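/- \textbf{Notation.} Points of $\mathbb R^6$ are written $(x,y)$ with $x,y\in\mathbb R^3$. Let $S=\frac1i\partial_t-\Delta_x-\Delta_y$ and $S_\pm=\frac1i\partial_t-\Delta_x+\Delta_y$ on $\mathbb R\times\mathbb R^6$. $|\nabla_x|^s$, $\langle\nabla_x\rangle^s$ are the Fourier multipliers with symbols $|\xi|^s$, $\langle\xi\rangle^s=(1+|\xi|^2)^{s/2}$ in the variable $x$ (similarly for $y$), and $|\nabla|_{x-y}^{1/2}$ is the one with symbol $|\xi-\eta|^{1/2}$, where $(\xi,\eta)$ is dual to $(x,y)$. Put $$\|f\|_{X_S^{b}}=\big\|(1+|\tau+|\xi|^2+|\eta|^2|)^{b}\hat f(\tau,\xi,\eta)\big\|_{L^2},\qquad \|f\|_{X_W^{b}}=\big\|(1+|\tau+|\xi|^2-|\eta|^2|)^{b}\hat f(\tau,\xi,\eta)\big\|_{L^2}.$$ $\Lambda,\Gamma,F$ denote tempered distributions on $\mathbb R\times\mathbb R^6$; the equations hold in the sense of distributions, and $\Lambda$, $\Gamma$ are continuous in $t$ with values in $\mathcal S'(\mathbb R^6)$ (weak topology), with values $\Lambda_0$,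 $\Gamma_0$ at $t=0$. A norm $\|m(D)f\|_{L^2}=\|m\hat f\|_{L^2}$ is $\infty$ if $\hat f$ is not a function. For a tempered distribution $u$ on $\mathbb R\times\mathbb R^6$, $u(t,x,x+z)$ denotes the value at $z$ of $u$ regarded as a continuous function of $z=y-x$ with values in $\mathcal S'(\mathbb R_t\times\mathbb R^3_x)$; in each estimate below, part of the claim is that, if the norm that bounds it is finite, the restriction in question exists in this sense. A cut-off function is a real $\chi\in C_0^\infty(\mathbb R)$. \textbf{Lemma (collapsing estimates).} (1) There is an absolute constant $C$ such that, if $S\Lambda=0$, then $$\|\Lambda(t,x,x)\|_{L^2(dt\,dx)}\le C\,\big\||\nabla|_{x-y}^{1/2}\Lambda_0\big\|_{L^2(dx\,dy)},$$ $$\big\||\nabla_x|^{1/2}\,\Lambda(t,x,x)\big\|_{L^2(dt\,dx)}\le C\,\big\||\nabla_x|^{1/2}|\nabla_y|^{1/2}\Lambda_0\big\|_{L^2(dx\,dy)}.$$ (2) For all $\epsilon,\delta>0$ there is $C_1=C_1(\epsilon,\delta)$, and for every cut-off function $\chi$ there is $C_2=C_2(\epsilon,\delta,\chi)$, such that, if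 $S\Lambda=F$, then $$\sup_{z\in\mathbb R^3}\big\|\langle\nabla_x\rangle^{\frac12+\epsilon}\chi(t)\Lambda(t,x,x+z)\big\|_{L^2(dt\,dx)} \le C_1\big\|\langle\nabla_x\rangle^{\frac12+\epsilon}\langle\nabla_y\rangle^{\frac12+\epsilon}\chi(t)\Lambda\big\|_{X_S^{1/2+\delta}},$$ $$\big\|\langle\nabla_x\rangle^{\frac12+\epsilon}\langle\nabla_y\rangle^{\frac12+\epsilon}\chi(t)\Lambda\big\|_{X_S^{1/2+\delta}} \le C_2\Big(\big\|\langle\nabla_x\rangle^{\frac12+\epsilon}\langle\nabla_y\rangle^{\frac12+\epsilon}\Lambda_0\big\|_{L^2} +\big\|\langle\nabla_x\rangle^{\frac12+\epsilon}\langle\nabla_y\rangle^{\frac12+\epsilon}F\big\|_{X_S^{-1/2+\delta}}\Big).$$ (3) For every $\epsilon>0$ there is $C=C(\epsilon)$ such that, if $S_\pm\Gamma=0$, then $$\big\||\nabla_x|^{\frac12+\epsilon}\Gamma(t,x,x)\big\|_{L^2(dt\,dx)}+\big\||\nabla_x|^{\frac12}\Gamma(t,x,x)\big\|_{L^2(dt\,dx)}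 \le C\big\|\langle\nabla_x\rangle^{\frac12+\epsilon}\langle\nabla_y\rangle^{\frac12+\epsilon}\Gamma_0\big\|_{L^2(dx\,dy)}.$$ (4) For all $\epsilon,\delta>0$ there is $C_1=C_1(\epsilon,\delta)$, and for every cut-off function $\chi$ there is $C_2=C_2(\epsilon,\delta,\chi)$, such that, if $S_\pm\Gamma=F$, then $$\sup_{z}\big\||\nabla_x|^{\frac12+\epsilon}\chi(t)\Gamma(t,x,x+z)\big\|_{L^2(dt\,dx)} +\sup_{z}\big\||\nabla_x|^{\frac12}\chi(t)\Gamma(t,x,x+z)\big\|_{L^2(dt\,dx)} \le C_1\big\|\langle\nabla_x\rangle^{\frac12+\epsilon}\langle\nabla_y\rangle^{\frac12+\epsilon}\chi(t)\Gamma\big\|_{X_W^{1/2+\delta}},$$ $$\big\|\langle\nabla_x\rangle^{\frac12+\epsilon}\langle\nabla_y\rangle^{\frac12+\epsilon}\chi(t)\Gamma\big\|_{X_W^{1/2+\delta}} \le C_2\Big(\big\|\langle\nabla_x\rangle^{\frac12+\epsilon}\langle\nabla_y\rangle^{\frac12+\epsilon}\Gamma_0\big\|_{L^2} +\big\|\langle\nabla_x\rangle^{\frac12+\epsilon}\langle\nabla_y\rangle^{\frac12+\epsilon}F\big\|_{X_W^{-1/2+\delta}}\Big).$$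 -/

import Mathlib

open MeasureTheory FourierTransform LineDeriv
open scoped SchwartzMap ENNReal NNReal ContDiff

noncomputable section

namespace Collapsing

/-- `ℝ³` with its Euclidean norm. -/
abbrev R3 : Type := EuclideanSpace ℝ (Fin 3)

/-- `ℝ³ × ℝ³` (points `(x, y)`) with its Euclidean structure. -/
abbrev R6 : Type := WithLp 2 (R3 × R3)

/-- Space-time `ℝ × ℝ³` (points `(t, x)`) with its Euclidean structure. -/
abbrev R4 : Type := WithLp 2 (ℝ × R3)

/-- Space-time `ℝ × (ℝ³ × ℝ³)` (points `(t, (x, y))`) with its Euclidean structure. -/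
abbrev R7 : Type := WithLp 2 (ℝ × R6)

/-! ### Norms defined by a weight on the Fourier side -/

section Norms

variable {E : Type*} [NormedAddCommGroup E] [InnerProductSpace ℝ E] [FiniteDimensional ℝ E]
  [MeasurableSpace E] [BorelSpace E]

/-- The Fourier transform of the tempered distribution `u` is the function `g`. (Mathlib's
Fourier transform has the kernel `exp (-2πi ⟨x, ξ⟩)`, so `ξ` stands for the angular frequency
`2π ξ`; this is taken into account in all the symbols below.) -/
def HasFourierFunction (u : 𝓢'(E, ℂ)) (g : E → ℂ) : Prop :=
  AEStronglyMeasurable g volume ∧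
    ∀ φ : 𝓢(E, ℂ), Integrable (fun ξ => φ ξ * g ξ) volume ∧ (𝓕 u) φ = ∫ ξ, φ ξ * g ξ

/-- `‖m(D) u‖_{L²} = ‖m û‖_{L²}` for the Fourier multiplier `m(D)` with the symbol `m`; it is `∞`
if `û` is not a function. -/
def fourierNorm (m : E → ℝ) (u : 𝓢'(E, ℂ)) : ℝ≥0∞ :=
  ⨅ (g : E → ℂ) (_ : HasFourierFunction u g), eLpNorm (fun ξ => (m ξ : ℂ) * g ξ) 2 volume

/-- `‖u‖_{L²}`; it is `∞` if `u` is not (given by) a function in `L²`. -/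
def l2Norm (u : 𝓢'(E, ℂ)) : ℝ≥0∞ :=
  ⨅ (f : Lp ℂ 2 (volume : Measure E)) (_ : (f : 𝓢'(E, ℂ)) = u), ‖f‖ₑ

end Norms

/-! ### Symbols -/

/-- The symbol `|ξ|^s` of `|∇|^s`. -/
def homSymbol (s : ℝ) (ξ : R3) : ℝ := ‖(2 * Real.pi) • ξ‖ ^ s

/-- The symbol `⟨ξ⟩^s = (1 + |ξ|²)^{s/2}` of `⟨∇⟩^s`. -/
def japSymbol (s : ℝ) (ξ : R3) : ℝ := (1 + ‖(2 * Real.pi) • ξ‖ ^ 2) ^ (s / 2)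

/-- The symbol `⟨ξ⟩^s ⟨η⟩^s` of `⟨∇_x⟩^s ⟨∇_y⟩^s`. -/
def japSymbol2 (s : ℝ) (p : R6) : ℝ := japSymbol s p.fst * japSymbol s p.snd

/-- The symbol `τ + |ξ|² + |η|²` of `S`. -/
def symbolS (p : R7) : ℝ :=
  2 * Real.pi * p.fst + ‖(2 * Real.pi) • p.snd.fst‖ ^ 2 + ‖(2 * Real.pi) • p.snd.snd‖ ^ 2

/-- The symbol `τ + |ξ|² - |η|²` of `S_±`. -/
def symbolW (p : R7) : ℝ :=
  2 * Real.pi * p.fst + ‖(2 * Real.pi) • p.snd.fst‖ ^ 2 - ‖(2 * Real.pi) • p.snd.snd‖ ^ 2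

/-- `‖⟨∇_x⟩^s ⟨∇_y⟩^s u‖` in the space `X_S^b`. -/
def normXS (s b : ℝ) (u : 𝓢'(R7, ℂ)) : ℝ≥0∞ :=
  fourierNorm (fun p => (1 + |symbolS p|) ^ b * japSymbol2 s p.snd) u

/-- `‖⟨∇_x⟩^s ⟨∇_y⟩^s u‖` in the space `X_W^b`. -/
def normXW (s b : ℝ) (u : 𝓢'(R7, ℂ)) : ℝ≥0∞ :=
  fourierNorm (fun p => (1 + |symbolW p|) ^ b * japSymbol2 s p.snd) u

/-! ### The operators `S` and `S_±` -/

/-- The unit vector of the variable `t`. -/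
def unitT : R7 := WithLp.toLp 2 (1, 0)

/-- The unit vector of the variable `x_i`. -/
def unitX (i : Fin 3) : R7 := WithLp.toLp 2 (0, WithLp.toLp 2 (EuclideanSpace.single i 1, 0))

/-- The unit vector of the variable `y_i`. -/
def unitY (i : Fin 3) : R7 := WithLp.toLp 2 (0, WithLp.toLp 2 (0, EuclideanSpace.single i 1))

/-- The Laplacian in `x`, on distributions in `(t, x, y)`. -/
def laplaceX (u : 𝓢'(R7, ℂ)) : 𝓢'(R7, ℂ) := ∑ i : Fin 3, ∂_{unitX i} (∂_{unitX i} u)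

/-- The Laplacian in `y`, on distributions in `(t, x, y)`. -/
def laplaceY (u : 𝓢'(R7, ℂ)) : 𝓢'(R7, ℂ) := ∑ i : Fin 3, ∂_{unitY i} (∂_{unitY i} u)

/-- `S = (1/i) ∂_t - Δ_x - Δ_y`. -/
def opS (u : 𝓢'(R7, ℂ)) : 𝓢'(R7, ℂ) :=
  (1 / Complex.I) • (∂_{unitT} u) - laplaceX u - laplaceY u

/-- `S_± = (1/i) ∂_t - Δ_x + Δ_y`. -/
def opW (u : 𝓢'(R7, ℂ)) : 𝓢'(R7, ℂ) :=
  (1 / Complex.I) • (∂_{unitT} u) - laplaceX u + laplaceY u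

/-- The product `χ(t) u`. -/
def cutoff (χ : ℝ → ℝ) (u : 𝓢'(R7, ℂ)) : 𝓢'(R7, ℂ) :=
  TemperedDistribution.smulLeftCLM ℂ (fun p : R7 => (χ p.fst : ℂ)) u

/-- The multiplier in `cutoff` has temperate growth, so that `cutoff` is the actual product. -/
theorem hasTemperateGrowth_cutoff {χ : ℝ → ℝ} (h : ContDiff ℝ ∞ χ) (hc : HasCompactSupport χ) :
    (fun p : R7 => (χ p.fst : ℂ)).HasTemperateGrowth := by
  have h0 : ContDiff ℝ ∞ (fun t : ℝ => (χ t : ℂ)) := Complex.ofRealCLM.contDiff.comp h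
  have h1 : (fun t : ℝ => (χ t : ℂ)).HasTemperateGrowth :=
    (HasCompactSupport.toSchwartzMap (f := fun t : ℝ => (χ t : ℂ))
      (hc.comp_left (g := Complex.ofReal) rfl) h0).hasTemperateGrowth
  have h2 : (fun p : R7 => p.fst).HasTemperateGrowth :=
    (WithLp.fstL 2 ℝ ℝ R6).hasTemperateGrowth
  exact h1.comp h2

/-! ### Restriction of distributions -/

/-- Let `(a, b) : E → V × W` be a linear change of coordinates with Jacobian `1`. The distribution
`u` is, in the coordinates `(a, b)`, a continuous function of `a ∈ V` with values in the tempered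
distributions of `b ∈ W`, and `G v` is its restriction to `a = v`: for all `φ ∈ C_c^∞(V)`,
`ψ ∈ 𝓢(W)`, one has `⟨u, φ(a) ψ(b)⟩ = ∫ φ(v) ⟨G v, ψ⟩ dv`. A continuous family `G` with this
property is unique. -/
def IsRestriction {E V W : Type*} [NormedAddCommGroup E] [NormedSpace ℝ E]
    [NormedAddCommGroup V] [NormedSpace ℝ V] [MeasureSpace V]
    [NormedAddCommGroup W] [NormedSpace ℝ W]
    (a : E → V) (b : E → W) (u : 𝓢'(E, ℂ)) (G : V → 𝓢'(W, ℂ)) : Prop :=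
  Continuous G ∧
    ∀ (φ : 𝓢(V, ℂ)) (ψ : 𝓢(W, ℂ)) (Φ : 𝓢(E, ℂ)), HasCompactSupport φ →
      (∀ p : E, Φ p = φ (a p) * ψ (b p)) → u Φ = ∫ v, φ v * G v ψ

/-- `u(0, x, y) = u₀(x, y)`, where `u` is continuous in `t` with values in the tempered
distributions of `(x, y)`. -/
def HasInitialValue (u : 𝓢'(R7, ℂ)) (u₀ : 𝓢'(R6, ℂ)) : Prop :=
  ∃ U : ℝ → 𝓢'(R6, ℂ), IsRestriction (fun p : R7 => p.fst) (fun p : R7 => p.snd) u U ∧ U 0 = u₀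

/-- `u` is continuous in `z = y - x` with values in the tempered distributions of `(t, x)`, and
`G z` is the collapsed distribution `u(t, x, x + z)`. -/
def IsCollapse (u : 𝓢'(R7, ℂ)) (G : R3 → 𝓢'(R4, ℂ)) : Prop :=
  IsRestriction (fun p : R7 => p.snd.snd - p.snd.fst)
    (fun p : R7 => (WithLp.toLp 2 (p.fst, p.snd.fst) : R4)) u G

end Collapsing

end

open Collapsing

/-! On the Fourier side, passing to `y = x + z` pushes the frequency `(τ, ξ, η)` forward to `(τ, ξ +
η)`, after multiplication by a phase in `z` and `η` of modulus one. By duality in `L²`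
(Cauchy-Schwarz and Riesz), a bound of `m(D) u(t, x, x + z)` by `w(D)` of the data therefore
reduces, uniformly in `z`, to a weighted integral inequality for this projection,
`CollapseEstimate`. For a free solution the Fourier transform lives on the surface `τ = -q(ξ, η)`,
and what is needed is that `(m / w)²` has bounded integrals over the fibres of `(ξ, η) ↦ (-q, ξ +
η)`; this is `KernelBound`.

For `S` and fixed `ζ = ξ + η` the fibres are spheres in `ξ` centred at `ζ / 2`. The densities
`1/|ξ|`, `1/|η|`, `1/|ξ - η|` have bounded integrals over them (`lintegral_inv_norm_comp_le`), and
each quotient `(m / w)²` is at most a constant times one of these or a sum of two. For `S_±` the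
quantity `|ξ|² - |ζ - ξ|²` is linear in `ξ`, so the fibres are planes orthogonal to `ζ`. The factor
`1/|ζ|` from the change of variables is compensated by `|ζ|` in `m²`, and what remains is at most a
constant times `(1 + ρ²)^{-(1+ε)}`, where `ρ` is the distance to the line `ℝζ`; this is integrable
over a plane (`exists_lintegral_wave_slice_le`). The powers `1/2` and `1/2 + ε` are treated together
through the larger symbol.

For `X^b` norms with `b > 1/2`, space-time frequencies are foliated by the translates `τ + q = s` of
the surface. Each translate obeys the same fibre bound, and the square of the inverse weight is
integrable in `s` (`KernelBound.spaceTime`).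

Both the free estimates and the `X^b` bound of the cut-off solution rest on an explicit formula for
the Fourier transform of a solution in terms of its initial value and the source,
`fourier_representation`. A test function is split into one divisible by `τ + q`, to which the
equation applies, and a multiple of its restriction to `τ = -q`, which is tested by mollifying in
time at `t = 0`. Multiplication by `χ(t)` is convolution in `τ`, so the formula becomes Duhamel's
with an explicit kernel. The kernel is controlled by a convolution with an integrable function plus
a rank-one term (`exists_lintegral_cutoffKernel_le`). -/

noncomputable section

namespace Collapsing

open Set Filter Topology

/-! ### Smooth dependence of integrals over `[0, 1]` on a parameter. -/

section ParametricIntegral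

theorem contDiff_fderiv_slice {E F : Type} [NormedAddCommGroup E] [NormedSpace ℝ E]
    [NormedAddCommGroup F] [NormedSpace ℝ F]
    {f : ℝ × E → F} (hf : ContDiff ℝ ∞ f) :
    ContDiff ℝ ∞ (fun y : ℝ × E => fderiv ℝ (fun x => f (y.1, x)) y.2) := by
  have : ContDiff ℝ ∞ (Function.uncurry fun (y : ℝ × E) (x : E) => f (y.1, x)) := by
    unfold Function.uncurry
    fun_prop
  exact this.fderiv contDiff_snd (by simp)

variable {E : Type} [NormedAddCommGroup E] [NormedSpace ℝ E] [FiniteDimensional ℝ E]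

theorem hasFDerivAt_integral_slice {F : Type} [NormedAddCommGroup F] [NormedSpace ℝ F]
    [CompleteSpace F] {f : ℝ × E → F} (hf : ContDiff ℝ ∞ f) (x : E) :
    HasFDerivAt (fun x => ∫ s in (0 : ℝ)..1, f (s, x))
      (∫ s in (0 : ℝ)..1, fderiv ℝ (fun x => f (s, x)) x) x := by
  have hd := (contDiff_fderiv_slice hf).continuous
  -- In finite dimension closed balls are compact, so continuity of the derivative gives a constant
  -- that dominates it near `x`.
  obtain ⟨C, hC⟩ := ((isCompact_Icc (a := (0 : ℝ)) (b := 1)).prod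
    (isCompact_closedBall x 1)).exists_bound_of_continuousOn hd.continuousOn
  have hc := hf.continuous
  refine (intervalIntegral.hasFDerivAt_integral_of_dominated_of_fderiv_le
    (s := Metric.ball x 1) (bound := fun _ => C)
    (F := fun x s => f (s, x)) (F' := fun x s => fderiv ℝ (fun x => f (s, x)) x) (Metric.ball_mem_nhds x one_pos) ?_ ?_ ?_ ?_ ?_ ?_)
  · exact Eventually.of_forall fun y => (by fun_prop : Continuous fun s => f (s, y)).aestronglyMeasurable
  · exact (by fun_prop : Continuous fun s => f (s, x)).intervalIntegrable _ _
  · exact (hd.comp (by fun_prop : Continuous fun s : ℝ => (s, x))).aestronglyMeasurable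
  · refine Eventually.of_forall fun s hs y hy => hC (s, y) ⟨?_, Metric.ball_subset_closedBall hy⟩
    rw [uIoc_of_le zero_le_one] at hs
    exact Ioc_subset_Icc_self hs
  · exact intervalIntegrable_const
  · refine Eventually.of_forall fun s _ y _ => ?_
    have : ContDiff ℝ ∞ fun x => f (s, x) := by fun_prop
    exact (this.differentiable (by simp) y).hasFDerivAt

/-- The target `F` is quantified inside the induction because the derivative of the integral is
again such an integral, with values in `E →L[ℝ] F`. -/
theorem contDiff_integral_slice_nat (n : ℕ) : ∀ {F : Type} [NormedAddCommGroup F] [NormedSpace ℝ F]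
    [CompleteSpace F] {f : ℝ × E → F}, ContDiff ℝ ∞ f →
    ContDiff ℝ n (fun x => ∫ s in (0 : ℝ)..1, f (s, x)) := by
  induction n with
  | zero =>
    intro F _ _ _ f hf
    refine contDiff_zero.2 (continuous_iff_continuousAt.2 fun x => ?_)
    exact (hasFDerivAt_integral_slice hf x).continuousAt
  | succ n ih =>
    intro F _ _ _ f hf
    push_cast
    refine contDiff_succ_iff_fderiv.2
      ⟨fun x => (hasFDerivAt_integral_slice hf x).differentiableAt, by simp, ?_⟩
    convert ih (contDiff_fderiv_slice hf) using 1
    ext1 x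
    exact (hasFDerivAt_integral_slice hf x).fderiv

theorem contDiff_integral_slice {F : Type} [NormedAddCommGroup F] [NormedSpace ℝ F]
    [CompleteSpace F] {f : ℝ × E → F} (hf : ContDiff ℝ ∞ f) :
    ContDiff ℝ ∞ (fun x => ∫ s in (0 : ℝ)..1, f (s, x)) :=
  contDiff_infty.2 fun n => contDiff_integral_slice_nat n hf

theorem norm_iteratedFDeriv_integral_slice_le (n : ℕ) : ∀ {F : Type} [NormedAddCommGroup F]
    [NormedSpace ℝ F] [CompleteSpace F] {f : ℝ × E → F}, ContDiff ℝ ∞ f → ∀ (x : E) (B : ℝ),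
    (∀ s ∈ Icc (0 : ℝ) 1, ‖iteratedFDeriv ℝ n (fun x => f (s, x)) x‖ ≤ B) →
    ‖iteratedFDeriv ℝ n (fun x => ∫ s in (0 : ℝ)..1, f (s, x)) x‖ ≤ B := by
  induction n with
  | zero =>
    intro F _ _ _ f hf x B hB
    simp only [norm_iteratedFDeriv_zero] at hB ⊢
    refine (intervalIntegral.norm_integral_le_of_norm_le_const (C := B) fun s hs => hB s ?_).trans
      (by simp)
    rw [uIoc_of_le zero_le_one] at hs
    exact Ioc_subset_Icc_self hs
  | succ n ih =>
    intro F _ _ _ f hf x B hB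
    rw [← norm_iteratedFDeriv_fderiv]
    have : fderiv ℝ (fun x => ∫ s in (0 : ℝ)..1, f (s, x)) =
        fun x => ∫ s in (0 : ℝ)..1, fderiv ℝ (fun x => f (s, x)) x :=
      funext fun x => (hasFDerivAt_integral_slice hf x).fderiv
    rw [this]
    refine ih (contDiff_fderiv_slice hf) x B fun s hs => ?_
    have h2 := hB s hs
    rwa [← norm_iteratedFDeriv_fderiv] at h2

end ParametricIntegral

/-! ### Hadamard's lemma. -/

section Hadamard

theorem norm_iteratedFDeriv_comp_le_of_norm_le_one {E E' F : Type*} [NormedAddCommGroup E]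
    [NormedSpace ℝ E] [NormedAddCommGroup E'] [NormedSpace ℝ E'] [NormedAddCommGroup F]
    [NormedSpace ℝ F] {f : E' → F} (hf : ContDiff ℝ ∞ f) (L : E →L[ℝ] E') (hL : ‖L‖ ≤ 1) (n : ℕ)
    (x : E) :
    ‖iteratedFDeriv ℝ n (fun x => f (L x)) x‖ ≤ ‖iteratedFDeriv ℝ n f (L x)‖ := by
  have h1 : (fun x => f (L x)) = f ∘ L := rfl
  rw [h1, ContinuousLinearMap.iteratedFDeriv_comp_right L hf x (i := n) (mod_cast le_top)]
  refine (ContinuousMultilinearMap.norm_compContinuousLinearMap_le _ _).trans ?_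
  exact mul_le_of_le_one_right (norm_nonneg _)
    (Finset.prod_le_one (fun _ _ => norm_nonneg _) fun _ _ => hL)

variable {E : Type} [NormedAddCommGroup E] [NormedSpace ℝ E] [FiniteDimensional ℝ E]

/-- The family of linear maps `s A + B`. -/
theorem exists_hadamard_quotient (A B : E →L[ℝ] E) (hAB : ∀ s ∈ Icc (0 : ℝ) 1, ‖s • A + B‖ ≤ 1)
    (e : E) (l : E → ℝ) (hA : ∀ x, A x = l x • e) {Φ : E → ℂ} (hΦ : ContDiff ℝ ∞ Φ) :
    ∃ Ψ : E → ℂ, ContDiff ℝ ∞ Ψ ∧ (∀ x, Φ ((A + B) x) - Φ (B x) = l x * Ψ x) ∧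
      ∀ n x C, (∀ s ∈ Icc (0 : ℝ) 1,
        ‖iteratedFDeriv ℝ (n + 1) Φ ((s • A + B) x)‖ ≤ C) →
        ‖iteratedFDeriv ℝ n Ψ x‖ ≤ C * ‖e‖ := by
  have hg : ContDiff ℝ ∞ fun y => fderiv ℝ Φ y e :=
    (hΦ.fderiv_right (m := ∞) (by simp)).clm_apply contDiff_const
  have hf : ContDiff ℝ ∞ fun y : ℝ × E => fderiv ℝ Φ ((y.1 • A + B) y.2) e := by
    have : ContDiff ℝ ∞ fun y : ℝ × E => (y.1 • A + B) y.2 := by fun_prop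
    exact hg.comp this
  -- The quotient is the mean of the derivative in the direction `e` along the segment from `B x` to
  -- `(A + B) x`; the identity is the fundamental theorem of calculus on that segment.
  refine ⟨fun x => ∫ s in (0 : ℝ)..1, fderiv ℝ Φ ((s • A + B) x) e, contDiff_integral_slice hf,
    fun x => ?_, fun n x C hC => ?_⟩
  · have hder : ∀ s ∈ uIcc (0 : ℝ) 1, HasDerivAt (fun s : ℝ => Φ ((s • A + B) x))
        (l x * fderiv ℝ Φ ((s • A + B) x) e) s := by
      intro s _
      have h1 : HasDerivAt (fun s : ℝ => (s • A + B) x) (A x) s := by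
        simpa using ((hasDerivAt_id s).smul_const (A x)).add_const (B x)
      have h2 := ((hΦ.differentiable (by simp) ((s • A + B) x)).hasFDerivAt.comp_hasDerivAt s h1)
      rw [hA, map_smul] at h2
      simpa [Function.comp_def] using h2
    have hc : Continuous fun s : ℝ => (l x : ℂ) * fderiv ℝ Φ ((s • A + B) x) e :=
      continuous_const.mul (hf.continuous.comp (by fun_prop : Continuous fun s : ℝ => (s, x)))
    have := intervalIntegral.integral_eq_sub_of_hasDerivAt hder (hc.intervalIntegrable _ _)
    rw [intervalIntegral.integral_const_mul] at this
    simpa using this.symm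
  · refine norm_iteratedFDeriv_integral_slice_le n hf x _ fun s hs => ?_
    refine (norm_iteratedFDeriv_comp_le_of_norm_le_one hg (s • A + B) (hAB s hs) n x).trans ?_
    refine (norm_iteratedFDeriv_clm_apply_const
      ((hΦ.fderiv_right (m := ∞) (by simp)).contDiffAt) (n := n) (mod_cast le_top)).trans ?_
    rw [norm_iteratedFDeriv_fderiv, mul_comm]
    gcongr
    exact hC s hs

end Hadamard

/-! ### Products with separate decay, and division by a coordinate in the Schwartz space. -/

section SchwartzProducts

variable {V : Type} [NormedAddCommGroup V] [NormedSpace ℝ V]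

theorem norm_fstL_le : ‖WithLp.fstL 2 ℝ ℝ V‖ ≤ 1 :=
  ContinuousLinearMap.opNorm_le_bound _ zero_le_one fun P => by
    simpa using WithLp.norm_fst_le _ P

theorem norm_sndL_le : ‖WithLp.sndL 2 ℝ ℝ V‖ ≤ 1 :=
  ContinuousLinearMap.opNorm_le_bound _ zero_le_one fun P => by
    simpa using WithLp.norm_snd_le _ P

theorem withLp_prod_ext {α β : Type*} {P Q : WithLp 2 (α × β)} (h1 : P.fst = Q.fst)
    (h2 : P.snd = Q.snd) : P = Q :=
  WithLp.ofLp_injective 2 (Prod.ext h1 h2)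

theorem norm_le_fst_add_snd {V : Type*} [NormedAddCommGroup V] (P : WithLp 2 (ℝ × V)) : ‖P‖ ≤ ‖P.fst‖ + ‖P.snd‖ := by
  rw [WithLp.prod_norm_eq_of_L2]
  refine Real.sqrt_le_iff.2 ⟨by positivity, ?_⟩
  nlinarith [norm_nonneg P.fst, norm_nonneg P.snd]

/-- One factor supplies the decay in the first variable, the other in the second. In Leibniz'
formula `‖P‖ ^ k` is split into powers of the two components, and the factor that is not needed for
decay is used with `k = 0`, that is, through bounded derivatives. -/
theorem exists_schwartzMap_mul {u v : WithLp 2 (ℝ × V) → ℂ} (hu : ContDiff ℝ ∞ u)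
    (hv : ContDiff ℝ ∞ v)
    (hu' : ∀ k n : ℕ, ∃ C : ℝ, ∀ P, ‖P.fst‖ ^ k * ‖iteratedFDeriv ℝ n u P‖ ≤ C)
    (hv' : ∀ k n : ℕ, ∃ C : ℝ, ∀ P, ‖P.snd‖ ^ k * ‖iteratedFDeriv ℝ n v P‖ ≤ C) :
    ∃ Φ : 𝓢(WithLp 2 (ℝ × V), ℂ), ∀ P, Φ P = u P * v P := by
  choose Cu hCu using hu'
  choose Cv hCv using hv'
  refine ⟨⟨fun P => u P * v P, hu.mul hv, fun k n => ?_⟩, fun P => rfl⟩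
  refine ⟨∑ i ∈ Finset.range (n + 1), (n.choose i : ℝ) * (2 ^ (k - 1) *
    (Cu k i * Cv 0 (n - i) + Cu 0 i * Cv k (n - i))), fun P => ?_⟩
  refine (mul_le_mul_of_nonneg_left (norm_iteratedFDeriv_mul_le hu hv P (n := n)
    (mod_cast le_top)) (by positivity)).trans ?_
  rw [Finset.mul_sum]
  refine Finset.sum_le_sum fun i _ => ?_
  have h1 : ‖P‖ ^ k ≤ 2 ^ (k - 1) * (‖P.fst‖ ^ k + ‖P.snd‖ ^ k) :=
    (pow_le_pow_left₀ (norm_nonneg _) (norm_le_fst_add_snd P) k).trans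
      (add_pow_le (norm_nonneg _) (norm_nonneg _) k)
  have a1 := hCu k i P
  have a2 := hCu 0 i P
  have b1 := hCv k (n - i) P
  have b2 := hCv 0 (n - i) P
  simp only [pow_zero, one_mul] at a2 b2
  set U := ‖iteratedFDeriv ℝ i u P‖
  set W := ‖iteratedFDeriv ℝ (n - i) v P‖
  have hU : 0 ≤ U := norm_nonneg _
  have hW : 0 ≤ W := norm_nonneg _
  have e1 : (‖P.fst‖ ^ k * U) * W ≤ Cu k i * Cv 0 (n - i) :=
    mul_le_mul a1 b2 hW ((by positivity : (0:ℝ) ≤ ‖P.fst‖ ^ k * U).trans a1)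
  have e2 : U * (‖P.snd‖ ^ k * W) ≤ Cu 0 i * Cv k (n - i) :=
    mul_le_mul a2 b1 (by positivity) (hU.trans a2)
  calc ‖P‖ ^ k * ((n.choose i : ℝ) * U * W)
      ≤ (2 ^ (k - 1) * (‖P.fst‖ ^ k + ‖P.snd‖ ^ k)) * ((n.choose i : ℝ) * U * W) := by gcongr
    _ = (n.choose i : ℝ) * (2 ^ (k - 1) * ((‖P.fst‖ ^ k * U) * W + U * (‖P.snd‖ ^ k * W))) := by
        ring
    _ ≤ _ := by gcongr

theorem fst_decay (a : 𝓢(ℝ, ℂ)) (k n : ℕ) : ∃ C : ℝ, ∀ P : WithLp 2 (ℝ × V),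
    ‖P.fst‖ ^ k * ‖iteratedFDeriv ℝ n (fun P : WithLp 2 (ℝ × V) => a P.fst) P‖ ≤ C := by
  obtain ⟨C, hC⟩ := a.decay' k n
  refine ⟨C, fun P => le_trans ?_ (hC P.fst)⟩
  gcongr
  exact norm_iteratedFDeriv_comp_le_of_norm_le_one (a.smooth ⊤) (WithLp.fstL 2 ℝ ℝ V)
    norm_fstL_le n P

theorem contDiff_comp_fst {a : ℝ → ℂ} (ha : ContDiff ℝ ∞ a) :
    ContDiff ℝ ∞ (fun P : WithLp 2 (ℝ × V) => a P.fst) :=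
  ha.comp (WithLp.fstL 2 ℝ ℝ V).contDiff

/-- Tensor products of Schwartz functions are Schwartz functions. -/
theorem exists_schwartzMap_tensor (a : 𝓢(ℝ, ℂ)) (ψ : 𝓢(V, ℂ)) :
    ∃ Φ : 𝓢(WithLp 2 (ℝ × V), ℂ), ∀ P, Φ P = a P.fst * ψ P.snd := by
  refine exists_schwartzMap_mul (u := fun P => a P.fst) (v := fun P => ψ P.snd)
    (contDiff_comp_fst (a.smooth ⊤))
    ((ψ.smooth ⊤).comp (WithLp.sndL 2 ℝ ℝ V).contDiff) (fst_decay a) fun k n => ?_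
  obtain ⟨C, hC⟩ := ψ.decay' k n
  refine ⟨C, fun P => le_trans ?_ (hC P.snd)⟩
  gcongr
  exact norm_iteratedFDeriv_comp_le_of_norm_le_one (ψ.smooth ⊤) (WithLp.sndL 2 ℝ ℝ V)
    norm_sndL_le n P

/-- Hadamard's lemma on the line: the `n`-th derivative of `r` is bounded by the supremum of the `(n
+ 1)`-st derivative of `a`. -/
theorem exists_quotient_sub_one (a : 𝓢(ℝ, ℂ)) (ha : a 0 = 1) :
    ∃ r : ℝ → ℂ, r.HasTemperateGrowth ∧ ∀ s, a s - 1 = s * r s := by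
  obtain ⟨r, hr, hr1, hr2⟩ := exists_hadamard_quotient (ContinuousLinearMap.id ℝ ℝ) 0
    (fun s hs => by
      rw [add_zero]
      rw [norm_smul, ContinuousLinearMap.norm_id, mul_one, Real.norm_of_nonneg hs.1]
      exact hs.2) 1 id (fun x => by simp) (a.smooth ⊤)
  refine ⟨r, ⟨hr, fun n => ?_⟩, fun s => by simpa [ha] using hr1 s⟩
  obtain ⟨C, -, hC⟩ := a.decay 0 (n + 1)
  refine ⟨0, C, fun x => ?_⟩
  have := hr2 n x C fun s _ => by simpa using hC _
  simpa using this

variable [FiniteDimensional ℝ V]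

/-- Without the factor `a` the difference would not decay in the first variable. With `Φ(t, p) -
Φ(0, p) = t Ψ` and `a - 1 = t r`, the difference is `a (Φ - Φ(0, ·)) + (1 - a) Φ = t (a Ψ - r Φ)`.
Here `Ψ` decays in `p` only, and `a` provides the decay in `t`. -/
theorem hadamard_schwartzMap (a : 𝓢(ℝ, ℂ)) (ha : a 0 = 1) (Φ : 𝓢(WithLp 2 (ℝ × V), ℂ)) :
    ∃ Θ : 𝓢(WithLp 2 (ℝ × V), ℂ), ∀ P,
      Φ P - a P.fst * Φ (WithLp.toLp 2 (0, P.snd)) = P.fst * Θ P := by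
  obtain ⟨r, hr, hr1⟩ := exists_quotient_sub_one a ha
  let i₁ : ℝ →L[ℝ] WithLp 2 (ℝ × V) :=
    (WithLp.prodContinuousLinearEquiv 2 ℝ ℝ V).symm.toContinuousLinearMap ∘L
      ContinuousLinearMap.inl ℝ ℝ V
  let i₂ : V →L[ℝ] WithLp 2 (ℝ × V) :=
    (WithLp.prodContinuousLinearEquiv 2 ℝ ℝ V).symm.toContinuousLinearMap ∘L
      ContinuousLinearMap.inr ℝ ℝ V
  let A := i₁ ∘L WithLp.fstL 2 ℝ ℝ V
  let B := i₂ ∘L WithLp.sndL 2 ℝ ℝ V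
  have hAB : ∀ (s : ℝ) P, (s • A + B) P = WithLp.toLp 2 (s * P.fst, P.snd) := by
    intro s P
    apply withLp_prod_ext <;> simp [A, B, i₁, i₂]
  obtain ⟨Ψ, hΨ, hΨ1, hΨ2⟩ := exists_hadamard_quotient A B
    (fun s hs => ContinuousLinearMap.opNorm_le_bound _ zero_le_one fun P => by
      rw [hAB, one_mul, WithLp.prod_norm_eq_of_L2, WithLp.prod_norm_eq_of_L2]
      refine Real.sqrt_le_sqrt ?_
      change ‖s * P.fst‖ ^ 2 + ‖P.snd‖ ^ 2 ≤ _
      rw [norm_mul]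
      gcongr
      refine mul_le_of_le_one_left (norm_nonneg _) ?_
      rw [Real.norm_of_nonneg hs.1]
      exact hs.2) (WithLp.toLp 2 (1, 0)) (fun P => P.fst) (fun P => by
        apply withLp_prod_ext <;> simp [A, i₁]) (Φ.smooth ⊤)
  obtain ⟨Θ₁, hΘ₁⟩ := exists_schwartzMap_mul (u := fun P => a P.fst) (v := Ψ)
    (contDiff_comp_fst (a.smooth ⊤)) hΨ (fst_decay a) fun k n => by
      obtain ⟨C, -, hC⟩ := Φ.decay k (n + 1)
      refine ⟨C * ‖(WithLp.toLp 2 (1, 0) : WithLp 2 (ℝ × V))‖, fun P => ?_⟩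
      rcases eq_or_ne (‖P.snd‖ ^ k) 0 with h0 | h0
      · rw [h0, zero_mul]
        have : 0 ≤ C := le_trans (by positivity) (hC 0)
        positivity
      · have hpos : 0 < ‖P.snd‖ ^ k := lt_of_le_of_ne (by positivity) h0.symm
        rw [mul_comm, ← le_div_iff₀ hpos, mul_div_right_comm]
        refine hΨ2 n P _ fun s _ => ?_
        -- The segment from `(0, p)` to `(t, p)` keeps the component `p`, so `|p|` is at most the
        -- norm of each of its points and the decay of `Φ` passes to `Ψ`.
        rw [le_div_iff₀ hpos, mul_comm]
        refine le_trans ?_ (hC ((s • A + B) P))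
        gcongr
        rw [hAB]
        exact WithLp.norm_snd_le _ (WithLp.toLp 2 (s * P.fst, P.snd))
  have hr' : (fun P : WithLp 2 (ℝ × V) => r P.fst).HasTemperateGrowth :=
    hr.comp (WithLp.fstL 2 ℝ ℝ V).hasTemperateGrowth
  refine ⟨Θ₁ - SchwartzMap.smulLeftCLM ℂ (fun P => r P.fst) Φ, fun P => ?_⟩
  have h1 := hΨ1 P
  have h2 : (A + B) P = P := by
    have := hAB 1 P
    rw [one_smul ℝ A, one_mul] at this
    exact this
  have h3 : B P = WithLp.toLp 2 (0, P.snd) := by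
    have := hAB 0 P
    rw [zero_smul ℝ A, zero_add, zero_mul] at this
    exact this
  rw [h2, h3] at h1
  have h4 := hr1 P.fst
  simp only [sub_apply, hΘ₁, SchwartzMap.smulLeftCLM_apply_apply hr', smul_eq_mul]
  linear_combination (a P.fst) * h1 - Φ P * h4

end SchwartzProducts

/-! ### Uniform bounds for a distribution on a family of test functions. -/

section UniformBounds

variable {V : Type} [NormedAddCommGroup V] [NormedSpace ℝ V]

theorem HasTemperateGrowth.slice {G : ℝ × V → ℂ} (hG : G.HasTemperateGrowth) (l : ℝ) :
    (fun x => G (l, x)).HasTemperateGrowth := by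
  have : (fun x : V => ((l, x) : ℝ × V)).HasTemperateGrowth := by
    have h := (Function.HasTemperateGrowth.const ((l, 0) : ℝ × V)).add
      (ContinuousLinearMap.inr ℝ ℝ V).hasTemperateGrowth
    convert h using 1
    ext x <;> simp
  exact hG.comp this

theorem norm_iteratedFDeriv_slice_le {G : ℝ × V → ℂ} (hG : ContDiff ℝ ∞ G) (l : ℝ) (n : ℕ)
    (x : V) : ‖iteratedFDeriv ℝ n (fun x => G (l, x)) x‖ ≤ ‖iteratedFDeriv ℝ n G (l, x)‖ := by
  have h := norm_iteratedFDeriv_comp_le_of_norm_le_one (f := fun y => G (y + (l, 0)))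
    (by fun_prop) (ContinuousLinearMap.inr ℝ ℝ V) (ContinuousLinearMap.norm_inr_le_one ℝ ℝ V) n x
  rw [iteratedFDeriv_comp_add_right] at h
  simpa using h

theorem exists_seminorm_slice_le {G : ℝ × V → ℂ} (hG : G.HasTemperateGrowth) (Ψ : 𝓢(V, ℂ))
    (k n : ℕ) : ∃ C : ℝ, ∀ l ∈ Icc (0 : ℝ) 1,
      SchwartzMap.seminorm ℂ k n (SchwartzMap.smulLeftCLM ℂ (fun x => G (l, x)) Ψ) ≤ C := by
  obtain ⟨N, C, hC0, hC⟩ := hG.norm_iteratedFDeriv_le_uniform n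
  let S := 2 ^ (N + k) * ((Finset.Iic (N + k, n)).sup (schwartzSeminormFamily ℝ V ℂ)) Ψ
  have hS : 0 ≤ S := by positivity
  refine ⟨∑ i ∈ Finset.range (n + 1), (n.choose i : ℝ) * (C * 2 ^ N * S), fun l hl => ?_⟩
  refine SchwartzMap.seminorm_le_bound ℂ k n _ (by positivity) fun x => ?_
  rw [SchwartzMap.smulLeftCLM_apply (HasTemperateGrowth.slice hG l)]
  have h0 := norm_iteratedFDeriv_mul_le (HasTemperateGrowth.slice hG l).1 (Ψ.smooth ⊤) x (n := n)
    (mod_cast le_top)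
  refine (mul_le_mul_of_nonneg_left h0 (by positivity)).trans ?_
  rw [Finset.mul_sum]
  refine Finset.sum_le_sum fun i hi => ?_
  have hi' : i ≤ n := Nat.lt_succ_iff.1 (Finset.mem_range.1 hi)
  have h1 : ‖iteratedFDeriv ℝ i (fun x => G (l, x)) x‖ ≤ C * (2 ^ N * (1 + ‖x‖) ^ N) := by
    refine (norm_iteratedFDeriv_slice_le hG.1 l i x).trans ((hC i hi' (l, x)).trans ?_)
    rw [← mul_pow]
    gcongr
    have : ‖(l, x)‖ ≤ 1 + ‖x‖ := by
      refine norm_prod_le_iff.2 ⟨?_, ?_⟩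
      · simp only [Real.norm_of_nonneg hl.1]
        linarith [hl.2, norm_nonneg x]
      · simp
    linarith [norm_nonneg x]
  have h2 : (1 + ‖x‖) ^ (N + k) * ‖iteratedFDeriv ℝ (n - i) Ψ x‖ ≤ S :=
    SchwartzMap.one_add_le_sup_seminorm_apply (𝕜 := ℝ) (m := (N + k, n)) le_rfl (Nat.sub_le n i) Ψ x
  calc ‖x‖ ^ k * ((n.choose i : ℝ) * ‖iteratedFDeriv ℝ i (fun x => G (l, x)) x‖ *
        ‖iteratedFDeriv ℝ (n - i) Ψ x‖)
      ≤ (1 + ‖x‖) ^ k * ((n.choose i : ℝ) * (C * (2 ^ N * (1 + ‖x‖) ^ N)) *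
        ‖iteratedFDeriv ℝ (n - i) Ψ x‖) := by
        gcongr
        linarith
    _ = (n.choose i : ℝ) * (C * 2 ^ N * ((1 + ‖x‖) ^ (N + k) *
        ‖iteratedFDeriv ℝ (n - i) Ψ x‖)) := by ring
    _ ≤ _ := by gcongr

/-- A tempered distribution is bounded by finitely many Schwartz seminorms, and each of these is
bounded for parameters in `[0, 1]`. A uniform bound is enough later, because the difference that has
to vanish carries an explicit factor `l`. -/
theorem exists_norm_apply_slice_le {G : ℝ × V → ℂ} (hG : G.HasTemperateGrowth) (T : 𝓢'(V, ℂ))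
    (Ψ : 𝓢(V, ℂ)) : ∃ C : ℝ, ∀ l ∈ Icc (0 : ℝ) 1,
      ‖T (SchwartzMap.smulLeftCLM ℂ (fun x => G (l, x)) Ψ)‖ ≤ C := by
  obtain ⟨s, C, -, hC⟩ := Seminorm.bound_of_continuous (schwartz_withSeminorms ℂ V ℂ)
    ((normSeminorm ℂ ℂ).comp (T : 𝓢(V, ℂ) →ₗ[ℂ] ℂ)) (continuous_norm.comp T.cont)
  choose D hD using fun m : ℕ × ℕ => exists_seminorm_slice_le hG Ψ m.1 m.2
  refine ⟨C * ∑ m ∈ s, D m, fun l hl => ?_⟩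
  have h1 := hC (SchwartzMap.smulLeftCLM ℂ (fun x => G (l, x)) Ψ)
  refine le_trans h1 ?_
  rw [smul_apply, NNReal.smul_def, smul_eq_mul]
  gcongr
  refine (Seminorm.le_def.1 (Seminorm.finset_sup_le_sum _ s) _).trans ?_
  rw [sum_apply]
  exact Finset.sum_le_sum fun m _ => hD m l hl

end UniformBounds

/-! ### Uniqueness of the Fourier function, and norms with weights. -/

section FourierNorm

variable {E : Type*} [NormedAddCommGroup E] [InnerProductSpace ℝ E] [FiniteDimensional ℝ E]
  [MeasurableSpace E] [BorelSpace E]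

/-- The product with a test function equal to `1` near the point is integrable. -/
theorem HasFourierFunction.locallyIntegrable {u : 𝓢'(E, ℂ)} {g : E → ℂ}
    (h : HasFourierFunction u g) : LocallyIntegrable g volume := by
  intro x
  let f : ContDiffBump x := ⟨1, 2, one_pos, one_lt_two⟩
  have hf : ContDiff ℝ ∞ fun y => (f y : ℂ) := Complex.ofRealCLM.contDiff.comp f.contDiff
  have hc : HasCompactSupport fun y => (f y : ℂ) :=
    f.hasCompactSupport.comp_left (g := Complex.ofReal) rfl
  refine ⟨Metric.ball x 1, Metric.ball_mem_nhds x one_pos, ?_⟩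
  refine ((h.2 (hc.toSchwartzMap hf)).1.integrableOn (s := Metric.ball x 1)).congr_fun
    (fun y hy => ?_) measurableSet_ball
  have : f y = 1 := f.one_of_mem_closedBall (Metric.ball_subset_closedBall hy)
  simp [this]

/-- Two Fourier functions have the same integrals against test functions. Hence the infimum in
`fourierNorm` runs over one class modulo null sets and can be computed from any representative. -/
theorem HasFourierFunction.ae_eq {u : 𝓢'(E, ℂ)} {g g' : E → ℂ}
    (h : HasFourierFunction u g) (h' : HasFourierFunction u g') : g =ᵐ[volume] g' := by
  have h0 := ae_eq_zero_of_integral_contDiff_smul_eq_zero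
    (h.locallyIntegrable.sub h'.locallyIntegrable) fun φ hφ hc => by
      have hφ' : ContDiff ℝ ∞ fun x => (φ x : ℂ) := Complex.ofRealCLM.contDiff.comp hφ
      have hc' : HasCompactSupport fun x => (φ x : ℂ) := hc.comp_left (g := Complex.ofReal) rfl
      obtain ⟨i1, e1⟩ := h.2 (hc'.toSchwartzMap hφ')
      obtain ⟨i2, e2⟩ := h'.2 (hc'.toSchwartzMap hφ')
      have := integral_sub i1 i2
      rw [← e1, ← e2, sub_self] at this
      rw [← this]
      refine integral_congr_ae (Eventually.of_forall fun x => ?_)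
      simp [mul_sub]
  filter_upwards [h0] with x hx
  exact sub_eq_zero.1 hx

theorem fourierNorm_eq {u : 𝓢'(E, ℂ)} {g : E → ℂ} (h : HasFourierFunction u g) (m : E → ℝ) :
    fourierNorm m u = eLpNorm (fun ξ => (m ξ : ℂ) * g ξ) 2 volume := by
  refine le_antisymm (iInf₂_le g h) (le_iInf₂ fun g' h' => le_of_eq (eLpNorm_congr_ae ?_))
  filter_upwards [h.ae_eq h'] with x hx
  rw [hx]

theorem HasFourierFunction.congr {u : 𝓢'(E, ℂ)} {g g' : E → ℂ} (h : HasFourierFunction u g)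
    (hg : g =ᵐ[volume] g') : HasFourierFunction u g' := by
  refine ⟨h.1.congr hg, fun φ => ?_⟩
  have : (fun ξ => φ ξ * g ξ) =ᵐ[volume] fun ξ => φ ξ * g' ξ := by
    filter_upwards [hg] with x hx
    rw [hx]
  exact ⟨(h.2 φ).1.congr this, by rw [(h.2 φ).2, integral_congr_ae this]⟩

theorem exists_hasFourierFunction {u : 𝓢'(E, ℂ)} {m : E → ℝ} (h : fourierNorm m u ≠ ⊤) :
    ∃ g : E → ℂ, StronglyMeasurable g ∧ HasFourierFunction u g ∧
      eLpNorm (fun ξ => (m ξ : ℂ) * g ξ) 2 volume = fourierNorm m u := by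
  have : ∃ g, HasFourierFunction u g := by
    by_contra! hne
    exact h (by simp [fourierNorm, hne])
  obtain ⟨g, hg⟩ := this
  exact ⟨hg.1.mk g, hg.1.stronglyMeasurable_mk, hg.congr hg.1.ae_eq_mk,
    (fourierNorm_eq (hg.congr hg.1.ae_eq_mk) m).symm⟩

theorem fourierNorm_mono {m m' : E → ℝ} (h : ∀ ξ, |m ξ| ≤ |m' ξ|) (u : 𝓢'(E, ℂ)) :
    fourierNorm m u ≤ fourierNorm m' u := by
  refine le_iInf₂ fun g hg => (iInf₂_le g hg).trans (eLpNorm_mono fun x => ?_)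
  simp only [norm_mul, Complex.norm_real, Real.norm_eq_abs]
  exact mul_le_mul_of_nonneg_right (h x) (norm_nonneg _)

theorem lineDerivOp_apply_fourier (u : 𝓢'(E, ℂ)) (m : E) (Θ : 𝓢(E, ℂ)) :
    (∂_{m} u) (𝓕 Θ) =
      (𝓕 u) ((2 * Real.pi * Complex.I) • SchwartzMap.smulLeftCLM ℂ (inner ℝ · m) Θ) := by
  have h := congrArg (fun v : 𝓢'(E, ℂ) => v Θ) (TemperedDistribution.fourier_lineDerivOp_eq u m)
  simp only [TemperedDistribution.fourier_apply] at h
  rw [h, map_smul]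
  have : (inner ℝ · m : E → ℝ).HasTemperateGrowth := by fun_prop
  simp [← SchwartzMap.smulLeftCLM_ofReal ℂ this]

end FourierNorm

/-! ### The operators `S` and `S_±` on the Fourier side. -/

theorem inner_unitT (P : R7) : inner ℝ P unitT = P.fst := by
  simp [unitT, WithLp.prod_inner_apply]

theorem inner_unitX (P : R7) (i : Fin 3) : inner ℝ P (unitX i) = P.snd.fst i := by
  simp [unitX, WithLp.prod_inner_apply, EuclideanSpace.inner_single_right]

theorem inner_unitY (P : R7) (i : Fin 3) : inner ℝ P (unitY i) = P.snd.snd i := by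
  simp [unitY, WithLp.prod_inner_apply, EuclideanSpace.inner_single_right]

def secondSymbol (m : R7) (Θ : 𝓢(R7, ℂ)) : 𝓢(R7, ℂ) :=
  (2 * Real.pi * Complex.I) • SchwartzMap.smulLeftCLM ℂ (inner ℝ · m)
    ((2 * Real.pi * Complex.I) • SchwartzMap.smulLeftCLM ℂ (inner ℝ · m) Θ)

theorem secondSymbol_apply (m : R7) (Θ : 𝓢(R7, ℂ)) (P : R7) :
    secondSymbol m Θ P = -(4 * Real.pi ^ 2 * (inner ℝ P m : ℝ) ^ 2 * Θ P) := by
  have : (inner ℝ · m : R7 → ℝ).HasTemperateGrowth := by fun_prop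
  simp only [secondSymbol, smul_apply, SchwartzMap.smulLeftCLM_apply_apply this, smul_eq_mul,
    Complex.real_smul]
  linear_combination (4 * Real.pi ^ 2 * (inner ℝ P m : ℝ) ^ 2 * Θ P) * Complex.I_sq

theorem lineDerivOp_lineDerivOp_apply_fourier (u : 𝓢'(R7, ℂ)) (m : R7) (Θ : 𝓢(R7, ℂ)) :
    (∂_{m} (∂_{m} u)) (𝓕 Θ) = (𝓕 u) (secondSymbol m Θ) := by
  rw [lineDerivOp_apply_fourier, TemperedDistribution.fourier_apply, lineDerivOp_apply_fourier,
    secondSymbol]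

def firstSymbol (Θ : 𝓢(R7, ℂ)) : 𝓢(R7, ℂ) :=
  (1 / Complex.I) • (2 * Real.pi * Complex.I) • SchwartzMap.smulLeftCLM ℂ (inner ℝ · unitT) Θ

theorem firstSymbol_apply (Θ : 𝓢(R7, ℂ)) (P : R7) :
    firstSymbol Θ P = 2 * Real.pi * P.fst * Θ P := by
  have : (inner ℝ · unitT : R7 → ℝ).HasTemperateGrowth := by fun_prop
  simp only [firstSymbol, smul_apply, SchwartzMap.smulLeftCLM_apply_apply this, smul_eq_mul,
    Complex.real_smul]
  rw [inner_unitT]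
  field_simp

theorem norm_two_pi_smul_sq (ξ : R3) :
    ((‖(2 * Real.pi) • ξ‖ ^ 2 : ℝ) : ℂ) = ∑ i, 4 * Real.pi ^ 2 * (ξ i : ℂ) ^ 2 := by
  rw [norm_smul, mul_pow, EuclideanSpace.real_norm_sq_eq, Finset.mul_sum, Real.norm_of_nonneg (by positivity)]
  push_cast
  exact Finset.sum_congr rfl fun i _ => by ring

/-- The equation in tested form: it determines the Fourier transform on exactly those test functions
that are divisible by the symbol, which is what the division lemma supplies. -/
theorem fourier_apply_of_opS {u F : 𝓢'(R7, ℂ)} (h : opS u = F) {Θ Φ : 𝓢(R7, ℂ)}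
    (hΦ : ∀ P, Φ P = symbolS P * Θ P) : (𝓕 u) Φ = (𝓕 F) Θ := by
  have h1 : (𝓕 F) Θ = (𝓕 u) (firstSymbol Θ - ∑ i, secondSymbol (unitX i) Θ -
      ∑ i, secondSymbol (unitY i) Θ) := by
    rw [← h, TemperedDistribution.fourier_apply]
    simp only [opS, laplaceX, laplaceY, map_sub, map_sum, ← lineDerivOp_lineDerivOp_apply_fourier]
    simp only [firstSymbol, map_smul, sub_apply, smul_apply, sum_apply, lineDerivOp_apply_fourier]
  rw [h1]
  congr 1
  ext P
  simp only [sub_apply, sum_apply, firstSymbol_apply, secondSymbol_apply, hΦ, symbolS, inner_unitX,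
    inner_unitY, Complex.ofReal_add, norm_two_pi_smul_sq, Finset.sum_neg_distrib, ← Finset.sum_mul]
  push_cast
  ring

theorem fourier_apply_of_opW {u F : 𝓢'(R7, ℂ)} (h : opW u = F) {Θ Φ : 𝓢(R7, ℂ)}
    (hΦ : ∀ P, Φ P = symbolW P * Θ P) : (𝓕 u) Φ = (𝓕 F) Θ := by
  have h1 : (𝓕 F) Θ = (𝓕 u) (firstSymbol Θ - ∑ i, secondSymbol (unitX i) Θ +
      ∑ i, secondSymbol (unitY i) Θ) := by
    rw [← h, TemperedDistribution.fourier_apply]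
    simp only [opW, laplaceX, laplaceY, map_add, map_sub, map_sum, ← lineDerivOp_lineDerivOp_apply_fourier]
    simp only [firstSymbol, map_smul, add_apply, sub_apply, smul_apply, sum_apply, lineDerivOp_apply_fourier]
  rw [h1]
  congr 1
  ext P
  simp only [add_apply, sub_apply, sum_apply, firstSymbol_apply, secondSymbol_apply, hΦ, symbolW, inner_unitX,
    inner_unitY, Complex.ofReal_add, Complex.ofReal_sub, norm_two_pi_smul_sq, Finset.sum_neg_distrib, ← Finset.sum_mul]
  push_cast
  ring

/-! ### Integrals over Euclidean products. -/

section ProductMeasure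

variable {U V : Type*} [NormedAddCommGroup U] [InnerProductSpace ℝ U] [FiniteDimensional ℝ U]
  [MeasurableSpace U] [BorelSpace U] [NormedAddCommGroup V] [InnerProductSpace ℝ V]
  [FiniteDimensional ℝ V] [MeasurableSpace V] [BorelSpace V]

theorem measurePreserving_toLp : MeasurePreserving (WithLp.toLp 2 : U × V → WithLp 2 (U × V)) :=
  (WithLp.volume_preserving_symm_measurableEquiv_toLp_prod U V).symm

theorem integral_withLp_prod {G : Type*} [NormedAddCommGroup G] [NormedSpace ℝ G]
    (F : WithLp 2 (U × V) → G) : ∫ P, F P = ∫ z : U × V, F (WithLp.toLp 2 z) :=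
  (measurePreserving_toLp.integral_comp
    (MeasurableEquiv.toLp 2 (U × V)).measurableEmbedding F).symm

theorem integrable_withLp_prod {G : Type*} [NormedAddCommGroup G]
    {F : WithLp 2 (U × V) → G} :
    Integrable F ↔ Integrable fun z : U × V => F (WithLp.toLp 2 z) :=
  (measurePreserving_toLp.integrable_comp_emb
    (MeasurableEquiv.toLp 2 (U × V)).measurableEmbedding).symm

theorem lintegral_withLp_prod (F : WithLp 2 (U × V) → ℝ≥0∞) :
    ∫⁻ P, F P = ∫⁻ z : U × V, F (WithLp.toLp 2 z) :=
  (measurePreserving_toLp.lintegral_comp_emb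
    (MeasurableEquiv.toLp 2 (U × V)).measurableEmbedding F).symm

theorem lintegral_withLp_prod' {F : WithLp 2 (U × V) → ℝ≥0∞} (hF : Measurable F) :
    ∫⁻ P, F P = ∫⁻ p : V, ∫⁻ t : U, F (WithLp.toLp 2 (t, p)) := by
  rw [lintegral_withLp_prod, Measure.volume_eq_prod]
  exact lintegral_prod_symm' _ (hF.comp (MeasurableEquiv.toLp 2 (U × V)).measurable)

theorem fourier_tensor {a : U → ℂ} {ψ : V → ℂ} {F : WithLp 2 (U × V) → ℂ}
    (h : ∀ P, F P = a P.fst * ψ P.snd) (P : WithLp 2 (U × V)) :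
    𝓕 F P = 𝓕 a P.fst * 𝓕 ψ P.snd := by
  rw [Real.fourier_eq, Real.fourier_eq, Real.fourier_eq, integral_withLp_prod,
    Measure.volume_eq_prod, ← integral_prod_mul]
  refine integral_congr_ae (Eventually.of_forall fun z => ?_)
  simp only [h, WithLp.prod_inner_apply, neg_add, AddChar.map_add_eq_mul, Circle.smul_def, smul_eq_mul, Circle.coe_mul]
  exact (by intros; ring : ∀ x y a b : ℂ, x * y * (a * b) = x * a * (y * b)) _ _ _ _

end ProductMeasure

/-! ### Straightening the characteristic surface. -/

section Gauge

variable {V : Type} [NormedAddCommGroup V] [InnerProductSpace ℝ V]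

theorem hasTemperateGrowth_toLp {a : WithLp 2 (ℝ × V) → ℝ} {b : WithLp 2 (ℝ × V) → V}
    (ha : a.HasTemperateGrowth) (hb : b.HasTemperateGrowth) :
    (fun P => (WithLp.toLp 2 (a P, b P) : WithLp 2 (ℝ × V))).HasTemperateGrowth := by
  let i₁ : ℝ →L[ℝ] WithLp 2 (ℝ × V) :=
    (WithLp.prodContinuousLinearEquiv 2 ℝ ℝ V).symm.toContinuousLinearMap ∘L
      ContinuousLinearMap.inl ℝ ℝ V
  let i₂ : V →L[ℝ] WithLp 2 (ℝ × V) :=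
    (WithLp.prodContinuousLinearEquiv 2 ℝ ℝ V).symm.toContinuousLinearMap ∘L
      ContinuousLinearMap.inr ℝ ℝ V
  have := (i₁.hasTemperateGrowth.comp ha).add (i₂.hasTemperateGrowth.comp hb)
  convert this using 1
  ext P
  apply withLp_prod_ext <;> simp [i₁, i₂]

theorem hasTemperateGrowth_fst :
    (fun P : WithLp 2 (ℝ × V) => P.fst).HasTemperateGrowth :=
  (WithLp.fstL 2 ℝ ℝ V).hasTemperateGrowth

theorem hasTemperateGrowth_snd :
    (fun P : WithLp 2 (ℝ × V) => P.snd).HasTemperateGrowth :=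
  (WithLp.sndL 2 ℝ ℝ V).hasTemperateGrowth

/-- The shear `(τ, p) ↦ (τ + q(p), p)` has derivatives of polynomial growth, and so does its
inverse: if `Q` is the image of `P`, then `‖P‖` is bounded by a power of `1 + ‖Q‖`, so composition
preserves decay. -/
theorem exists_schwartzMap_gauge {q : V → ℝ} (hq : q.HasTemperateGrowth)
    (Φ : 𝓢(WithLp 2 (ℝ × V), ℂ)) : ∃ Φ' : 𝓢(WithLp 2 (ℝ × V), ℂ),
      ∀ P, Φ' P = Φ (WithLp.toLp 2 (P.fst + q P.snd, P.snd)) := by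
  have hg := hasTemperateGrowth_toLp (hasTemperateGrowth_fst.add (hq.comp hasTemperateGrowth_snd))
    hasTemperateGrowth_snd
  obtain ⟨k, C, hC0, hC⟩ := hq.norm_iteratedFDeriv_le_uniform 0
  refine ⟨SchwartzMap.compCLM ℂ hg ⟨k + 1, 2 + C, fun P => ?_⟩ Φ, fun P => rfl⟩
  have h1 := hC 0 le_rfl P.snd
  rw [norm_iteratedFDeriv_zero] at h1
  set Q : WithLp 2 (ℝ × V) := WithLp.toLp 2 (((fun P : WithLp 2 (ℝ × V) => P.fst) +
    q ∘ fun P : WithLp 2 (ℝ × V) => P.snd) P, P.snd) with hQ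
  have h2 : ‖P.snd‖ ≤ ‖Q‖ := WithLp.norm_snd_le _ Q
  have h3 : ‖P.fst + q P.snd‖ ≤ ‖Q‖ := WithLp.norm_fst_le _ Q
  have h4 : ‖P.fst‖ ≤ ‖Q‖ + C * (1 + ‖Q‖) ^ k := by
    have := norm_sub_le (P.fst + q P.snd) (q P.snd)
    rw [add_sub_cancel_right] at this
    refine this.trans (add_le_add h3 (h1.trans ?_))
    gcongr
  have h5 : 1 ≤ (1 + ‖Q‖) ^ k := one_le_pow₀ (by linarith [norm_nonneg Q])
  calc ‖P‖ ≤ (‖Q‖ + C * (1 + ‖Q‖) ^ k) + ‖Q‖ :=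
        (norm_le_fst_add_snd P).trans (add_le_add h4 h2)
    _ ≤ (2 + C) * ((1 + ‖Q‖) ^ k * (1 + ‖Q‖)) := by
        have e1 : ‖Q‖ ≤ (1 + ‖Q‖) ^ k * (1 + ‖Q‖) := by nlinarith [norm_nonneg Q]
        have e2 : (1 + ‖Q‖) ^ k ≤ (1 + ‖Q‖) ^ k * (1 + ‖Q‖) := by nlinarith [norm_nonneg Q]
        nlinarith
    _ = _ := by rw [pow_succ]

theorem exists_schwartzMap_restrict (Φ : 𝓢(WithLp 2 (ℝ × V), ℂ)) :
    ∃ ψ : 𝓢(V, ℂ), ∀ p, ψ p = Φ (WithLp.toLp 2 (0, p)) := by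
  let i₂ : V →L[ℝ] WithLp 2 (ℝ × V) :=
    (WithLp.prodContinuousLinearEquiv 2 ℝ ℝ V).symm.toContinuousLinearMap ∘L
      ContinuousLinearMap.inr ℝ ℝ V
  refine ⟨SchwartzMap.compCLM ℂ i₂.hasTemperateGrowth ⟨1, 1, fun p => ?_⟩ Φ, fun p => rfl⟩
  have : ‖p‖ ≤ ‖i₂ p‖ := WithLp.norm_snd_le _ (i₂ p)
  linarith

/-- Division by `τ + q(p)`, after subtraction of a function with the same values on the surface
`τ = - q(p)`. -/
theorem exists_schwartzMap_division [FiniteDimensional ℝ V] {q : V → ℝ} (hq : q.HasTemperateGrowth)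
    (a : 𝓢(ℝ, ℂ)) (ha : a 0 = 1) (Φ : 𝓢(WithLp 2 (ℝ × V), ℂ)) :
    ∃ (ψ : 𝓢(V, ℂ)) (Φ₀ Θ : 𝓢(WithLp 2 (ℝ × V), ℂ)),
      (∀ p, ψ p = Φ (WithLp.toLp 2 (-q p, p))) ∧
      (∀ P, Φ₀ P = a (P.fst + q P.snd) * ψ P.snd) ∧
      ∀ P, Φ P - Φ₀ P = ((P.fst + q P.snd : ℝ) : ℂ) * Θ P := by
  -- A shear moves the surface `τ = -q(p)` to `τ = 0`; there Hadamard's lemma divides by `τ`, and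
  -- the opposite shear carries the result back.
  obtain ⟨Φ', hΦ'⟩ := exists_schwartzMap_gauge hq.neg Φ
  obtain ⟨ψ, hψ⟩ := exists_schwartzMap_restrict Φ'
  obtain ⟨Θ', hΘ'⟩ := hadamard_schwartzMap a ha Φ'
  obtain ⟨Θ, hΘ⟩ := exists_schwartzMap_gauge hq Θ'
  obtain ⟨Φ₁, hΦ₁⟩ := exists_schwartzMap_tensor a ψ
  obtain ⟨Φ₀, hΦ₀⟩ := exists_schwartzMap_gauge hq Φ₁
  refine ⟨ψ, Φ₀, Θ, fun p => by simp [hψ, hΦ'], fun P => by simp [hΦ₀, hΦ₁], fun P => ?_⟩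
  have h := hΘ' (WithLp.toLp 2 (P.fst + q P.snd, P.snd))
  rw [hΦ₀, hΦ₁, hΘ, hψ]
  simp only [hΦ'] at h ⊢
  have e : (WithLp.toLp 2 (P.fst, P.snd) : WithLp 2 (ℝ × V)) = P := rfl
  simpa [e] using h

end Gauge

/-! ### Mollifiers in time. -/

section Mollifier

/-- A smooth function of integral `1` supported in `[-1, 1]`. -/
def bump : ContDiffBump (0 : ℝ) := ⟨1 / 2, 1, by norm_num, by norm_num⟩

def mollifier (l : ℝ) (t : ℝ) : ℂ := (l⁻¹ * bump.normed volume (t * l⁻¹) : ℝ)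

theorem contDiff_mollifier (l : ℝ) : ContDiff ℝ ∞ (mollifier l) := by
  have : ContDiff ℝ ∞ fun t : ℝ => l⁻¹ * bump.normed volume (t * l⁻¹) :=
    contDiff_const.mul (bump.contDiff_normed.comp (by fun_prop))
  exact Complex.ofRealCLM.contDiff.comp this

theorem hasCompactSupport_mollifier {l : ℝ} (hl : 0 < l) : HasCompactSupport (mollifier l) := by
  refine HasCompactSupport.of_support_subset_isCompact (isCompact_closedBall 0 l) fun t ht => ?_
  have h1 : bump.normed volume (t * l⁻¹) ≠ 0 := by
    intro h
    simp [mollifier, h] at ht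
  have h2 : t * l⁻¹ ∈ Function.support (bump.normed volume) := h1
  rw [ContDiffBump.support_normed_eq, mem_ball_zero_iff] at h2
  have h3 : ‖t * l⁻¹‖ < 1 := h2
  rw [mem_closedBall_zero_iff]
  rw [norm_mul, norm_inv, Real.norm_of_nonneg hl.le, ← div_eq_mul_inv, div_lt_one hl] at h3
  exact h3.le

/-- After `t = l s` the domain no longer depends on `l`, and the right-hand side stays meaningful at
`l = 0`; the limit is then continuity of an integral in its parameter. -/
theorem integral_mollifier_mul {l : ℝ} (hl : 0 < l) (h : ℝ → ℂ) :
    ∫ t, mollifier l t * h t = ∫ s in Icc (-1 : ℝ) 1, (bump.normed volume s : ℂ) * h (s * l) := by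
  have h1 := Measure.integral_comp_mul_right (fun t => mollifier l t * h t) l
  rw [abs_of_pos (inv_pos.2 hl)] at h1
  have h2 : ∫ t, mollifier l t * h t = ∫ s, (bump.normed volume s : ℂ) * h (s * l) := by
    have h3 : (fun s => mollifier l (s * l) * h (s * l)) =
        fun s => l⁻¹ • ((bump.normed volume s : ℂ) * h (s * l)) := by
      ext s
      simp only [mollifier, mul_assoc, mul_inv_cancel₀ hl.ne', mul_one, Complex.real_smul]
      push_cast
      ring
    rw [h3, integral_smul] at h1
    exact (smul_right_injective ℂ (inv_ne_zero hl.ne') h1).symm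
  rw [h2, setIntegral_eq_integral_of_forall_compl_eq_zero]
  intro s hs
  have : bump.normed volume s = 0 := by
    by_contra hne
    have h2 : s ∈ Function.support (bump.normed volume) := hne
    rw [ContDiffBump.support_normed_eq, Real.ball_eq_Ioo] at h2
    exact hs (Ioo_subset_Icc_self (by simpa [bump] using h2))
  simp [this]

theorem tendsto_integral_mollifier_mul {h : ℝ → ℂ} (hh : Continuous h) :
    Tendsto (fun l => ∫ t, mollifier l t * h t) (𝓝[>] 0) (𝓝 (h 0)) := by
  have hb : Continuous fun s => (bump.normed volume s : ℂ) :=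
    Complex.continuous_ofReal.comp bump.continuous_normed
  have hc : Continuous fun l : ℝ => ∫ s in Icc (-1 : ℝ) 1, (bump.normed volume s : ℂ) * h (s * l) :=
    continuous_parametric_integral_of_continuous
      ((hb.comp continuous_snd).mul (hh.comp (continuous_snd.mul continuous_fst))) isCompact_Icc
  have h0 : ∫ s in Icc (-1 : ℝ) 1, (bump.normed volume s : ℂ) * h (s * 0) = h 0 := by
    have := integral_mollifier_mul one_pos (fun _ => h 0)
    simp only [mul_zero]
    rw [← this, integral_mul_const]
    have h1 : ∫ t, mollifier 1 t = 1 := by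
      have : mollifier 1 = fun t => ((bump.normed volume t : ℝ) : ℂ) := by
        ext t
        simp [mollifier]
      rw [this, integral_complex_ofReal, ContDiffBump.integral_normed]
      simp
    rw [h1, one_mul]
  have h2 := (hc.tendsto 0).mono_left (nhdsWithin_le_nhds (s := Ioi 0))
  simp only [h0] at h2
  refine h2.congr' ?_
  filter_upwards [self_mem_nhdsWithin] with l hl
  exact (integral_mollifier_mul hl h).symm

def mollifierSchwartz {l : ℝ} (hl : 0 < l) : 𝓢(ℝ, ℂ) :=
  (hasCompactSupport_mollifier hl).toSchwartzMap (contDiff_mollifier l)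

/-- It has the value `1` at `0` and serves twice: its dilates are the inverse transforms of the
mollifiers, and it is the cut-off function `a` in the division lemma. -/
def mollifierSymbol : 𝓢(ℝ, ℂ) := 𝓕⁻ (mollifierSchwartz one_pos)

theorem fourierInv_mollifierSchwartz {l : ℝ} (hl : 0 < l) (s : ℝ) :
    (𝓕⁻ (mollifierSchwartz hl)) s = mollifierSymbol (l * s) := by
  simp only [mollifierSymbol, SchwartzMap.fourierInv_coe, Real.fourierInv_eq]
  have h : ∀ {l : ℝ} (hl : 0 < l) (s : ℝ), ∫ v, Real.fourierChar (inner ℝ v s) • mollifierSchwartz hl v =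
      ∫ v in Icc (-1 : ℝ) 1, (bump.normed volume v : ℂ) * Real.fourierChar (v * l * s) := by
    intro l hl s
    rw [← integral_mollifier_mul hl fun t => (Real.fourierChar (t * s) : ℂ)]
    refine integral_congr_ae (Eventually.of_forall fun t => ?_)
    simp [mollifierSchwartz, Circle.smul_def, mul_comm]
  rw [h, h]
  simp [mul_assoc]

theorem mollifierSymbol_zero : mollifierSymbol 0 = 1 := by
  have h := fourierInv_mollifierSchwartz one_pos 0
  rw [mul_zero] at h
  rw [← h, SchwartzMap.fourierInv_coe, Real.fourierInv_eq]
  simp only [inner_zero_right, AddChar.map_zero_eq_one, one_smul]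
  have : ∀ v, mollifierSchwartz one_pos v = ((bump.normed volume v : ℝ) : ℂ) := by
    intro v
    simp [mollifierSchwartz, mollifier]
  simp only [this]
  rw [integral_complex_ofReal, ContDiffBump.integral_normed]
  simp

end Mollifier

/-! ### The Fourier transform of a solution in terms of its data. -/

theorem exists_norm_le_div_one_add_norm_pow {V : Type*} [NormedAddCommGroup V] [NormedSpace ℝ V]
    (Φ : 𝓢(V, ℂ)) (N : ℕ) : ∃ C : ℝ, 0 ≤ C ∧ ∀ x, ‖Φ x‖ ≤ C / (1 + ‖x‖) ^ N := by
  refine ⟨2 ^ N * ((Finset.Iic (N, 0)).sup (schwartzSeminormFamily ℝ V ℂ)) Φ, by positivity,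
    fun x => ?_⟩
  have h := SchwartzMap.one_add_le_sup_seminorm_apply (𝕜 := ℝ) (m := (N, 0)) le_rfl le_rfl Φ x
  rw [norm_iteratedFDeriv_zero] at h
  rwa [le_div_iff₀ (by positivity), mul_comm]

theorem exists_lipschitz (a : 𝓢(ℝ, ℂ)) :
    ∃ L : ℝ, 0 ≤ L ∧ ∀ x y, ‖a x - a y‖ ≤ L * |x - y| := by
  obtain ⟨C, hC0, hC⟩ := exists_norm_le_div_one_add_norm_pow (SchwartzMap.derivCLM ℂ ℂ a) 0
  refine ⟨C, hC0, fun x y => ?_⟩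
  refine convex_univ.norm_image_sub_le_of_norm_deriv_le (f := a) (𝕜 := ℝ)
    (fun z _ => a.differentiableAt) (fun z _ => ?_) (mem_univ y) (mem_univ x)
  simpa using hC z

theorem ae_fst_add_ne_zero {V : Type*} [NormedAddCommGroup V] [InnerProductSpace ℝ V]
    [FiniteDimensional ℝ V] [MeasurableSpace V] [BorelSpace V] {q : V → ℝ} (hq : Measurable q) :
    ∀ᵐ P : WithLp 2 (ℝ × V), P.fst + q P.snd ≠ 0 := by
  have hm : Measurable fun P : WithLp 2 (ℝ × V) => P.fst + q P.snd :=
    (WithLp.fstL 2 ℝ ℝ V).continuous.measurable.add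
      (hq.comp (WithLp.sndL 2 ℝ ℝ V).continuous.measurable)
  have hs : MeasurableSet {P : WithLp 2 (ℝ × V) | P.fst + q P.snd = 0} :=
    hm (measurableSet_singleton 0)
  rw [ae_iff]
  simp only [not_not]
  rw [← lintegral_indicator_one hs, lintegral_withLp_prod' (measurable_one.indicator hs),
    lintegral_eq_zero_of_ae_eq_zero]
  refine Eventually.of_forall fun p => ?_
  have : ∀ᵐ t : ℝ, t ≠ -q p := Measure.ae_ne volume (-q p)
  refine lintegral_eq_zero_of_ae_eq_zero ?_
  filter_upwards [this] with t ht
  refine indicator_of_notMem (fun h => ht ?_) _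
  have h' : t + q p = 0 := h
  linarith

/-- The first bound controls the quotient for `|s| ≤ 1`, the second for `|s| ≥ 1`. At `s = 0` the
quotient is `0` by convention. -/
theorem norm_div_mul_le {A f : ℂ} {s C d : ℝ} (h1 : ‖A‖ ≤ C * |s| * d) (h2 : ‖A‖ ≤ C * d) :
    ‖A / (2 * Real.pi * s : ℝ) * f‖ ≤ 2 * C * (‖f‖ / (1 + |s|) * d) := by
  rcases eq_or_ne s 0 with rfl | hs
  · have : 0 ≤ C * d := (norm_nonneg _).trans h2
    simp only [mul_zero, Complex.ofReal_zero, div_zero, zero_mul, norm_zero, abs_zero, add_zero,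
      div_one]
    nlinarith [norm_nonneg f]
  have hs' : 0 < |s| := abs_pos.2 hs
  have hpi : 1 ≤ 2 * Real.pi := by linarith [Real.pi_gt_three]
  have h3 : ‖A‖ / |s| ≤ 2 * C * (1 / (1 + |s|) * d) := by
    have e : 2 * C * (1 / (1 + |s|) * d) * |s| = (2 * C * |s| * d) / (1 + |s|) := by ring
    rw [div_le_iff₀ hs', e, le_div_iff₀ (by positivity)]
    nlinarith
  rw [norm_mul, norm_div, Complex.norm_real, norm_mul, Real.norm_of_nonneg (by positivity),
    Real.norm_eq_abs]
  calc ‖A‖ / (2 * Real.pi * |s|) * ‖f‖ ≤ ‖A‖ / |s| * ‖f‖ := by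
        gcongr
        nlinarith
    _ ≤ 2 * C * (1 / (1 + |s|) * d) * ‖f‖ := by gcongr
    _ = _ := by ring

section Representation

variable {q : R6 → ℝ} {f : R7 → ℂ} {N : ℕ}

theorem integrable_div_mul (hq : Continuous q) (hf : AEStronglyMeasurable f)
    (hfi : Integrable fun P : R7 => ‖f P‖ / (1 + |P.fst + q P.snd|) * (1 / (1 + ‖P.snd‖) ^ N))
    {A : R7 → ℂ} (hA : Measurable A) {C : ℝ}
    (h1 : ∀ P, ‖A P‖ ≤ C * |P.fst + q P.snd| * (1 / (1 + ‖P.snd‖) ^ N))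
    (h2 : ∀ P, ‖A P‖ ≤ C * (1 / (1 + ‖P.snd‖) ^ N)) :
    Integrable fun P => A P / (2 * Real.pi * (P.fst + q P.snd) : ℝ) * f P := by
  refine (hfi.const_mul (2 * C)).mono' ?_ (Eventually.of_forall fun P => norm_div_mul_le (h1 P) (h2 P))
  have : Continuous fun P : R7 => 2 * Real.pi * (P.fst + q P.snd) := by fun_prop
  exact (hA.div (Complex.measurable_ofReal.comp this.measurable)).aestronglyMeasurable.mul hf

/-- The restriction does not decay in `τ`, so only decay in `p` is claimed. The factor `|τ + q(p)|`
comes from the division lemma together with the Lipschitz bound for `a(τ + q) - a(0)`. -/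
theorem exists_sub_restriction_le (hq : q.HasTemperateGrowth) (Φ : 𝓢(R7, ℂ)) (N : ℕ) :
    ∃ C : ℝ, (∀ P : R7, ‖Φ P - Φ (WithLp.toLp 2 (-q P.snd, P.snd))‖ ≤
        C * |P.fst + q P.snd| * (1 / (1 + ‖P.snd‖) ^ N)) ∧
      ∀ P : R7, ‖Φ P - Φ (WithLp.toLp 2 (-q P.snd, P.snd))‖ ≤ C * (1 / (1 + ‖P.snd‖) ^ N) := by
  obtain ⟨ψ, Φ₀, Θ, hψ, hΦ₀, hΘ⟩ :=
    exists_schwartzMap_division hq mollifierSymbol mollifierSymbol_zero Φ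
  obtain ⟨C₁, h₁, hC₁⟩ := exists_norm_le_div_one_add_norm_pow Φ N
  obtain ⟨C₂, h₂, hC₂⟩ := exists_norm_le_div_one_add_norm_pow ψ N
  obtain ⟨C₃, h₃, hC₃⟩ := exists_norm_le_div_one_add_norm_pow Θ N
  obtain ⟨L, hL, hLa⟩ := exists_lipschitz mollifierSymbol
  have hsnd : ∀ P : R7, 1 / (1 + ‖P‖) ^ N ≤ 1 / (1 + ‖P.snd‖) ^ N := fun P => by
    have := WithLp.norm_snd_le _ P
    gcongr
  refine ⟨C₁ + C₂ + C₃ + L * C₂, fun P => ?_, fun P => ?_⟩ <;> rw [← hψ]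
  · have e : Φ P - ψ P.snd = ((P.fst + q P.snd : ℝ) : ℂ) * Θ P +
        (mollifierSymbol (P.fst + q P.snd) - mollifierSymbol 0) * ψ P.snd := by
      rw [← hΘ, hΦ₀, mollifierSymbol_zero]
      ring
    have b1 := hLa (P.fst + q P.snd) 0
    rw [sub_zero] at b1
    set s := P.fst + q P.snd
    set d := 1 / (1 + ‖P.snd‖) ^ N
    have hd : 0 ≤ d := by positivity
    have b2 : ‖Θ P‖ ≤ C₃ * d := (hC₃ P).trans (by
      rw [div_eq_mul_one_div]
      exact mul_le_mul_of_nonneg_left (hsnd P) h₃)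
    have b3 : ‖ψ P.snd‖ ≤ C₂ * d := (hC₂ _).trans (by rw [div_eq_mul_one_div])
    rw [e]
    refine (norm_add_le _ _).trans ?_
    rw [norm_mul, norm_mul, Complex.norm_real, Real.norm_eq_abs]
    calc |s| * ‖Θ P‖ + ‖mollifierSymbol s - mollifierSymbol 0‖ * ‖ψ P.snd‖
        ≤ |s| * (C₃ * d) + (L * |s|) * (C₂ * d) := by gcongr
      _ ≤ |s| * (C₃ * d) + (L * |s|) * (C₂ * d) + (C₁ + C₂) * |s| * d := by
          have : 0 ≤ (C₁ + C₂) * |s| * d := by positivity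
          linarith
      _ = _ := by ring
  · set d := 1 / (1 + ‖P.snd‖) ^ N
    have hd : 0 ≤ d := by positivity
    have b2 : ‖Φ P‖ ≤ C₁ * d := (hC₁ P).trans (by
      rw [div_eq_mul_one_div]
      exact mul_le_mul_of_nonneg_left (hsnd P) h₁)
    have b3 : ‖ψ P.snd‖ ≤ C₂ * d := (hC₂ _).trans (by rw [div_eq_mul_one_div])
    refine (norm_sub_le _ _).trans ((add_le_add b2 b3).trans ?_)
    have : 0 ≤ (C₃ + L * C₂) * d := by positivity
    linarith

/-- The Fourier transform of a solution of an evolution equation with the symbol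
`2π (τ + q(p))`, the initial value `Λ₀` and the right-hand side with Fourier transform `f`. -/
theorem fourier_representation (hq : q.HasTemperateGrowth) {Λ : 𝓢'(R7, ℂ)} {Λ₀ : 𝓢'(R6, ℂ)}
    {g₀ : R6 → ℂ} (h0 : HasFourierFunction Λ₀ g₀) (hU : HasInitialValue Λ Λ₀)
    (hf : AEStronglyMeasurable f)
    (hfi : Integrable fun P : R7 => ‖f P‖ / (1 + |P.fst + q P.snd|) * (1 / (1 + ‖P.snd‖) ^ N))
    (hF : ∀ Θ Φ : 𝓢(R7, ℂ), (∀ P : R7, Φ P = (2 * Real.pi * (P.fst + q P.snd) : ℝ) * Θ P) →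
      (𝓕 Λ) Φ = ∫ P, Θ P * f P) (Φ : 𝓢(R7, ℂ)) :
    (𝓕 Λ) Φ = (∫ p, Φ (WithLp.toLp 2 (-q p, p)) * g₀ p) +
      ∫ P : R7, (Φ P - Φ (WithLp.toLp 2 (-q P.snd, P.snd))) /
        (2 * Real.pi * (P.fst + q P.snd) : ℝ) * f P := by
  have hqc : Continuous q := hq.1.continuous
  set a := mollifierSymbol with ha_def
  have ha : a 0 = 1 := mollifierSymbol_zero
  -- The equation evaluates the transform on differences divisible by `τ + q`. The quotient formula
  -- then holds off the null set `τ = -q`.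
  have hdiv : ∀ Φ Φ₀ Θ : 𝓢(R7, ℂ), (∀ P, Φ P - Φ₀ P = ((P.fst + q P.snd : ℝ) : ℂ) * Θ P) →
      (𝓕 Λ) Φ = (𝓕 Λ) Φ₀ +
        ∫ P : R7, (Φ P - Φ₀ P) / (2 * Real.pi * (P.fst + q P.snd) : ℝ) * f P := by
    intro Φ Φ₀ Θ h
    have h1 := hF ((1 / (2 * Real.pi) : ℂ) • Θ) (Φ - Φ₀) fun P => by
      rw [sub_apply, h, smul_apply, smul_eq_mul]
      have : (Real.pi : ℂ) ≠ 0 := by exact_mod_cast Real.pi_ne_zero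
      push_cast
      field_simp
    rw [map_sub, sub_eq_iff_eq_add'] at h1
    rw [h1]
    congr 1
    refine integral_congr_ae ?_
    filter_upwards [ae_fst_add_ne_zero hqc.measurable] with P hP
    have h2 : ((P.fst + q P.snd : ℝ) : ℂ) ≠ 0 := by exact_mod_cast hP
    have : (Real.pi : ℂ) ≠ 0 := by exact_mod_cast Real.pi_ne_zero
    rw [h, smul_apply, smul_eq_mul, Complex.ofReal_mul]
    push_cast at h2 ⊢
    field_simp
  obtain ⟨ψ, Φ₀, Θ, hψ, hΦ₀, hΘ⟩ := exists_schwartzMap_division hq a ha Φ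
  have hΦ := hdiv Φ Φ₀ Θ hΘ
  obtain ⟨C₂, h₂, hC₂⟩ := exists_norm_le_div_one_add_norm_pow ψ N
  obtain ⟨M, hM0, hM⟩ := exists_norm_le_div_one_add_norm_pow a 0
  simp only [pow_zero, div_one] at hM
  obtain ⟨L, hL, hLa⟩ := exists_lipschitz a
  -- the correction term for mollified initial data
  let A : ℝ → R7 → ℂ := fun l P =>
    a (l * P.fst) * ψ P.snd - a (P.fst + q P.snd) * (a (-(l * q P.snd)) * ψ P.snd)
  let C := (L + M * L + M + M * M) * C₂
  have hA1 : ∀ l ∈ Icc (0 : ℝ) 1, ∀ P : R7,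
      ‖A l P‖ ≤ C * |P.fst + q P.snd| * (1 / (1 + ‖P.snd‖) ^ N) := by
    intro l hl P
    -- The arguments of `a` differ by `l (τ + q)` in the first difference and by `τ + q` in the
    -- second, so both are `O(|τ + q|)` uniformly in `l ≤ 1`.
    have e : A l P = ((a (l * P.fst) - a (-(l * q P.snd))) +
        a (-(l * q P.snd)) * (a 0 - a (P.fst + q P.snd))) * ψ P.snd := by
      simp only [A, ha]
      ring
    have b1 := hLa (l * P.fst) (-(l * q P.snd))
    have b2 := hLa 0 (P.fst + q P.snd)
    rw [sub_neg_eq_add, ← mul_add, abs_mul, abs_of_nonneg hl.1] at b1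
    rw [zero_sub, abs_neg] at b2
    have b3 : ‖ψ P.snd‖ ≤ C₂ * (1 / (1 + ‖P.snd‖) ^ N) := (hC₂ _).trans (by rw [div_eq_mul_one_div])
    set s := P.fst + q P.snd
    set d := 1 / (1 + ‖P.snd‖) ^ N
    have hd : 0 ≤ d := by positivity
    have b4 : L * (l * |s|) ≤ L * |s| := by
      gcongr
      exact mul_le_of_le_one_left (abs_nonneg _) hl.2
    rw [e, norm_mul]
    calc _ ≤ (L * |s| + M * (L * |s|)) * (C₂ * d) := by
          gcongr
          refine (norm_add_le _ _).trans ?_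
          rw [norm_mul]
          gcongr
          · exact b1.trans b4
          · exact hM _
      _ ≤ (L * |s| + M * (L * |s|)) * (C₂ * d) + (M + M * M) * |s| * (C₂ * d) := by
          have : 0 ≤ (M + M * M) * |s| * (C₂ * d) := by positivity
          linarith
      _ = _ := by ring
  have hA2 : ∀ l : ℝ, ∀ P : R7, ‖A l P‖ ≤ C * (1 / (1 + ‖P.snd‖) ^ N) := by
    intro l P
    have b3 : ‖ψ P.snd‖ ≤ C₂ * (1 / (1 + ‖P.snd‖) ^ N) := (hC₂ _).trans (by rw [div_eq_mul_one_div])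
    set d := 1 / (1 + ‖P.snd‖) ^ N
    have hd : 0 ≤ d := by positivity
    refine (norm_sub_le _ _).trans ?_
    rw [norm_mul, norm_mul, norm_mul]
    calc _ ≤ M * (C₂ * d) + M * (M * (C₂ * d)) := by
          gcongr <;> exact hM _
      _ ≤ M * (C₂ * d) + M * (M * (C₂ * d)) + (L + M * L) * (C₂ * d) := by
          have : 0 ≤ (L + M * L) * (C₂ * d) := by positivity
          linarith
      _ = _ := by ring
  have hAm : ∀ l, Continuous (A l) := by
    intro l
    have := a.continuous
    have := ψ.continuous
    simp only [A]
    fun_prop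
  have hlim3 : Tendsto (fun l => ∫ P : R7, A l P / (2 * Real.pi * (P.fst + q P.snd) : ℝ) * f P)
      (𝓝[>] 0) (𝓝 (∫ P : R7, A 0 P / (2 * Real.pi * (P.fst + q P.snd) : ℝ) * f P)) := by
    have h01 : Icc (0 : ℝ) 1 ∈ 𝓝[>] (0 : ℝ) :=
      mem_of_superset (Ioc_mem_nhdsGT one_pos) Ioc_subset_Icc_self
    refine tendsto_integral_filter_of_dominated_convergence _ ?_ ?_ (hfi.const_mul (2 * C)) ?_
    · filter_upwards [h01] with l hl
      exact (integrable_div_mul hqc hf hfi (hAm l).measurable (hA1 l hl) (hA2 l)).1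
    · filter_upwards [h01] with l hl
      exact Eventually.of_forall fun P => norm_div_mul_le (hA1 l hl P) (hA2 l P)
    · refine Eventually.of_forall fun P => ?_
      have hc : Continuous fun l => A l P := by
        have := a.continuous
        simp only [A]
        fun_prop
      exact (((hc.tendsto 0).mono_left nhdsWithin_le_nhds).div_const _).mul_const _
  -- the value at the restriction
  obtain ⟨r, hr, hr1⟩ := exists_quotient_sub_one a ha
  have hqs : (fun P : R7 => q P.snd).HasTemperateGrowth := hq.comp hasTemperateGrowth_snd
  have hG : (fun y : ℝ × R7 => r (-(y.1 * q y.2.snd))).HasTemperateGrowth := by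
    have h1 : (fun y : ℝ × R7 => y.1).HasTemperateGrowth :=
      (ContinuousLinearMap.fst ℝ ℝ R7).hasTemperateGrowth
    have h2 : (fun y : ℝ × R7 => q y.2.snd).HasTemperateGrowth :=
      hqs.comp (ContinuousLinearMap.snd ℝ ℝ R7).hasTemperateGrowth
    exact hr.comp (h1.mul h2).neg
  have hqc' : (fun P : R7 => ((-q P.snd : ℝ) : ℂ)).HasTemperateGrowth :=
    Function.Complex.hasTemperateGrowth_ofReal.comp hqs.neg
  let Φ₁ := SchwartzMap.smulLeftCLM ℂ (fun P : R7 => ((-q P.snd : ℝ) : ℂ)) Φ₀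
  have hal : ∀ l : ℝ, (fun P : R7 => a (-(l * q P.snd))).HasTemperateGrowth := fun l =>
    a.hasTemperateGrowth.comp ((Function.HasTemperateGrowth.const l).mul hqs).neg
  let Φm : ℝ → 𝓢(R7, ℂ) := fun l => SchwartzMap.smulLeftCLM ℂ (fun P : R7 => a (-(l * q P.snd))) Φ₀
  have hΦm : ∀ l P, Φm l P = a (-(l * q P.snd)) * Φ₀ P := fun l P => by
    simp only [Φm, SchwartzMap.smulLeftCLM_apply_apply (hal l), smul_eq_mul]
  have hlim2 : Tendsto (fun l => (𝓕 Λ) (Φm l)) (𝓝[>] 0) (𝓝 ((𝓕 Λ) Φ₀)) := by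
    obtain ⟨K, hK⟩ := exists_norm_apply_slice_le hG (𝓕 Λ) Φ₁
    have h01 : Icc (0 : ℝ) 1 ∈ 𝓝[>] (0 : ℝ) :=
      mem_of_superset (Ioc_mem_nhdsGT one_pos) Ioc_subset_Icc_self
    -- From `a(s) - 1 = s r(s)` at `s = -l q`: a factor `l` times the value of a fixed distribution
    -- on a bounded family.
    have e : ∀ l : ℝ, (𝓕 Λ) (Φm l) - (𝓕 Λ) Φ₀ =
        (l : ℂ) * (𝓕 Λ) (SchwartzMap.smulLeftCLM ℂ (fun P : R7 => r (-(l * q P.snd))) Φ₁) := by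
      intro l
      rw [← map_sub, ← smul_eq_mul, ← map_smul]
      congr 1
      ext P
      have h3 := hr1 (-(l * q P.snd))
      have h4 : (fun P : R7 => r (-(l * q P.snd))).HasTemperateGrowth :=
        HasTemperateGrowth.slice hG l
      simp only [sub_apply, hΦm, smul_apply, SchwartzMap.smulLeftCLM_apply_apply h4, Φ₁,
        SchwartzMap.smulLeftCLM_apply_apply hqc', smul_eq_mul]
      push_cast at h3 ⊢
      linear_combination Φ₀ P * h3
    rw [tendsto_iff_norm_sub_tendsto_zero]
    refine squeeze_zero' (Eventually.of_forall fun l => norm_nonneg _) (g := fun l => |l| * K) ?_ ?_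
    · filter_upwards [h01] with l hl
      rw [e, norm_mul, Complex.norm_real, Real.norm_eq_abs]
      gcongr
      exact hK l hl
    · have : Continuous fun l : ℝ => |l| * K := by fun_prop
      have h5 := (this.tendsto 0).mono_left (nhdsWithin_le_nhds (s := Ioi 0))
      simpa using h5
  -- the pairing with mollified initial data
  obtain ⟨U, ⟨hUc, hU1⟩, hU0⟩ := hU
  have hlim1 : Tendsto (fun l => ∫ t, mollifier l t * U t (𝓕 ψ)) (𝓝[>] 0)
      (𝓝 (U 0 (𝓕 ψ))) :=
    tendsto_integral_mollifier_mul
      ((PointwiseConvergenceCLM.evalCLM _ _ _).continuous.comp hUc)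
  have key : ∀ l ∈ Ioi (0 : ℝ), ∫ t, mollifier l t * U t (𝓕 ψ) = (𝓕 Λ) (Φm l) +
      ∫ P : R7, A l P / (2 * Real.pi * (P.fst + q P.snd) : ℝ) * f P := by
    intro l hl
    have hl' : 0 < l := hl
    -- The Fourier transform of `a(lτ) ψ(p)` is the mollifier in `t` times `𝓕 ψ`, so testing the
    -- solution with it averages the initial trace. The restriction of `a(lτ) ψ(p)` to the surface
    -- is `a(-l q) ψ`.
    obtain ⟨Ψ, hΨ⟩ := exists_schwartzMap_tensor (𝓕⁻ (mollifierSchwartz hl')) ψ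
    have hfour : ∀ P : R7, (𝓕 Ψ) P = mollifierSchwartz hl' P.fst * (𝓕 ψ) P.snd := by
      intro P
      rw [SchwartzMap.fourier_coe, fourier_tensor hΨ, ← SchwartzMap.fourier_coe,
        ← SchwartzMap.fourier_coe]
      simp
    have h6 := hU1 (mollifierSchwartz hl') (𝓕 ψ) (𝓕 Ψ)
      (hasCompactSupport_mollifier hl') hfour
    obtain ⟨ψ', Φ₀', Θ', hψ', hΦ₀', hΘ'⟩ := exists_schwartzMap_division hq a ha Ψ
    have e1 : Φ₀' = Φm l := by
      ext P
      rw [hΦ₀', hψ', hΨ, hΦm, hΦ₀, fourierInv_mollifierSchwartz]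
      have e2 : l * (WithLp.toLp 2 (-q P.snd, P.snd) : R7).fst = -(l * q P.snd) := mul_neg _ _
      rw [e2]
      change a (P.fst + q P.snd) * (a (-(l * q P.snd)) * ψ P.snd) = _
      ring
    have h7 := hdiv Ψ Φ₀' Θ' hΘ'
    rw [e1] at h7
    rw [TemperedDistribution.fourier_apply, h6] at h7
    refine Eq.trans ?_ (h7.trans ?_)
    · rfl
    · congr 1
      refine integral_congr_ae (Eventually.of_forall fun P => ?_)
      simp only [hΨ, hΦm, hΦ₀, fourierInv_mollifierSchwartz, A, ← ha_def]
      ring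
  have hlim := hlim1.congr' (by filter_upwards [self_mem_nhdsWithin] with l hl using key l hl)
  have heq := tendsto_nhds_unique hlim (hlim2.add hlim3)
  rw [hU0, ← TemperedDistribution.fourier_apply, (h0.2 ψ).2] at heq
  simp only [← hψ]
  have hi1 := integrable_div_mul hqc hf hfi (hAm 0).measurable (hA1 0 (by simp)) (hA2 0)
  obtain ⟨C', hC1', hC2'⟩ := exists_sub_restriction_le hq Φ N
  simp only [← hψ] at hC1' hC2'
  have hi2 := integrable_div_mul hqc hf hfi (A := fun P => Φ P - ψ P.snd)
    (by
      have := Φ.continuous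
      have := ψ.continuous
      exact (by fun_prop : Continuous fun P : R7 => Φ P - ψ P.snd).measurable) hC1' hC2'
  -- The limit expresses `∫ ψ g₀` through `(𝓕 Λ) Φ₀`. The cut-off function cancels, since `(Φ - Φ₀)
  -- = (1 - a) ψ + (Φ - ψ) - (ψ - ψ)` with `Φ₀ = a ψ`, after `A 0 = (1 - a) ψ` is taken into
  -- account.
  rw [heq, hΦ, add_assoc, ← integral_add hi1 hi2]
  congr 2
  ext P
  simp only [A, hΦ₀, zero_mul, neg_zero, ha]
  ring

end Representation

/-! ### Restriction to `y = x + z` on the Fourier side. -/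

theorem eLpNorm_two_sq {X G : Type*} [MeasurableSpace X] {μ : Measure X} [NormedAddCommGroup G]
    (f : X → G) : eLpNorm f 2 μ ^ 2 = ∫⁻ x, ‖f x‖ₑ ^ 2 ∂μ := by
  have := eLpNorm_nnreal_pow_eq_lintegral (μ := μ) (f := f) (p := 2) two_ne_zero
  simpa using this

theorem eLpNorm_two_le {X Y G H : Type*} [MeasurableSpace X] {μ : Measure X} [MeasurableSpace Y]
    {ν : Measure Y} [NormedAddCommGroup G] [NormedAddCommGroup H] {f : X → G} {h : Y → H}
    {C : ℝ≥0∞} (hfh : ∫⁻ x, ‖f x‖ₑ ^ 2 ∂μ ≤ C ^ 2 * ∫⁻ y, ‖h y‖ₑ ^ 2 ∂ν) :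
    eLpNorm f 2 μ ≤ C * eLpNorm h 2 ν := by
  rw [← eLpNorm_two_sq, ← eLpNorm_two_sq, ← mul_pow] at hfh
  exact (ENNReal.pow_le_pow_left_iff two_ne_zero).1 hfh

theorem enorm_ofReal_complex (r : ℝ) : ‖(r : ℂ)‖ₑ = ‖r‖ₑ := by
  simp [enorm_eq_nnnorm]

/-- The frequency variables `(τ, ξ + η)` of the collapsed distribution. -/
def collapseMap (P : R7) : R4 := WithLp.toLp 2 (P.fst, P.snd.fst + P.snd.snd)

theorem continuous_collapseMap : Continuous collapseMap := by
  unfold collapseMap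
  fun_prop

/-- The shift `z` enters the collapsed distribution only through this factor. Its modulus is one,
which makes every bound uniform in `z`. -/
def phase (z : R3) (P : R7) : ℂ := (Real.fourierChar (inner ℝ z P.snd.snd) : ℂ)

theorem norm_phase (z : R3) (P : R7) : ‖phase z P‖ = 1 := Circle.norm_coe _

theorem continuous_phase : Continuous fun y : R3 × R7 => phase y.1 y.2 := by
  unfold phase
  have := Real.continuous_fourierChar
  fun_prop

theorem continuous_phase_right (z : R3) : Continuous (phase z) := by
  unfold phase
  have := Real.continuous_fourierChar
  fun_prop

theorem continuous_phase_left (P : R7) : Continuous fun z => phase z P := by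
  unfold phase
  have := Real.continuous_fourierChar
  fun_prop

theorem measurePreserving_collapse :
    MeasurePreserving (fun y : R3 × R4 =>
      (WithLp.toLp 2 (y.2.fst, WithLp.toLp 2 (y.2.snd, y.2.snd + y.1)) : R7))
      (volume.prod volume) volume := by
  have f1 : MeasurePreserving (Prod.swap : R3 × R4 → R4 × R3) (volume.prod volume)
    (volume.prod volume) := Measure.measurePreserving_swap
  have f2 : MeasurePreserving (Prod.map (WithLp.ofLp : R4 → ℝ × R3) (id : R3 → R3))
    (volume.prod volume) (volume.prod volume) :=
    (WithLp.volume_preserving_ofLp ℝ R3).prod (MeasurePreserving.id _)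
  have f3 : MeasurePreserving (MeasurableEquiv.prodAssoc : (ℝ × R3) × R3 ≃ᵐ ℝ × (R3 × R3))
    (volume.prod volume) (volume.prod (volume.prod volume)) :=
    measurePreserving_prodAssoc volume volume volume
  have f4 : MeasurePreserving (Prod.map (id : ℝ → ℝ) (fun z : R3 × R3 => (z.1, z.1 + z.2)))
    (volume.prod (volume.prod volume)) (volume.prod (volume.prod volume)) :=
    (MeasurePreserving.id _).prod (measurePreserving_prod_add volume volume)
  have f5 : MeasurePreserving (Prod.map (id : ℝ → ℝ) (WithLp.toLp 2 : R3 × R3 → R6))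
    (volume.prod (volume.prod volume)) (volume.prod volume) :=
    (MeasurePreserving.id _).prod measurePreserving_toLp
  exact measurePreserving_toLp.comp (f5.comp (f4.comp (f3.comp (f2.comp f1))))

/-- With `y = x + z` the exponent `tτ + x·ξ + y·η` equals `tτ + x·(ξ + η) + z·η`, so the integral
over `(t, x)` is an inverse transform at `(τ, ξ + η)` and the integral over `z` keeps the phase. -/
theorem fourierInv_of_restriction {φ : 𝓢(R3, ℂ)} {ψ : 𝓢(R4, ℂ)} {Φ : 𝓢(R7, ℂ)}
    (h : ∀ P : R7, Φ P = φ (P.snd.snd - P.snd.fst) * ψ (WithLp.toLp 2 (P.fst, P.snd.fst)))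
    (P : R7) : (𝓕⁻ Φ) P = ∫ z, φ z * phase z P * (𝓕⁻ ψ) (collapseMap P) := by
  have hcont : Continuous fun v : R7 => Real.fourierChar (inner ℝ v P) • Φ v := by
    have := Real.continuous_fourierChar
    have := Φ.continuous
    fun_prop
  have hint : Integrable fun v : R7 => Real.fourierChar (inner ℝ v P) • Φ v :=
    (Φ.integrable (μ := volume)).mono hcont.aestronglyMeasurable
      (Eventually.of_forall fun v => by simp)
  rw [SchwartzMap.fourierInv_coe, Real.fourierInv_eq, ← measurePreserving_collapse.map_eq,
    integral_map measurePreserving_collapse.measurable.aemeasurable hcont.aestronglyMeasurable,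
    integral_prod]
  · refine integral_congr_ae (Eventually.of_forall fun z => ?_)
    simp only [SchwartzMap.fourierInv_coe]
    rw [Real.fourierInv_eq, ← integral_const_mul]
    refine integral_congr_ae (Eventually.of_forall fun v => ?_)
    have e1 : inner ℝ (WithLp.toLp 2 (v.fst, WithLp.toLp 2 (v.snd, v.snd + z)) : R7) P =
        inner ℝ z P.snd.snd + inner ℝ v (collapseMap P) := by
      simp only [WithLp.prod_inner_apply, collapseMap, inner_add_left, inner_add_right]
      change inner ℝ v.fst P.fst + (inner ℝ v.snd P.snd.fst +
        (inner ℝ v.snd P.snd.snd + inner ℝ z P.snd.snd)) = _ +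
        (inner ℝ v.fst P.fst + (inner ℝ v.snd P.snd.fst + inner ℝ v.snd P.snd.snd))
      ring
    have e2 : Φ (WithLp.toLp 2 (v.fst, WithLp.toLp 2 (v.snd, v.snd + z))) = φ z * ψ v := by
      rw [h]
      change φ (v.snd + z - v.snd) * ψ v = _
      rw [add_sub_cancel_left]
    simp only [Circle.smul_def, smul_eq_mul]
    rw [e1, e2, AddChar.map_add_eq_mul, Circle.coe_mul, phase]
    ring
  · exact (measurePreserving_collapse.integrable_comp hint.aestronglyMeasurable).2 hint

/-! ### The collapsing estimate by duality. -/

section Collapse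

variable {X : Type*} [MeasurableSpace X] {μ : Measure X} {g : X → ℂ} {ι : X → R7} {m : R4 → ℝ}
  {w : X → ℝ} {C : ℝ≥0}

/-- The weighted estimate for the collapsing map `(τ, ξ, η) ↦ (τ, ξ + η)` on a family of
frequencies `ι`, dual to the collapsing estimate. -/
structure CollapseEstimate (μ : Measure X) (ι : X → R7) (m : R4 → ℝ) (w : X → ℝ) (C : ℝ≥0) :
    Prop where
  measurable_map : Measurable ι
  measurable_symbol : Measurable m
  measurable_weight : Measurable w
  symbol_ne_zero : ∀ᵐ x ∂μ, m (collapseMap (ι x)) ≠ 0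
  weight_ne_zero : ∀ᵐ x ∂μ, w x ≠ 0
  lintegral_le : ∀ f : R4 → ℝ≥0∞, Measurable f →
    ∫⁻ x, ‖m (collapseMap (ι x)) / w x‖ₑ ^ 2 * f (collapseMap (ι x)) ∂μ ≤ C ^ 2 * ∫⁻ y, f y

/-- Apply the estimate to the indicator of a null set and use that `m / w` does not vanish almost
everywhere. This makes composition of `L²` classes with the projection well defined. -/
theorem CollapseEstimate.quasiMeasurePreserving (h : CollapseEstimate μ ι m w C) :
    Measure.QuasiMeasurePreserving (fun x => collapseMap (ι x)) μ volume := by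
  have hm : Measurable fun x => collapseMap (ι x) :=
    continuous_collapseMap.measurable.comp h.measurable_map
  refine ⟨hm, Measure.AbsolutelyContinuous.mk fun s hs h0 => ?_⟩
  rw [Measure.map_apply hm hs]
  have h1 := h.lintegral_le (s.indicator 1) (measurable_one.indicator hs)
  rw [lintegral_indicator_one hs, h0, mul_zero, nonpos_iff_eq_zero, lintegral_eq_zero_iff] at h1
  · refine measure_mono_null (fun x hx => ?_)
      (ae_iff.1 (h1.and (h.symbol_ne_zero.and h.weight_ne_zero)))
    rintro ⟨e1, e2, e3⟩
    have hx' : s.indicator (1 : R4 → ℝ≥0∞) (collapseMap (ι x)) = 1 :=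
      indicator_of_mem (show collapseMap (ι x) ∈ s from hx) _
    simp [hx', e2, e3] at e1
  · have := h.measurable_symbol
    have := h.measurable_weight
    have := measurable_one.indicator (α := R4) (β := ℝ≥0∞) hs
    exact (((h.measurable_symbol.comp hm).div h.measurable_weight).enorm.pow_const 2).mul
      (this.comp hm)

theorem CollapseEstimate.eLpNorm_le (h : CollapseEstimate μ ι m w C) {F : R4 → ℂ}
    (hF : AEStronglyMeasurable F) :
    eLpNorm (fun x => ((m (collapseMap (ι x)) / w x : ℝ) : ℂ) * F (collapseMap (ι x))) 2 μ ≤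
      C * eLpNorm F 2 volume := by
  have e1 := eLpNorm_congr_ae (p := 2) hF.ae_eq_mk
  have e2 : (fun x => ((m (collapseMap (ι x)) / w x : ℝ) : ℂ) * F (collapseMap (ι x))) =ᵐ[μ]
      fun x => ((m (collapseMap (ι x)) / w x : ℝ) : ℂ) * hF.mk F (collapseMap (ι x)) := by
    filter_upwards [h.quasiMeasurePreserving.ae_eq_comp hF.ae_eq_mk] with x hx
    have hx' : F (collapseMap (ι x)) = hF.mk F (collapseMap (ι x)) := hx
    rw [hx']
  rw [e1, eLpNorm_congr_ae e2]
  refine eLpNorm_two_le ?_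
  have := h.lintegral_le (fun y => ‖hF.mk F y‖ₑ ^ 2)
    (hF.stronglyMeasurable_mk.measurable.enorm.pow_const 2)
  simpa only [enorm_mul, mul_pow, enorm_ofReal_complex] using this

theorem CollapseEstimate.memLp (h : CollapseEstimate μ ι m w C) {F : R4 → ℂ}
    (hF : MemLp F 2 volume) :
    MemLp (fun x => ((m (collapseMap (ι x)) / w x : ℝ) : ℂ) * F (collapseMap (ι x))) 2 μ := by
  refine ⟨?_, (h.eLpNorm_le hF.1).trans_lt (ENNReal.mul_lt_top (by simp) hF.2)⟩
  have hq := h.quasiMeasurePreserving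
  exact (Complex.measurable_ofReal.comp
    ((h.measurable_symbol.comp hq.measurable).div h.measurable_weight)).aestronglyMeasurable.mul
    (hF.1.comp_quasiMeasurePreserving hq)

/-- Cauchy-Schwarz for the factors `w g` and `(m / w) F`, the second of which the estimate controls.
-/
theorem CollapseEstimate.integrable (h : CollapseEstimate μ ι m w C)
    (hg : MemLp (fun x => (w x : ℂ) * g x) 2 μ) {F : R4 → ℂ} (hF : MemLp F 2 volume) (z : R3) :
    Integrable (fun x => (m (collapseMap (ι x)) * F (collapseMap (ι x))) * (phase z (ι x) * g x)) μ ∧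
      ‖∫ x, (m (collapseMap (ι x)) * F (collapseMap (ι x))) * (phase z (ι x) * g x) ∂μ‖ₑ ≤
        C * eLpNorm (fun x => (w x : ℂ) * g x) 2 μ * eLpNorm F 2 volume := by
  have hphase : MemLp (fun x => phase z (ι x) * ((w x : ℂ) * g x)) 2 μ := by
    refine hg.congr_norm ?_ (Eventually.of_forall fun x => by
      rw [norm_mul (phase z (ι x)), norm_phase, one_mul])
    exact ((continuous_phase_right z).measurable.comp h.measurable_map).aestronglyMeasurable.mul hg.1
  have hnorm : eLpNorm (fun x => phase z (ι x) * ((w x : ℂ) * g x)) 2 μ =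
      eLpNorm (fun x => (w x : ℂ) * g x) 2 μ :=
    eLpNorm_congr_norm_ae (Eventually.of_forall fun x => by
      rw [norm_mul (phase z (ι x)), norm_phase, one_mul])
  have hT := h.memLp hF
  have e : (fun x => (m (collapseMap (ι x)) * F (collapseMap (ι x))) * (phase z (ι x) * g x)) =ᵐ[μ]
      (fun x => phase z (ι x) * ((w x : ℂ) * g x)) •
        fun x => ((m (collapseMap (ι x)) / w x : ℝ) : ℂ) * F (collapseMap (ι x)) := by
    filter_upwards [h.weight_ne_zero] with x hx
    have : (w x : ℂ) ≠ 0 := by exact_mod_cast hx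
    simp only [Pi.smul_apply', smul_eq_mul, Complex.ofReal_div]
    field_simp
  have hi : MemLp ((fun x => phase z (ι x) * ((w x : ℂ) * g x)) •
        fun x => ((m (collapseMap (ι x)) / w x : ℝ) : ℂ) * F (collapseMap (ι x))) 1 μ :=
    hT.smul (p := 2) (q := 2) (r := 1) hphase
  refine ⟨(memLp_one_iff_integrable.1 hi).congr e.symm, ?_⟩
  rw [integral_congr_ae e]
  refine (enorm_integral_le_lintegral_enorm _).trans ?_
  rw [← eLpNorm_one_eq_lintegral_enorm]
  refine (eLpNorm_smul_le_mul_eLpNorm (p := 2) (q := 2) (r := 1) hT.1 hphase.1).trans ?_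
  rw [hnorm, mul_right_comm, mul_comm]
  gcongr
  exact h.eLpNorm_le hF.1

end Collapse

section Collapse

variable {X : Type*} [MeasurableSpace X] {μ : Measure X} {g : X → ℂ} {ι : X → R7} {m : R4 → ℝ}
  {w : X → ℝ} {C : ℝ≥0} {N : ℕ}

/-- Schwartz functions divided by the symbol `m` are square integrable. -/
def DecayOverSymbol (m : R4 → ℝ) (N : ℕ) : Prop :=
  MemLp (fun y : R4 => ((1 / (1 + ‖y‖) ^ N / m y : ℝ) : ℂ)) 2 volume

theorem DecayOverSymbol.memLp (h : DecayOverSymbol m N) (hm : Measurable m) (φ : 𝓢(R4, ℂ)) :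
    MemLp (fun y => φ y / m y) 2 volume := by
  obtain ⟨D, hD0, hD⟩ := exists_norm_le_div_one_add_norm_pow φ N
  refine (MemLp.const_mul h (D : ℂ)).mono
    (φ.continuous.measurable.div (Complex.measurable_ofReal.comp hm)).aestronglyMeasurable
    (Eventually.of_forall fun y => ?_)
  rw [norm_mul, norm_div, Complex.norm_real, Complex.norm_real, Complex.norm_real, norm_div,
    Real.norm_of_nonneg hD0, Real.norm_of_nonneg (by positivity : 0 ≤ 1 / (1 + ‖y‖) ^ N)]
  calc ‖φ y‖ / ‖m y‖ ≤ D / (1 + ‖y‖) ^ N / ‖m y‖ := by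
        gcongr
        exact hD y
    _ = _ := by ring

/-- The choice `F = (1 + ‖y‖)^{-N} / m` cancels the symbol `m`. -/
theorem CollapseEstimate.integrable_decay (h : CollapseEstimate μ ι m w C)
    (hN : DecayOverSymbol m N) (hg : MemLp (fun x => (w x : ℂ) * g x) 2 μ) :
    Integrable (fun x => 1 / (1 + ‖collapseMap (ι x)‖) ^ N * ‖g x‖) μ := by
  have h1 := ((h.integrable hg hN 0).1).norm
  refine h1.congr ?_
  filter_upwards [h.symbol_ne_zero] with x hx
  have hx' : ‖m (collapseMap (ι x))‖ ≠ 0 := norm_ne_zero_iff.2 hx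
  rw [norm_mul, norm_mul, norm_mul, norm_phase, one_mul, Complex.norm_real, Complex.norm_real,
    norm_div, mul_div_cancel₀ _ hx', Real.norm_of_nonneg (by positivity)]

theorem CollapseEstimate.integrable_schwartz (h : CollapseEstimate μ ι m w C)
    (hN : DecayOverSymbol m N) (hg : MemLp (fun x => (w x : ℂ) * g x) 2 μ) (hgm : Measurable g)
    (φ : 𝓢(R4, ℂ)) (z : R3) :
    Integrable (fun x => φ (collapseMap (ι x)) * (phase z (ι x) * g x)) μ := by
  obtain ⟨D, hD0, hD⟩ := exists_norm_le_div_one_add_norm_pow φ N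
  refine ((h.integrable_decay hN hg).const_mul D).mono' ?_ (Eventually.of_forall fun x => ?_)
  · exact ((φ.continuous.measurable.comp h.quasiMeasurePreserving.measurable).mul
      (((continuous_phase_right z).measurable.comp h.measurable_map).mul hgm)).aestronglyMeasurable
  · rw [norm_mul, norm_mul, norm_phase, one_mul, ← mul_assoc, mul_one_div]
    gcongr
    exact hD _

/-- The Fourier transform of the distribution collapsed to `y = x + z`. -/
def collapsedFourier (h : CollapseEstimate μ ι m w C) (hN : DecayOverSymbol m N)
    (hg : MemLp (fun x => (w x : ℂ) * g x) 2 μ) (hgm : Measurable g) (z : R3) : 𝓢'(R4, ℂ) :=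
  ContinuousLinearMap.toPointwiseConvergenceCLM ℂ (RingHom.id ℂ) 𝓢(R4, ℂ) ℂ
    (SchwartzMap.mkCLMtoNormedSpace (𝕜 := ℂ)
      (fun φ => ∫ x, φ (collapseMap (ι x)) * (phase z (ι x) * g x) ∂μ)
      (fun φ φ' => by
        rw [← integral_add (h.integrable_schwartz hN hg hgm φ z)
          (h.integrable_schwartz hN hg hgm φ' z)]
        simp [add_mul])
      (fun a φ => by
        simp [mul_assoc, integral_const_mul])
      (by
        refine ⟨Finset.Iic (N, 0),
          2 ^ N * ∫ x, 1 / (1 + ‖collapseMap (ι x)‖) ^ N * ‖g x‖ ∂μ, ?_, fun φ => ?_⟩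
        · have : 0 ≤ ∫ x, 1 / (1 + ‖collapseMap (ι x)‖) ^ N * ‖g x‖ ∂μ :=
            integral_nonneg fun x => by positivity
          positivity
        · rw [mul_right_comm, ← integral_const_mul]
          refine norm_integral_le_of_norm_le ((h.integrable_decay hN hg).const_mul _)
            (Eventually.of_forall fun x => ?_)
          have h1 := SchwartzMap.one_add_le_sup_seminorm_apply (𝕜 := ℂ) (m := (N, 0)) le_rfl le_rfl φ
            (collapseMap (ι x))
          rw [norm_iteratedFDeriv_zero] at h1
          rw [norm_mul, norm_mul, norm_phase, one_mul, ← mul_assoc, mul_one_div]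
          gcongr
          rwa [le_div_iff₀ (by positivity), mul_comm]))

theorem collapsedFourier_apply (h : CollapseEstimate μ ι m w C) (hN : DecayOverSymbol m N)
    (hg : MemLp (fun x => (w x : ℂ) * g x) 2 μ) (hgm : Measurable g) (z : R3) (φ : 𝓢(R4, ℂ)) :
    collapsedFourier h hN hg hgm z φ = ∫ x, φ (collapseMap (ι x)) * (phase z (ι x) * g x) ∂μ :=
  rfl

theorem continuous_collapsedFourier_apply (h : CollapseEstimate μ ι m w C)
    (hN : DecayOverSymbol m N) (hg : MemLp (fun x => (w x : ℂ) * g x) 2 μ) (hgm : Measurable g)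
    (φ : 𝓢(R4, ℂ)) : Continuous fun z => collapsedFourier h hN hg hgm z φ := by
  simp only [collapsedFourier_apply]
  have hi := h.integrable_schwartz hN hg hgm φ
  refine continuous_of_dominated (fun z => (hi z).1)
    (bound := fun x => ‖φ (collapseMap (ι x)) * (phase 0 (ι x) * g x)‖)
    (fun z => Eventually.of_forall fun x => ?_) (hi 0).norm (Eventually.of_forall fun x => ?_)
  · rw [norm_mul, norm_mul, norm_mul, norm_mul, norm_phase, norm_phase]
  · exact continuous_const.mul ((continuous_phase_left (ι x)).mul continuous_const)

theorem CollapseEstimate.integrable_prod [SFinite μ] (h : CollapseEstimate μ ι m w C)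
    (hN : DecayOverSymbol m N) (hg : MemLp (fun x => (w x : ℂ) * g x) 2 μ) (hgm : Measurable g)
    (ψ : 𝓢(R4, ℂ)) (φ : 𝓢(R3, ℂ)) :
    Integrable (fun y : X × R3 =>
      φ y.2 * (ψ (collapseMap (ι y.1)) * (phase y.2 (ι y.1) * g y.1))) (μ.prod volume) := by
  have hm := h.quasiMeasurePreserving.measurable
  have hι := h.measurable_map
  have h3 := (h.integrable_schwartz hN hg hgm ψ 0).mul_prod (φ.integrable (μ := volume))
  refine h3.mono ?_ (Eventually.of_forall fun y => ?_)
  · have hp : Measurable fun y : X × R3 => phase y.2 (ι y.1) :=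
      Measurable.comp (g := fun y : R3 × R7 => phase y.1 y.2) (f := fun y : X × R3 => (y.2, ι y.1))
        continuous_phase.measurable (measurable_snd.prodMk (hι.comp measurable_fst))
    have h4 : Measurable fun y : X × R3 => ψ (collapseMap (ι y.1)) :=
      (ψ.continuous.measurable.comp hm).comp measurable_fst
    exact ((φ.continuous.measurable.comp measurable_snd).mul
      (h4.mul (hp.mul (hgm.comp measurable_fst)))).aestronglyMeasurable
  · simp only [norm_mul, norm_phase]
    exact le_of_eq (by ring)

/-- `⟨u, Φ⟩` is the pairing of `𝓕 u` with `𝓕⁻ Φ`. Inserting the formula for `𝓕⁻ Φ` and exchanging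
the integrals brings out the integral over `z`. -/
theorem isCollapse_collapsedFourier [SFinite μ] (h : CollapseEstimate μ ι m w C)
    (hN : DecayOverSymbol m N) (hg : MemLp (fun x => (w x : ℂ) * g x) 2 μ) (hgm : Measurable g) {u : 𝓢'(R7, ℂ)}
    (hu : ∀ Φ : 𝓢(R7, ℂ), (𝓕 u) Φ = ∫ x, Φ (ι x) * g x ∂μ) :
    IsCollapse u fun z => 𝓕⁻ (collapsedFourier h hN hg hgm z) := by
  refine ⟨PointwiseConvergenceCLM.continuous_of_continuous_eval fun ψ => ?_, fun φ ψ Φ _ hΦ => ?_⟩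
  · exact continuous_collapsedFourier_apply h hN hg hgm (𝓕⁻ ψ)
  · have h1 : u Φ = ∫ x, (𝓕⁻ Φ) (ι x) * g x ∂μ := by
      rw [← hu, TemperedDistribution.fourier_apply, fourier_fourierInv_eq]
    rw [h1]
    simp only [TemperedDistribution.fourierInv_apply, collapsedFourier_apply]
    have h2 : ∀ x, (𝓕⁻ Φ) (ι x) * g x =
        ∫ z, φ z * ((𝓕⁻ ψ) (collapseMap (ι x)) * (phase z (ι x) * g x)) := by
      intro x
      rw [fourierInv_of_restriction hΦ, ← integral_mul_const]
      refine integral_congr_ae (Eventually.of_forall fun z => ?_)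
      ring
    simp only [h2, ← integral_const_mul]
    exact integral_integral_swap (h.integrable_prod hN hg hgm (𝓕⁻ ψ) φ)

/-- The functional on `L²` that the collapsed distribution defines on the Fourier side. -/
def collapsedFunctional (h : CollapseEstimate μ ι m w C)
    (hg : MemLp (fun x => (w x : ℂ) * g x) 2 μ) (z : R3) :
    Lp ℂ 2 (volume : Measure R4) →L[ℂ] ℂ :=
  LinearMap.mkContinuous
    { toFun := fun F =>
        ∫ x, (m (collapseMap (ι x)) * F (collapseMap (ι x))) * (phase z (ι x) * g x) ∂μ
      map_add' := fun F F' => by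
        rw [← integral_add (h.integrable hg (Lp.memLp F) z).1 (h.integrable hg (Lp.memLp F') z).1]
        refine integral_congr_ae ?_
        filter_upwards [h.quasiMeasurePreserving.ae_eq_comp (Lp.coeFn_add F F')] with x hx
        have hx' : (F + F' : Lp ℂ 2 (volume : Measure R4)) (collapseMap (ι x)) =
          F (collapseMap (ι x)) + F' (collapseMap (ι x)) := hx
        rw [hx']
        ring
      map_smul' := fun a F => by
        rw [RingHom.id_apply, smul_eq_mul, ← integral_const_mul]
        refine integral_congr_ae ?_
        filter_upwards [h.quasiMeasurePreserving.ae_eq_comp (Lp.coeFn_smul a F)] with x hx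
        have hx' : (a • F : Lp ℂ 2 (volume : Measure R4)) (collapseMap (ι x)) =
          a * F (collapseMap (ι x)) := hx
        rw [hx']
        ring }
    (C * (eLpNorm (fun x => (w x : ℂ) * g x) 2 μ).toReal) fun F => by
      have h1 := (h.integrable hg (Lp.memLp F) z).2
      rw [← ENNReal.toReal_le_toReal (by simp) (ENNReal.mul_ne_top
        (ENNReal.mul_ne_top (by simp) hg.2.ne) (Lp.memLp F).2.ne)] at h1
      simpa [ENNReal.toReal_mul, Lp.norm_def] using h1

/-- The functional `F ↦ ∫ m F · phase · g` is bounded on `L²` and hence represented by some `k`. A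
Schwartz function `φ` is reached as `m · (φ / m)`, with `φ / m` in `L²`. -/
theorem exists_fourierFunction_collapsed (h : CollapseEstimate μ ι m w C) (hN : DecayOverSymbol m N)
    (hg : MemLp (fun x => (w x : ℂ) * g x) 2 μ) (hgm : Measurable g) (z : R3) :
    ∃ H : R4 → ℂ, HasFourierFunction (𝓕⁻ (collapsedFourier h hN hg hgm z)) H ∧
      eLpNorm (fun y => (m y : ℂ) * H y) 2 volume ≤
        C * eLpNorm (fun x => (w x : ℂ) * g x) 2 μ := by
  let B := collapsedFunctional h hg z
  let k : Lp ℂ 2 (volume : Measure R4) := (InnerProductSpace.toDual ℂ _).symm B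
  have hB : ∀ F, B F = ∫ y, F y * (starRingEnd ℂ) (k y) := by
    intro F
    have := InnerProductSpace.toDual_symm_apply (𝕜 := ℂ) (x := F) (y := B)
    rw [← this, L2.inner_def]
    rfl
  have hm := h.measurable_symbol
  have hk : AEStronglyMeasurable (fun y => (starRingEnd ℂ) (k y)) :=
    Complex.continuous_conj.comp_aestronglyMeasurable (Lp.memLp k).1
  have hk2 : MemLp (fun y => (starRingEnd ℂ) (k y)) 2 volume :=
    (Lp.memLp k).congr_norm hk (Eventually.of_forall fun y => by simp)
  -- The conjugate appears because the inner product is conjugate linear in `k`. Where `m = 0` the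
  -- quotient is `0`, which can only lower the norm of `m H`.
  refine ⟨fun y => (starRingEnd ℂ) (k y) / m y, ⟨?_, fun φ => ?_⟩, ?_⟩
  · simp_rw [div_eq_mul_inv]
    exact hk.mul (Complex.measurable_ofReal.comp hm).inv.aestronglyMeasurable
  · have hφ := hN.memLp hm φ
    have e0 : (fun y => φ y * ((starRingEnd ℂ) (k y) / m y)) =
        fun y => φ y / m y * (starRingEnd ℂ) (k y) := by
      ext y
      ring
    rw [e0]
    refine ⟨hφ.integrable_mul hk2, ?_⟩
    rw [fourier_fourierInv_eq, collapsedFourier_apply]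
    let F : Lp ℂ 2 (volume : Measure R4) := hφ.toLp _
    have hF : F =ᵐ[volume] fun y => φ y / m y := hφ.coeFn_toLp
    have h2 : ∫ y, F y * (starRingEnd ℂ) (k y) = ∫ y, φ y / m y * (starRingEnd ℂ) (k y) := by
      refine integral_congr_ae ?_
      filter_upwards [hF] with y hy
      rw [hy]
    rw [← h2, ← hB F]
    refine integral_congr_ae ?_
    filter_upwards [h.symbol_ne_zero, h.quasiMeasurePreserving.ae_eq_comp hF] with x hx hy
    have hy' : F (collapseMap (ι x)) = φ (collapseMap (ι x)) / m (collapseMap (ι x)) := hy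
    have hx' : (m (collapseMap (ι x)) : ℂ) ≠ 0 := by exact_mod_cast hx
    rw [hy', mul_div_cancel₀ _ hx']
  · have h1 : eLpNorm (fun y => (m y : ℂ) * ((starRingEnd ℂ) (k y) / m y)) 2 volume ≤
        eLpNorm k 2 volume := by
      refine eLpNorm_mono fun y => ?_
      rcases eq_or_ne (m y) 0 with h0 | h0
      · simp [h0]
      · have h0' : (m y : ℂ) ≠ 0 := by exact_mod_cast h0
        rw [mul_div_cancel₀ _ h0']
        simp
    refine h1.trans ?_
    have h2 : ‖k‖ ≤ C * (eLpNorm (fun x => (w x : ℂ) * g x) 2 μ).toReal := by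
      rw [LinearIsometryEquiv.norm_map]
      exact LinearMap.mkContinuous_norm_le _ (by positivity) _
    rw [Lp.norm_def] at h2
    rw [← ENNReal.toReal_le_toReal (Lp.memLp k).2.ne (ENNReal.mul_ne_top (by simp) hg.2.ne)]
    simpa [ENNReal.toReal_mul] using h2

/-- The collapsing estimate, in terms of the Fourier transform. -/
theorem CollapseEstimate.exists_isCollapse [SFinite μ] (h : CollapseEstimate μ ι m w C)
    (hN : DecayOverSymbol m N) (hg : MemLp (fun x => (w x : ℂ) * g x) 2 μ) (hgm : Measurable g)
    {u : 𝓢'(R7, ℂ)} (hu : ∀ Φ : 𝓢(R7, ℂ), (𝓕 u) Φ = ∫ x, Φ (ι x) * g x ∂μ) :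
    ∃ G : R3 → 𝓢'(R4, ℂ), IsCollapse u G ∧ ∀ z, ∃ H : R4 → ℂ, HasFourierFunction (G z) H ∧
      eLpNorm (fun y => (m y : ℂ) * H y) 2 volume ≤
        C * eLpNorm (fun x => (w x : ℂ) * g x) 2 μ :=
  ⟨_, isCollapse_collapsedFourier h hN hg hgm hu,
    exists_fourierFunction_collapsed h hN hg hgm⟩

end Collapse

/-- Plancherel: `𝓕⁻ H` is an `L²` function representing `u`. -/
theorem l2Norm_le_of_hasFourierFunction {E : Type*} [NormedAddCommGroup E] [InnerProductSpace ℝ E]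
    [FiniteDimensional ℝ E] [MeasurableSpace E] [BorelSpace E] {u : 𝓢'(E, ℂ)} {H : E → ℂ}
    (h : HasFourierFunction u H) : l2Norm u ≤ eLpNorm H 2 volume := by
  rcases eq_or_ne (eLpNorm H 2 volume) ⊤ with h0 | h0
  · rw [h0]
    exact le_top
  have hH : MemLp H 2 volume := ⟨h.1, h0.lt_top⟩
  let f : Lp ℂ 2 (volume : Measure E) := hH.toLp _
  have hf : (f : 𝓢'(E, ℂ)) = 𝓕 u := by
    ext φ
    rw [Lp.toTemperedDistribution_apply, (h.2 φ).2]
    refine integral_congr_ae ?_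
    filter_upwards [hH.coeFn_toLp] with x hx
    rw [hx, smul_eq_mul]
  refine (iInf₂_le (𝓕⁻ f) ?_).trans ?_
  · rw [← Lp.fourierInv_toTemperedDistribution_eq, hf, fourierInv_fourier_eq]
  · have h1 : ‖𝓕⁻ f‖ = ‖f‖ := by
      rw [← Lp.norm_fourier_eq, fourier_fourierInv_eq]
    rw [← ofReal_norm, h1, ofReal_norm, Lp.enorm_toLp]

/-! ### Integrals over `ℝ³` in coordinates adapted to a direction. -/

theorem lintegral_comp_mul_add {F : ℝ → ℝ≥0∞} (hF : Measurable F) {a : ℝ} (ha : a ≠ 0) (b : ℝ) :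
    ∫⁻ x, F (a * x + b) = ENNReal.ofReal |a⁻¹| * ∫⁻ x, F x := by
  rw [← lintegral_add_right_eq_self (μ := volume) F b, ← smul_eq_mul, ← lintegral_smul_measure,
    ← Real.map_volume_mul_left ha, lintegral_map (by fun_prop) (by fun_prop)]

theorem lintegral_Ioi_comp_sq (h : ℝ → ℝ≥0∞) :
    ∫⁻ s in Ioi 0, h s = ∫⁻ a in Ioi 0, ENNReal.ofReal (2 * a) * h (a ^ 2) := by
  have himage : (fun a : ℝ => a ^ 2) '' Ioi 0 = Ioi 0 := by
    ext s
    constructor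
    · rintro ⟨a, ha, rfl⟩
      exact pow_pos (mem_Ioi.1 ha) 2
    · intro hs
      exact ⟨√s, Real.sqrt_pos.2 hs, Real.sq_sqrt (le_of_lt hs)⟩
  have h1 := lintegral_image_eq_lintegral_abs_deriv_mul (s := Ioi (0 : ℝ)) (f := fun a => a ^ 2)
    (f' := fun a => 2 * a) measurableSet_Ioi
    (fun a _ => by simpa using (hasDerivAt_pow 2 a).hasDerivWithinAt)
    (fun a ha b hb hab => (pow_left_inj₀ (le_of_lt ha) (le_of_lt hb) two_ne_zero).1 hab) h
  rw [himage] at h1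
  rw [h1]
  refine setLIntegral_congr_fun measurableSet_Ioi fun a ha => ?_
  have ha' : 0 < a := ha
  simp only [abs_of_pos (by linarith : 0 < 2 * a)]

theorem lintegral_radial_plane {h : ℝ → ℝ≥0∞} (hh : Measurable h) :
    ∫⁻ v : ℝ × ℝ, h (v.1 ^ 2 + v.2 ^ 2) = ENNReal.ofReal Real.pi * ∫⁻ s in Ioi 0, h s := by
  rw [← lintegral_comp_polarCoord_symm]
  have e : ∀ p : ℝ × ℝ, ENNReal.ofReal p.1 • h ((polarCoord.symm p).1 ^ 2 +
      (polarCoord.symm p).2 ^ 2) = (fun r => ENNReal.ofReal r * h (r ^ 2)) p.1 := by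
    intro p
    rw [polarCoord_symm_apply, smul_eq_mul]
    congr 2
    linear_combination p.1 ^ 2 * Real.sin_sq_add_cos_sq p.2
  have hm : Measurable fun r : ℝ => ENNReal.ofReal r * h (r ^ 2) := by fun_prop
  simp_rw [e]
  rw [polarCoord_target, Measure.volume_eq_prod, ← Measure.prod_restrict,
    lintegral_prod _ (Measurable.aemeasurable (by fun_prop))]
  simp only [lintegral_const, Measure.restrict_apply_univ, Real.volume_Ioo]
  rw [lintegral_mul_const _ hm, lintegral_Ioi_comp_sq h, mul_comm]
  have e2 : ∀ a : ℝ, ENNReal.ofReal (2 * a) * h (a ^ 2) =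
      2 * (ENNReal.ofReal a * h (a ^ 2)) := by
    intro a
    rw [ENNReal.ofReal_mul zero_le_two, ENNReal.ofReal_ofNat, mul_assoc]
  rw [lintegral_congr e2, lintegral_const_mul _ hm, ← mul_assoc]
  congr 1
  rw [sub_neg_eq_add, ← two_mul, ENNReal.ofReal_mul zero_le_two, ENNReal.ofReal_ofNat, mul_comm]

/-- An orthonormal basis whose first vector is `ζ / |ζ|`; for `ζ = 0` any orthonormal basis serves.
-/
theorem exists_aligned_coordinates (ζ : R3) : ∃ e : ℝ × (ℝ × ℝ) → R3,
    MeasurePreserving e (volume.prod volume) volume ∧ ∀ x, inner ℝ (e x) ζ = x.1 * ‖ζ‖ ∧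
      ‖e x‖ ^ 2 = x.1 ^ 2 + (x.2.1 ^ 2 + x.2.2 ^ 2) := by
  obtain ⟨b, hb⟩ : ∃ b : OrthonormalBasis (Fin 3) ℝ R3, inner ℝ (b 0) ζ = ‖ζ‖ ∧
      ∀ i, i ≠ 0 → inner ℝ (b i) ζ = 0 := by
    rcases eq_or_ne ζ 0 with h0 | h0
    · exact ⟨EuclideanSpace.basisFun _ _, by simp [h0]⟩
    · obtain ⟨b, hb⟩ := Orthonormal.exists_orthonormalBasis_extension_of_card_eq (𝕜 := ℝ)
        (E := R3) (ι := Fin 3) (by simp) (v := fun _ => ‖ζ‖⁻¹ • ζ) (s := {0}) (by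
          refine ⟨fun i => ?_, fun i j hij => absurd (Subsingleton.elim i j) hij⟩
          simp [norm_smul, h0])
      have hb0 : b 0 = ‖ζ‖⁻¹ • ζ := hb 0 rfl
      have hz : ζ = ‖ζ‖ • b 0 := by
        rw [hb0, smul_smul, mul_inv_cancel₀ (norm_ne_zero_iff.2 h0), one_smul]
      refine ⟨b, ?_, fun i hi => ?_⟩
      · conv_lhs => rw [hz, inner_smul_right]
        simp
      · rw [hz, inner_smul_right, b.orthonormal.2 hi, mul_zero]
  have f1 : MeasurePreserving (Prod.map (id : ℝ → ℝ) (MeasurableEquiv.finTwoArrow (α := ℝ)).symm)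
      (volume.prod volume) (volume.prod volume) :=
    (MeasurePreserving.id _).prod (volume_preserving_finTwoArrow ℝ).symm
  have f2 := (volume_preserving_piFinSuccAbove (fun _ : Fin 3 => ℝ) 0).symm
  have f3 := PiLp.volume_preserving_toLp (Fin 3)
  have f4 := b.repr.symm.measurePreserving
  refine ⟨_, f4.comp (f3.comp (f2.comp f1)), fun x => ?_⟩
  let y : Fin 3 → ℝ := (MeasurableEquiv.piFinSuccAbove (fun _ : Fin 3 => ℝ) 0).symm
    (x.1, (MeasurableEquiv.finTwoArrow (α := ℝ)).symm x.2)
  have y0 : y 0 = x.1 := rfl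
  have y1 : y 1 = x.2.1 := rfl
  have y2 : y 2 = x.2.2 := rfl
  change inner ℝ (b.repr.symm (WithLp.toLp 2 y)) ζ = _ ∧ ‖b.repr.symm (WithLp.toLp 2 y)‖ ^ 2 = _
  constructor
  · rw [← b.sum_repr_symm, sum_inner, Fin.sum_univ_three]
    simp [inner_smul_left, hb.1, hb.2, y0]
  · rw [LinearIsometryEquiv.norm_map, EuclideanSpace.norm_sq_eq, Fin.sum_univ_three]
    simp [y0, y1, y2]
    ring

theorem lintegral_aligned_coordinates (ζ : R3) {H : ℝ → ℝ → ℝ≥0∞}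
    (hH : Measurable (Function.uncurry H)) :
    ∫⁻ ξ : R3, H (inner ℝ ξ ζ) (‖ξ‖ ^ 2) = ENNReal.ofReal Real.pi *
      ∫⁻ u : ℝ, ∫⁻ r in Ioi 0, H (u * ‖ζ‖) (u ^ 2 + r) := by
  obtain ⟨e, he, h⟩ := exists_aligned_coordinates ζ
  have hm : Measurable fun ξ : R3 => H (inner ℝ ξ ζ) (‖ξ‖ ^ 2) :=
    hH.comp (f := fun ξ : R3 => (inner ℝ ξ ζ, ‖ξ‖ ^ 2)) (by fun_prop)
  have hme : Measurable fun a => H (inner ℝ (e a) ζ) (‖e a‖ ^ 2) := hm.comp he.measurable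
  rw [← he.lintegral_comp hm, lintegral_prod _ hme.aemeasurable,
    ← lintegral_const_mul]
  · refine lintegral_congr fun u => ?_
    simp_rw [(h _).1, (h _).2]
    have : Measurable fun r : ℝ => H (u * ‖ζ‖) (u ^ 2 + r) :=
      hH.comp (f := fun r : ℝ => (u * ‖ζ‖, u ^ 2 + r)) (by fun_prop)
    exact lintegral_radial_plane this
  · have : Measurable fun y : ℝ × ℝ => H (y.1 * ‖ζ‖) (y.1 ^ 2 + y.2) :=
      hH.comp (f := fun y : ℝ × ℝ => (y.1 * ‖ζ‖, y.1 ^ 2 + y.2)) (by fun_prop)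
    exact this.lintegral_prod_right'

/-- Let `c = |ζ|`, let `u` be the component of `ξ` along `ζ`, and let `a = |ξ|`. The volume is `2π a
da du` on `|u| < a`, so the weight `1/|ξ|` leaves `2π ∫∫ G(a² - u c) du da`. For `c > 0` and `y = a²
- u c`, the set of admissible `a` has length at most `c`, which cancels the Jacobian `1 / c`. For `c
= 0` the inner integral is `2a G(a²)`. -/
theorem lintegral_inv_norm_comp_le (ζ : R3) {G : ℝ → ℝ≥0∞} (hG : Measurable G) :
    ∫⁻ ξ : R3, ENNReal.ofReal (1 / ‖ξ‖) * G (‖ξ‖ ^ 2 - inner ℝ ξ ζ) ≤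
      ENNReal.ofReal (2 * Real.pi) * ∫⁻ y, G y := by
  have hH : Measurable (Function.uncurry fun i n : ℝ => ENNReal.ofReal (1 / √n) * G (n - i)) := by
    simp only [Function.uncurry_def]
    fun_prop
  have e := lintegral_aligned_coordinates ζ hH
  simp only [Real.sqrt_sq (norm_nonneg _)] at e
  rw [e, mul_comm 2 Real.pi, ENNReal.ofReal_mul Real.pi_pos.le, ENNReal.ofReal_ofNat, mul_assoc]
  gcongr
  set c := ‖ζ‖ with hc
  let K : ℝ → ℝ → ℝ≥0∞ := fun s u =>
    (Ioi (u ^ 2)).indicator (fun _ => ENNReal.ofReal (1 / √s) * G (s - u * c)) s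
  have hK : Measurable (Function.uncurry K) := by
    have : Function.uncurry K = {y : ℝ × ℝ | y.2 ^ 2 < y.1}.indicator
        fun y => ENNReal.ofReal (1 / √y.1) * G (y.1 - y.2 * c) := by
      ext y
      simp only [Function.uncurry, K, indicator, mem_Ioi, mem_ofPred_eq]
    rw [this]
    exact Measurable.indicator (by fun_prop) (measurableSet_lt (by fun_prop) (by fun_prop))
  have e1 : ∀ u : ℝ, ∫⁻ r in Ioi 0, ENNReal.ofReal (1 / √(u ^ 2 + r)) * G (u ^ 2 + r - u * c) =
      ∫⁻ s, K s u := by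
    intro u
    rw [← lintegral_add_left_eq_self (μ := volume) _ (u ^ 2), ← lintegral_indicator measurableSet_Ioi]
    refine lintegral_congr fun r => ?_
    simp [K, indicator]
  simp_rw [e1]
  -- With `s = |ξ|²` as the outer variable, the inner one ranges over `u² < s`; then `s = a²` turns
  -- `ds / √s` into `2 da`.
  rw [lintegral_lintegral_swap (by exact (hK.comp measurable_swap).aemeasurable)]
  have e2 : ∫⁻ s, ∫⁻ u, K s u = ∫⁻ s in Ioi 0, ∫⁻ u, K s u := by
    rw [← lintegral_indicator measurableSet_Ioi]
    refine lintegral_congr fun s => ?_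
    by_cases hs : 0 < s
    · simp [hs]
    · have : ∀ u, K s u = 0 := fun u => by
        simp [K, indicator, not_lt.2 ((not_lt.1 hs).trans (sq_nonneg u))]
      simp [this, hs]
  let D : ℝ → ℝ → ℝ≥0∞ := fun a u => (Ioo (-a) a).indicator (fun u => G (a ^ 2 - u * c)) u
  have e3 : ∀ a ∈ Ioi (0 : ℝ), ENNReal.ofReal (2 * a) * ∫⁻ u, K (a ^ 2) u = 2 * ∫⁻ u, D a u := by
    intro a ha
    have ha' : 0 < a := ha
    have e4 : ∀ u, K (a ^ 2) u = ENNReal.ofReal (1 / a) * D a u := by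
      intro u
      by_cases hu : u ∈ Ioo (-a) a
      · have : u ^ 2 < a ^ 2 := sq_lt_sq' hu.1 hu.2
        simp [K, D, hu, this, Real.sqrt_sq ha'.le]
      · have : ¬ u ^ 2 < a ^ 2 := fun h => hu (abs_lt.1 ((sq_lt_sq.1 h).trans_eq (abs_of_pos ha')))
        simp [K, D, hu, this]
    simp_rw [e4]
    rw [lintegral_const_mul _ (Measurable.indicator (by fun_prop) measurableSet_Ioo), ← mul_assoc,
      ← ENNReal.ofReal_mul (by positivity)]
    congr 1
    rw [mul_one_div, mul_div_cancel_right₀ _ ha'.ne', ENNReal.ofReal_ofNat]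
  rw [e2, lintegral_Ioi_comp_sq, setLIntegral_congr_fun measurableSet_Ioi e3]
  rcases (norm_nonneg ζ).eq_or_lt with h0 | h0
  · have e5 : ∀ a ∈ Ioi (0 : ℝ), 2 * ∫⁻ u, D a u = 2 * (ENNReal.ofReal (2 * a) * G (a ^ 2)) := by
      intro a _
      simp only [D, hc, ← h0, mul_zero, sub_zero]
      rw [lintegral_indicator measurableSet_Ioo, lintegral_const, Measure.restrict_apply_univ,
        Real.volume_Ioo, sub_neg_eq_add, ← two_mul, mul_comm (G _)]
    rw [setLIntegral_congr_fun measurableSet_Ioi e5, lintegral_const_mul _ (by fun_prop),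
      ← lintegral_Ioi_comp_sq]
    exact mul_le_mul_right (setLIntegral_le_lintegral _ _) _
  · have hc0 : 0 < c := h0
    let S : Set (ℝ × ℝ) := {x | 0 < x.1 ∧ |x.1 ^ 2 - x.2| < x.1 * c}
    have hS : MeasurableSet S :=
      (measurableSet_lt measurable_const measurable_fst).inter
        (measurableSet_lt (f := fun x : ℝ × ℝ => |x.1 ^ 2 - x.2|) (g := fun x => x.1 * c)
          (by fun_prop) (by fun_prop))
    have e5 : ∀ a ∈ Ioi (0 : ℝ), 2 * ∫⁻ u, D a u =
        ∫⁻ y, ENNReal.ofReal (2 / c) * (G y * S.indicator 1 (a, y)) := by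
      intro a ha
      have hSa : Measurable fun y => S.indicator (1 : ℝ × ℝ → ℝ≥0∞) (a, y) :=
        (measurable_one.indicator hS).comp (by fun_prop)
      rw [lintegral_const_mul _ (by fun_prop), ENNReal.ofReal_div_of_pos hc0, ENNReal.ofReal_ofNat,
        div_eq_mul_inv, ← ENNReal.ofReal_inv_of_pos hc0, mul_assoc]
      congr 1
      have := lintegral_comp_mul_add (F := fun y => G y * S.indicator 1 (a, y)) (by fun_prop)
        (neg_ne_zero.2 hc0.ne') (a ^ 2)
      rw [inv_neg, abs_neg, abs_of_pos (inv_pos.2 hc0)] at this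
      rw [← this]
      refine lintegral_congr fun u => ?_
      have e6 : -c * u + a ^ 2 = a ^ 2 - u * c := by ring
      have e7 : (a, a ^ 2 - u * c) ∈ S ↔ u ∈ Ioo (-a) a := by
        have : |u * c| = |u| * c := by rw [abs_mul, abs_of_pos hc0]
        simp only [S, mem_ofPred_eq, mem_Ioi.1 ha, true_and, sub_sub_cancel, this,
          mul_lt_mul_iff_left₀ hc0, mem_Ioo, ← abs_lt]
      rw [e6]
      by_cases hu : u ∈ Ioo (-a) a
      · simp [D, hu, e7.2 hu]
      · simp [D, hu, mt e7.1 hu]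
    have hS1 : Measurable (S.indicator (1 : ℝ × ℝ → ℝ≥0∞)) := measurable_one.indicator hS
    rw [setLIntegral_congr_fun measurableSet_Ioi e5, lintegral_lintegral_swap
      (Measurable.aemeasurable (by simp only [Function.uncurry_def]; fun_prop)),
      ← lintegral_const_mul _ hG]
    refine lintegral_mono fun y => ?_
    have hSy : Measurable fun a => S.indicator (1 : ℝ × ℝ → ℝ≥0∞) (a, y) := hS1.comp (by fun_prop)
    rw [lintegral_const_mul _ (by fun_prop), lintegral_const_mul _ (by fun_prop),
      mul_left_comm, mul_comm 2]
    gcongr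
    have e8 : ∫⁻ a in Ioi 0, S.indicator (1 : ℝ × ℝ → ℝ≥0∞) (a, y) ≤ volume {a | (a, y) ∈ S} := by
      exact (setLIntegral_le_lintegral _ _).trans_eq
        (lintegral_indicator_one (hS.preimage (by fun_prop : Measurable fun a : ℝ => (a, y))))
    -- For two admissible `a, a'`, subtracting the conditions gives `|a² - a'²| ≤ c (a + a')`, hence
    -- `|a - a'| ≤ c`: the diameter bounds the measure.
    have e9 : volume {a | (a, y) ∈ S} ≤ ENNReal.ofReal c := by
      refine (Real.volume_le_diam _).trans (Metric.ediam_le fun a ha a' ha' => ?_)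
      rw [edist_dist, Real.dist_eq]
      refine ENNReal.ofReal_le_ofReal ?_
      obtain ⟨h1, h2⟩ := ha
      obtain ⟨h3, h4⟩ := ha'
      simp only at h1 h2 h3 h4
      have h5 : |a - a'| * (a + a') ≤ c * (a + a') := by
        rw [← abs_of_pos (add_pos h1 h3), ← abs_mul, abs_of_pos (add_pos h1 h3)]
        rw [abs_lt] at h2 h4
        rw [abs_le]
        constructor <;> nlinarith
      exact le_of_mul_le_mul_right h5 (add_pos h1 h3)
    calc ENNReal.ofReal (2 / c) * _ ≤ ENNReal.ofReal (2 / c) * ENNReal.ofReal c := by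
          gcongr
          exact e8.trans e9
      _ = 2 := by
          rw [← ENNReal.ofReal_mul (by positivity), div_mul_cancel₀ _ hc0.ne', ENNReal.ofReal_ofNat]

/-- The symbol of `S`, without the part in `τ` and up to the normalization of frequencies. -/
def freqS (p : R6) : ℝ := 2 * Real.pi * (‖p.fst‖ ^ 2 + ‖p.snd‖ ^ 2)

/-- The symbol of `S_±`, without the part in `τ` and up to the normalization of frequencies. -/
def freqW (p : R6) : ℝ := 2 * Real.pi * (‖p.fst‖ ^ 2 - ‖p.snd‖ ^ 2)

theorem symbolS_eq (P : R7) : symbolS P = 2 * Real.pi * (P.fst + freqS P.snd) := by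
  simp only [symbolS, freqS, norm_smul, Real.norm_eq_abs, mul_pow, sq_abs]
  ring

theorem symbolW_eq (P : R7) : symbolW P = 2 * Real.pi * (P.fst + freqW P.snd) := by
  simp only [symbolW, freqW, norm_smul, Real.norm_eq_abs, mul_pow, sq_abs]
  ring

theorem measurable_freqS : Measurable freqS := by
  unfold freqS
  fun_prop

theorem measurable_freqW : Measurable freqW := by
  unfold freqW
  fun_prop

/-- The kernel `k` on the surface `τ = -q(ξ, η)` has bounded integrals, up to constants, over the
fibres of the collapsing map. -/
def KernelBound (q : R6 → ℝ) (k : R6 → ℝ≥0∞) (C : ℝ≥0) : Prop :=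
  ∀ f : R4 → ℝ≥0∞, Measurable f →
    ∫⁻ p, k p * f (WithLp.toLp 2 (-q p, p.fst + p.snd)) ≤ C * ∫⁻ y, f y

/-! ### From fibre integrals to collapsing estimates. -/

section KernelBound

variable {q : R6 → ℝ} {k k' : R6 → ℝ≥0∞} {C C' : ℝ≥0}

/-- With `η = ζ - ξ` and Fubini the bound can be proved for each fixed total frequency `ζ`; the
single value `ζ = 0` is null. -/
theorem KernelBound.of_slice (hq : Measurable q) (hk : Measurable k)
    (h : ∀ ζ : R3, ζ ≠ 0 → ∀ F : ℝ → ℝ≥0∞, Measurable F →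
      ∫⁻ ξ : R3, k (WithLp.toLp 2 (ξ, ζ - ξ)) * F (-q (WithLp.toLp 2 (ξ, ζ - ξ))) ≤
        C * ∫⁻ y, F y) : KernelBound q k C := by
  intro f hf
  have hF : Measurable fun y : R3 × R3 => k (WithLp.toLp 2 y) *
      f (WithLp.toLp 2 (-q (WithLp.toLp 2 y), (WithLp.toLp 2 y).fst + (WithLp.toLp 2 y).snd)) := by
    fun_prop
  rw [lintegral_withLp_prod, Measure.volume_eq_prod, lintegral_prod _ hF.aemeasurable]
  have e1 : ∀ ξ : R3, ∫⁻ η : R3, k (WithLp.toLp 2 (ξ, η)) *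
      f (WithLp.toLp 2 (-q (WithLp.toLp 2 (ξ, η)), ξ + η)) = ∫⁻ ζ : R3,
      k (WithLp.toLp 2 (ξ, ζ - ξ)) * f (WithLp.toLp 2 (-q (WithLp.toLp 2 (ξ, ζ - ξ)), ζ)) := by
    intro ξ
    rw [← lintegral_sub_right_eq_self (μ := volume) _ ξ]
    simp only [add_sub_cancel]
  change ∫⁻ ξ : R3, ∫⁻ η : R3, k (WithLp.toLp 2 (ξ, η)) *
      f (WithLp.toLp 2 (-q (WithLp.toLp 2 (ξ, η)), ξ + η)) ≤ _
  have hm : Measurable fun y : R3 × R3 => k (WithLp.toLp 2 (y.1, y.2 - y.1)) *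
      f (WithLp.toLp 2 (-q (WithLp.toLp 2 (y.1, y.2 - y.1)), y.2)) := by fun_prop
  simp_rw [e1]
  rw [lintegral_lintegral_swap hm.aemeasurable, lintegral_withLp_prod' hf, ← lintegral_const_mul]
  · refine lintegral_mono_ae ?_
    have h0 : ∀ᵐ ζ : R3, ζ ≠ 0 := by simp [ae_iff]
    filter_upwards [h0] with ζ hζ
    exact h ζ hζ (fun t => f (WithLp.toLp 2 (t, ζ))) (by fun_prop)
  · have : Measurable fun y : R3 × ℝ => f (WithLp.toLp 2 (y.2, y.1)) := by fun_prop
    exact this.lintegral_prod_right'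

theorem KernelBound.mono (h : KernelBound q k C) (hk : ∀ᵐ p, k' p ≤ k p) : KernelBound q k' C := by
  intro f hf
  refine (lintegral_mono_ae ?_).trans (h f hf)
  filter_upwards [hk] with p hp
  gcongr

theorem KernelBound.add (h : KernelBound q k C) (h' : KernelBound q k' C') (hq : Measurable q)
    (hk : Measurable k) : KernelBound q (fun p => k p + k' p) (C + C') := by
  intro f hf
  simp only [add_mul, ENNReal.coe_add]
  rw [lintegral_add_left (by fun_prop)]
  exact add_le_add (h f hf) (h' f hf)

theorem KernelBound.const_mul (h : KernelBound q k C) (c : ℝ≥0) :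
    KernelBound q (fun p => c * k p) (c * C) := by
  intro f hf
  simp only [mul_assoc, ENNReal.coe_mul]
  rw [lintegral_const_mul' _ _ (by simp)]
  gcongr
  exact h f hf

theorem KernelBound.free (h : KernelBound q k C) {m : R4 → ℝ} {w : R6 → ℝ} (hq : Measurable q)
    (hm : Measurable m) (hw : Measurable w)
    (hm0 : ∀ᵐ p, m (collapseMap (WithLp.toLp 2 (-q p, p))) ≠ 0) (hw0 : ∀ᵐ p, w p ≠ 0)
    (hk : ∀ᵐ p, ‖m (collapseMap (WithLp.toLp 2 (-q p, p))) / w p‖ₑ ^ 2 ≤ k p) :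
    CollapseEstimate volume (fun p => WithLp.toLp 2 (-q p, p)) m w (NNReal.sqrt C) where
  measurable_map := by fun_prop
  measurable_symbol := hm
  measurable_weight := hw
  symbol_ne_zero := hm0
  weight_ne_zero := hw0
  lintegral_le f hf := by
    rw [← ENNReal.coe_pow, NNReal.sq_sqrt]
    exact (h.mono hk) f hf

/-- For fixed `s = τ + q(p)` the points lie on a translate in `τ` of the characteristic surface, so
the fibre bound applies to a translate of `f` with the same constant. The squared inverse weight is
at most `(1 + |s|)^{-2b}`, integrable because `2b > 1`. -/
theorem KernelBound.spaceTime {b : ℝ} (hb : 1 / 2 < b) : ∃ D : ℝ≥0, ∀ {q : R6 → ℝ}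
    {k : R6 → ℝ≥0∞} {C : ℝ≥0} {m : R4 → ℝ} {w : R7 → ℝ} {v : R6 → ℝ}, KernelBound q k C →
    Measurable q → Measurable k → Measurable m → Measurable v → (∀ᵐ P, m (collapseMap P) ≠ 0) →
    (∀ p, 0 < v p) →
    (∀ P, w P = (1 + |2 * Real.pi * (P.fst + q P.snd)|) ^ b * v P.snd) →
    (∀ᵐ P : R7, ‖m (collapseMap P) / v P.snd‖ₑ ^ 2 ≤ k P.snd) →
    CollapseEstimate volume id m w (NNReal.sqrt (D * C)) := by
  let W : ℝ → ℝ≥0∞ := fun s => ENNReal.ofReal ((1 + ‖s‖) ^ (-(2 * b)))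
  have hW : Measurable W := by fun_prop
  have hWfin : ∫⁻ s, W s ≠ ⊤ := (finite_integral_one_add_norm (E := ℝ) (by simp; linarith)).ne
  refine ⟨(∫⁻ s, W s).toNNReal, fun {q k C m w v} h hq hk hm hv hm0 hv0 hw hkm => ?_⟩
  have hwm : Measurable w := by
    rw [funext hw]
    fun_prop
  refine ⟨measurable_id, hm, hwm, hm0, Eventually.of_forall fun P => ?_, fun f hf => ?_⟩
  · rw [hw]
    have := hv0 P.snd
    positivity
  have h1 : ∀ᵐ P : R7, ‖m (collapseMap P) / w P‖ₑ ^ 2 * f (collapseMap P) ≤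
      W (P.fst + q P.snd) * (k P.snd * f (collapseMap P)) := by
    filter_upwards [hkm] with P hP
    rw [← mul_assoc]
    gcongr
    refine le_trans (le_of_eq ?_) (mul_le_mul'
      (a := ‖((1 + |2 * Real.pi * (P.fst + q P.snd)|) ^ b)⁻¹‖ₑ ^ 2) ?_ hP)
    · rw [← mul_pow, ← enorm_mul, hw]
      congr 2
      ring
    · have h2 : 1 + ‖P.fst + q P.snd‖ ≤ 1 + |2 * Real.pi * (P.fst + q P.snd)| := by
        rw [abs_mul, Real.norm_eq_abs, abs_of_pos Real.two_pi_pos]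
        nlinarith [abs_nonneg (P.fst + q P.snd), Real.pi_gt_three]
      have h3 : 0 < 1 + |2 * Real.pi * (P.fst + q P.snd)| := by positivity
      rw [Real.enorm_eq_ofReal (by positivity), ← ENNReal.ofReal_pow (by positivity),
        ← Real.rpow_neg h3.le, ← Real.rpow_natCast, ← Real.rpow_mul h3.le]
      refine ENNReal.ofReal_le_ofReal ?_
      rw [show -b * ((2 : ℕ) : ℝ) = -(2 * b) by push_cast; ring]
      exact Real.rpow_le_rpow_of_nonpos (by positivity) h2 (by linarith)
  refine (lintegral_mono_ae h1).trans ?_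
  have hm1 : Measurable fun P : R7 => W (P.fst + q P.snd) * (k P.snd * f (collapseMap P)) := by
    have := continuous_collapseMap.measurable
    fun_prop
  rw [lintegral_withLp_prod' hm1]
  have e1 : ∀ p : R6, ∫⁻ t : ℝ, W (t + q p) * (k p * f (WithLp.toLp 2 (t, p.fst + p.snd))) =
      ∫⁻ s : ℝ, W s * (k p * f (WithLp.toLp 2 (s - q p, p.fst + p.snd))) := by
    intro p
    rw [← lintegral_sub_right_eq_self (μ := volume) _ (q p)]
    simp only [sub_add_cancel]
  change ∫⁻ p : R6, ∫⁻ t : ℝ, W (t + q p) * (k p * f (WithLp.toLp 2 (t, p.fst + p.snd))) ≤ _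
  rw [lintegral_congr e1, lintegral_lintegral_swap (Measurable.aemeasurable (by
    simp only [Function.uncurry_def]; fun_prop)), ← ENNReal.coe_pow, NNReal.sq_sqrt,
    ENNReal.coe_mul, ENNReal.coe_toNNReal hWfin, mul_assoc, ← lintegral_mul_const _ hW]
  refine lintegral_mono fun s => ?_
  rw [lintegral_const_mul _ (by fun_prop)]
  gcongr
  have h2 := h (fun y => f (y + WithLp.toLp 2 (s, 0))) (by fun_prop)
  rw [lintegral_add_right_eq_self] at h2
  refine (lintegral_congr fun p => ?_).trans_le h2
  congr 2
  refine withLp_prod_ext ?_ ?_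
  · change s - q p = -q p + s
    ring
  · exact (add_zero (p.fst + p.snd)).symm

end KernelBound

/-! ### Fibre integrals for `S` and `S_±`. -/

theorem norm_sub_sq_eq (ξ ζ : R3) : ‖ζ - ξ‖ ^ 2 = ‖ζ‖ ^ 2 - 2 * inner ℝ ξ ζ + ‖ξ‖ ^ 2 := by
  rw [norm_sub_sq_real, real_inner_comm]

/-- On a slice `|ξ|² + |ζ - ξ|² = 2 (|ξ|² - ξ·ζ) + |ζ|²`, an affine function of the argument in
`lintegral_inv_norm_comp_le`. -/
theorem exists_kernelBound_inv_norm_fst :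
    ∃ C, KernelBound freqS (fun p => ENNReal.ofReal (1 / ‖p.fst‖)) C := by
  have hpi : -(4 * Real.pi) ≠ 0 := neg_ne_zero.2 (by positivity)
  refine ⟨(2 * Real.pi).toNNReal * |(-(4 * Real.pi))⁻¹|.toNNReal,
    KernelBound.of_slice measurable_freqS (by fun_prop) fun ζ _ F hF => ?_⟩
  have h := lintegral_inv_norm_comp_le ζ
    (G := fun y => F (-(4 * Real.pi) * y + -(2 * Real.pi * ‖ζ‖ ^ 2))) (by fun_prop)
  rw [lintegral_comp_mul_add hF hpi, ← mul_assoc] at h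
  refine (lintegral_congr fun ξ => ?_).trans_le h
  change ENNReal.ofReal (1 / ‖ξ‖) * F (-(2 * Real.pi * (‖ξ‖ ^ 2 + ‖ζ - ξ‖ ^ 2))) = _
  rw [norm_sub_sq_eq]
  congr 2
  ring

/-- The reflection `ξ ↦ ζ - ξ` exchanges the two frequencies and preserves `|ξ|² - ξ·ζ`. -/
theorem exists_kernelBound_inv_norm_snd :
    ∃ C, KernelBound freqS (fun p => ENNReal.ofReal (1 / ‖p.snd‖)) C := by
  have hpi : -(4 * Real.pi) ≠ 0 := neg_ne_zero.2 (by positivity)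
  refine ⟨(2 * Real.pi).toNNReal * |(-(4 * Real.pi))⁻¹|.toNNReal,
    KernelBound.of_slice measurable_freqS (by fun_prop) fun ζ _ F hF => ?_⟩
  have h := lintegral_inv_norm_comp_le ζ
    (G := fun y => F (-(4 * Real.pi) * y + -(2 * Real.pi * ‖ζ‖ ^ 2))) (by fun_prop)
  rw [lintegral_comp_mul_add hF hpi, ← mul_assoc, ← lintegral_sub_left_eq_self _ ζ] at h
  refine (lintegral_congr fun ξ => ?_).trans_le h
  change ENNReal.ofReal (1 / ‖ζ - ξ‖) * F (-(2 * Real.pi * (‖ξ‖ ^ 2 + ‖ζ - ξ‖ ^ 2))) = _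
  rw [norm_sub_sq_eq, inner_sub_left, real_inner_self_eq_norm_sq]
  congr 2
  ring

/-- With `ξ = ζ/2 + ω` one has `ξ - η = 2ω` and `|ξ|² + |η|² = 2|ω|² + |ζ|²/2`, so the integral
estimate is used with the zero vector in place of `ζ`. The factor `1/2` in the constant comes from
`1/|2ω|`. -/
theorem exists_kernelBound_inv_norm_sub :
    ∃ C, KernelBound freqS (fun p => ENNReal.ofReal (1 / ‖p.fst - p.snd‖)) C := by
  have hpi : -(4 * Real.pi) ≠ 0 := neg_ne_zero.2 (by positivity)
  refine ⟨(1 / 2 : ℝ).toNNReal * ((2 * Real.pi).toNNReal * |(-(4 * Real.pi))⁻¹|.toNNReal),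
    KernelBound.of_slice measurable_freqS (by fun_prop) fun ζ _ F hF => ?_⟩
  have h := lintegral_inv_norm_comp_le 0
    (G := fun y => F (-(4 * Real.pi) * y + -(Real.pi * ‖ζ‖ ^ 2))) (by fun_prop)
  rw [lintegral_comp_mul_add hF hpi, ← mul_assoc,
    ← lintegral_sub_right_eq_self _ ((1 / 2 : ℝ) • ζ)] at h
  have h2 := mul_le_mul_right h (ENNReal.ofReal (1 / 2))
  rw [← lintegral_const_mul _ (by fun_prop), ← mul_assoc] at h2
  refine (lintegral_congr fun ξ => ?_).trans_le h2
  change ENNReal.ofReal (1 / ‖ξ - (ζ - ξ)‖) * F (-(2 * Real.pi * (‖ξ‖ ^ 2 + ‖ζ - ξ‖ ^ 2))) = _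
  have e1 : ξ - (ζ - ξ) = (2 : ℝ) • (ξ - (1 / 2 : ℝ) • ζ) := by
    rw [smul_sub, smul_smul, two_smul]
    norm_num
    abel
  rw [e1, norm_smul, ← mul_assoc, ← ENNReal.ofReal_mul (by positivity), norm_sub_sq_eq,
    norm_sub_sq_real, inner_smul_right, norm_smul, inner_zero_right]
  congr 2
  · rw [Real.norm_ofNat, div_mul_div_comm, one_mul]
  · norm_num
    ring

/-- The argument of `F` depends only on the component `u` of `ξ` along `ζ`, with slope proportional
to `|ζ|`; the prefactor `|ζ|` cancels the Jacobian. The squared distance `r` to the line `ℝζ`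
separates, and the orthogonal plane contributes `π ∫ (1 + r)^{-(1+ε)} dr < ∞`. -/
theorem exists_lintegral_wave_slice_le {ε : ℝ} (hε : 0 < ε) : ∃ C : ℝ≥0, ∀ ζ : R3, ζ ≠ 0 →
    ∀ F : ℝ → ℝ≥0∞, Measurable F → ∫⁻ ξ : R3, ENNReal.ofReal
      (‖ζ‖ * (1 + (‖ξ‖ ^ 2 - (inner ℝ ξ ζ / ‖ζ‖) ^ 2)) ^ (-(1 + ε))) *
        F (-(2 * Real.pi * (2 * inner ℝ ξ ζ - ‖ζ‖ ^ 2))) ≤ C * ∫⁻ y, F y := by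
  let W : ℝ → ℝ≥0∞ := fun r => ENNReal.ofReal ((1 + r) ^ (-(1 + ε)))
  have hfin : ∫⁻ r in Ioi 0, W r ≠ ⊤ := by
    refine ne_top_of_le_ne_top
      (finite_integral_one_add_norm (E := ℝ) (μ := volume) (r := 1 + ε) (by simp [hε])).ne
      ((setLIntegral_mono' (g := fun r => ENNReal.ofReal ((1 + ‖r‖) ^ (-(1 + ε))))
        measurableSet_Ioi fun r hr => ?_).trans (setLIntegral_le_lintegral _ _))
    rw [Real.norm_of_nonneg (le_of_lt hr)]
  refine ⟨Real.pi.toNNReal * ((∫⁻ r in Ioi 0, W r).toNNReal * ((4 * Real.pi)⁻¹).toNNReal),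
    fun ζ hζ F hF => ?_⟩
  have hc : 0 < ‖ζ‖ := norm_pos_iff.2 hζ
  set c := ‖ζ‖
  have hH : Measurable (Function.uncurry fun i n : ℝ => ENNReal.ofReal
      (c * (1 + (n - (i / c) ^ 2)) ^ (-(1 + ε))) * F (-(2 * Real.pi * (2 * i - c ^ 2)))) := by
    simp only [Function.uncurry_def]
    fun_prop
  rw [lintegral_aligned_coordinates ζ hH, ENNReal.coe_mul, mul_assoc]
  refine mul_le_mul_right ?_ _
  have e1 : ∀ u : ℝ, ∫⁻ r in Ioi 0, ENNReal.ofReal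
      (c * (1 + (u ^ 2 + r - (u * c / c) ^ 2)) ^ (-(1 + ε))) *
        F (-(2 * Real.pi * (2 * (u * c) - c ^ 2))) = (∫⁻ r in Ioi 0, W r) *
      (ENNReal.ofReal c * F (-(4 * Real.pi * c) * u + 2 * Real.pi * c ^ 2)) := by
    intro u
    rw [← lintegral_mul_const _ (by fun_prop)]
    refine lintegral_congr fun r => ?_
    rw [mul_div_cancel_right₀ _ hc.ne', add_sub_cancel_left, ENNReal.ofReal_mul hc.le,
      mul_right_comm, mul_comm]
    congr 3
    ring
  change ∫⁻ u : ℝ, ∫⁻ r in Ioi 0, ENNReal.ofReal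
      (c * (1 + (u ^ 2 + r - (u * c / c) ^ 2)) ^ (-(1 + ε))) *
        F (-(2 * Real.pi * (2 * (u * c) - c ^ 2))) ≤ _
  have hpi := Real.pi_pos
  rw [lintegral_congr e1, lintegral_const_mul _ (by fun_prop), lintegral_const_mul _ (by fun_prop),
    lintegral_comp_mul_add hF (neg_ne_zero.2 (by positivity)), ENNReal.coe_mul,
    ENNReal.coe_toNNReal hfin, mul_assoc, ← mul_assoc (ENNReal.ofReal c),
    ← ENNReal.ofReal_mul hc.le, inv_neg, abs_neg, abs_of_pos (by positivity)]
  have e2 : c * (4 * (Real.pi * c))⁻¹ = (4 * Real.pi)⁻¹ := by field_simp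
  rw [e2, mul_assoc]
  rfl

/-! ### Inequalities between symbols. -/

theorem norm_two_pi_smul (ξ : R3) : ‖(2 * Real.pi) • ξ‖ = 2 * Real.pi * ‖ξ‖ := by
  rw [norm_smul, Real.norm_of_nonneg Real.two_pi_pos.le]

theorem norm_le_norm_two_pi_smul (ξ : R3) : ‖ξ‖ ≤ ‖(2 * Real.pi) • ξ‖ := by
  rw [norm_two_pi_smul]
  nlinarith [norm_nonneg ξ, Real.pi_gt_three]

theorem homSymbol_nonneg (s : ℝ) (ξ : R3) : 0 ≤ homSymbol s ξ :=
  Real.rpow_nonneg (norm_nonneg _) _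

theorem homSymbol_pos (s : ℝ) {ξ : R3} (h : ξ ≠ 0) : 0 < homSymbol s ξ := by
  have : 0 < ‖ξ‖ := norm_pos_iff.2 h
  refine Real.rpow_pos_of_pos ?_ _
  rw [norm_two_pi_smul]
  positivity

theorem homSymbol_half_sq (ξ : R3) : homSymbol (1 / 2) ξ ^ 2 = 2 * Real.pi * ‖ξ‖ := by
  rw [homSymbol, ← Real.sqrt_eq_rpow, Real.sq_sqrt (norm_nonneg _), norm_two_pi_smul]

theorem japSymbol_sq (s : ℝ) (ξ : R3) :
    japSymbol s ξ ^ 2 = (1 + ‖(2 * Real.pi) • ξ‖ ^ 2) ^ s := by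
  rw [japSymbol, ← Real.rpow_natCast, ← Real.rpow_mul (by positivity)]
  norm_num

theorem one_le_japSymbol {s : ℝ} (hs : 0 ≤ s) (ξ : R3) : 1 ≤ japSymbol s ξ :=
  Real.one_le_rpow (by nlinarith [sq_nonneg ‖(2 * Real.pi) • ξ‖]) (by positivity)

theorem one_le_japSymbol2 {s : ℝ} (hs : 0 ≤ s) (p : R6) : 1 ≤ japSymbol2 s p :=
  one_le_mul_of_one_le_of_one_le (one_le_japSymbol hs _) (one_le_japSymbol hs _)

theorem measurable_homSymbol (s : ℝ) : Measurable (homSymbol s) := by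
  unfold homSymbol
  fun_prop

theorem measurable_japSymbol (s : ℝ) : Measurable (japSymbol s) := by
  unfold japSymbol
  fun_prop

theorem measurable_japSymbol2 (s : ℝ) : Measurable (japSymbol2 s) := by
  have := measurable_japSymbol s
  unfold japSymbol2
  fun_prop

theorem norm_le_japSymbol_sq {s : ℝ} (hs : 1 / 2 ≤ s) (ξ : R3) : ‖ξ‖ ≤ japSymbol s ξ ^ 2 := by
  rw [japSymbol_sq]
  calc ‖ξ‖ ≤ ‖(2 * Real.pi) • ξ‖ := norm_le_norm_two_pi_smul ξ
    _ ≤ √(1 + ‖(2 * Real.pi) • ξ‖ ^ 2) := Real.le_sqrt_of_sq_le (by linarith)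
    _ = (1 + ‖(2 * Real.pi) • ξ‖ ^ 2) ^ (1 / 2 : ℝ) := Real.sqrt_eq_rpow _
    _ ≤ _ := Real.rpow_le_rpow_of_exponent_le (by nlinarith [sq_nonneg ‖(2 * Real.pi) • ξ‖]) hs

theorem homSymbol_div_sq_le {ξ η : R3} (hξ : ξ ≠ 0) (hη : η ≠ 0) :
    (homSymbol (1 / 2) (ξ + η) / (homSymbol (1 / 2) ξ * homSymbol (1 / 2) η)) ^ 2 ≤
      1 / ‖ξ‖ + 1 / ‖η‖ := by
  have h1 : 0 < ‖ξ‖ := norm_pos_iff.2 hξ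
  have h2 : 0 < ‖η‖ := norm_pos_iff.2 hη
  rw [div_pow, mul_pow, homSymbol_half_sq, homSymbol_half_sq, homSymbol_half_sq,
    div_add_div _ _ h1.ne' h2.ne', div_le_div_iff₀ (by have := Real.pi_pos; positivity)
    (by positivity)]
  have h3 := norm_add_le ξ η
  have h4 : 1 ≤ 2 * Real.pi := by linarith [Real.pi_gt_three]
  calc 2 * Real.pi * ‖ξ + η‖ * (‖ξ‖ * ‖η‖)
      ≤ 2 * Real.pi * (‖ξ‖ + ‖η‖) * (‖ξ‖ * ‖η‖) := by gcongr
    _ ≤ 2 * Real.pi * (2 * Real.pi * ((‖ξ‖ + ‖η‖) * (‖ξ‖ * ‖η‖))) := by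
        rw [mul_assoc (2 * Real.pi)]
        exact mul_le_mul_of_nonneg_left (le_mul_of_one_le_left (by positivity) h4) (by positivity)
    _ = _ := by ring

/-- The square of the numerator is at most `4^s (⟨ξ⟩^{2s} + ⟨η⟩^{2s})`. Dividing leaves `⟨ξ⟩^{-2s} +
⟨η⟩^{-2s}`, and `2s ≥ 1` gives the homogeneous bound. -/
theorem japSymbol_div_sq_le {s : ℝ} (hs : 1 / 2 ≤ s) {ξ η : R3} (hξ : ξ ≠ 0) (hη : η ≠ 0) :
    (japSymbol s (ξ + η) / (japSymbol s ξ * japSymbol s η)) ^ 2 ≤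
      4 ^ s * (1 / ‖ξ‖ + 1 / ‖η‖) := by
  have h1 : 0 < ‖ξ‖ := norm_pos_iff.2 hξ
  have h2 : 0 < ‖η‖ := norm_pos_iff.2 hη
  have hX := norm_le_japSymbol_sq hs ξ
  have hY := norm_le_japSymbol_sq hs η
  have hZ : japSymbol s (ξ + η) ^ 2 ≤ 4 ^ s * (japSymbol s ξ ^ 2 + japSymbol s η ^ 2) := by
    simp only [japSymbol_sq]
    set X := 1 + ‖(2 * Real.pi) • ξ‖ ^ 2 with hX'
    set Y := 1 + ‖(2 * Real.pi) • η‖ ^ 2 with hY'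
    have hX0 : 0 < X := by positivity
    have hY0 : 0 < Y := by positivity
    have hle : 1 + ‖(2 * Real.pi) • (ξ + η)‖ ^ 2 ≤ 4 * max X Y := by
      have h3 : ‖(2 * Real.pi) • (ξ + η)‖ ≤ ‖(2 * Real.pi) • ξ‖ + ‖(2 * Real.pi) • η‖ := by
        rw [smul_add]
        exact norm_add_le _ _
      nlinarith [le_max_left X Y, le_max_right X Y, norm_nonneg ((2 * Real.pi) • (ξ + η)),
        sq_nonneg (‖(2 * Real.pi) • ξ‖ - ‖(2 * Real.pi) • η‖)]
    calc _ ≤ (4 * max X Y) ^ s := Real.rpow_le_rpow (by positivity) hle (by linarith)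
      _ = 4 ^ s * max X Y ^ s := Real.mul_rpow (by norm_num) (by positivity)
      _ ≤ _ := by
        gcongr
        have := Real.rpow_pos_of_pos hX0 s
        have := Real.rpow_pos_of_pos hY0 s
        rcases max_cases X Y with ⟨h, _⟩ | ⟨h, _⟩ <;> rw [h] <;> linarith
  have hX1 : 0 < japSymbol s ξ ^ 2 := h1.trans_le hX
  have hY1 : 0 < japSymbol s η ^ 2 := h2.trans_le hY
  rw [div_pow, mul_pow]
  calc _ ≤ 4 ^ s * (japSymbol s ξ ^ 2 + japSymbol s η ^ 2) /
        (japSymbol s ξ ^ 2 * japSymbol s η ^ 2) := by gcongr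
    _ = 4 ^ s * (1 / japSymbol s ξ ^ 2 + 1 / japSymbol s η ^ 2) := by
        rw [div_add_div _ _ hX1.ne' hY1.ne', mul_div_assoc, one_mul, mul_one,
          add_comm (japSymbol s ξ ^ 2)]
    _ ≤ _ := by gcongr

/-- Let `Y` be the larger of `X, Y`. Then `z² ≤ 4Y`, so the extra power of `z` costs at most
`(4Y)^ε`. The remaining power `Y^{1/2}` and all of `X^{1/2+ε}` are bounded below through `V` and
produce `V^{1+ε}`. -/
theorem max_rpow_sq_le {z V X Y ε : ℝ} (hε : 0 < ε) (hz : 0 < z) (hV : 1 ≤ V) (hX : V ≤ X)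
    (hY : V ≤ Y) (hzXY : z ≤ √X + √Y) : max (z ^ (1 / 2 : ℝ)) (z ^ (1 / 2 + ε)) ^ 2 ≤
      4 ^ ε * (z * V ^ (-(1 + ε))) * (X ^ (1 / 2 + ε) * Y ^ (1 / 2 + ε)) := by
  wlog h : X ≤ Y generalizing X Y
  · rw [mul_comm (X ^ _)]
    exact this hY hX (by linarith) (le_of_not_ge h)
  have hY0 : 0 < Y := by linarith
  have hV0 : 0 < V := by linarith
  have h1 : z ^ 2 ≤ 4 * Y := by
    have h2 := Real.sqrt_le_sqrt h
    calc z ^ 2 ≤ (2 * √Y) ^ 2 := by gcongr; linarith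
      _ = _ := by rw [mul_pow, Real.sq_sqrt hY0.le]; norm_num
  have h2 : max (z ^ (1 / 2 : ℝ)) (z ^ (1 / 2 + ε)) ^ 2 ≤ z * (4 * Y) ^ ε := by
    rcases max_cases (z ^ (1 / 2 : ℝ)) (z ^ (1 / 2 + ε)) with ⟨h, _⟩ | ⟨h, _⟩
    · rw [h, ← Real.sqrt_eq_rpow, Real.sq_sqrt hz.le]
      exact le_mul_of_one_le_right hz.le (Real.one_le_rpow (by linarith) hε.le)
    · rw [h, ← Real.rpow_natCast, ← Real.rpow_mul hz.le]
      calc z ^ ((1 / 2 + ε) * ((2 : ℕ) : ℝ)) = z * (z ^ 2) ^ ε := by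
            rw [← Real.rpow_natCast z 2, ← Real.rpow_mul hz.le, ← Real.rpow_one_add' hz.le
              (by positivity)]
            congr 1
            push_cast
            ring
        _ ≤ _ := by gcongr
  have h3 : V ^ (1 + ε) * Y ^ ε ≤ X ^ (1 / 2 + ε) * Y ^ (1 / 2 + ε) := by
    calc V ^ (1 + ε) * Y ^ ε = V ^ (1 / 2 + ε) * (V ^ (1 / 2 : ℝ) * Y ^ ε) := by
          rw [← mul_assoc, ← Real.rpow_add hV0]
          congr 2
          ring
      _ ≤ X ^ (1 / 2 + ε) * (Y ^ (1 / 2 : ℝ) * Y ^ ε) := by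
          have := Real.rpow_nonneg (hV0.le.trans hX) (1 / 2 + ε)
          gcongr
      _ = _ := by rw [← Real.rpow_add hY0]
  calc _ ≤ z * (4 * Y) ^ ε := h2
    _ = 4 ^ ε * (z * V ^ (-(1 + ε))) * (V ^ (1 + ε) * Y ^ ε) := by
        rw [Real.mul_rpow (by norm_num) hY0.le, Real.rpow_neg hV0.le]
        field_simp
    _ ≤ _ := by gcongr

/-- The quantity `R` is the squared distance of `ξ` from the line `ℝζ`. It is also that of `ζ - ξ`,
so it is at most both `|ξ|²` and `|ζ - ξ|²`. -/
theorem max_homSymbol_div_sq_le {ε : ℝ} (hε : 0 < ε) {ζ : R3} (hζ : ζ ≠ 0) (ξ : R3) :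
    (max (homSymbol (1 / 2) ζ) (homSymbol (1 / 2 + ε) ζ) /
      (japSymbol (1 / 2 + ε) ξ * japSymbol (1 / 2 + ε) (ζ - ξ))) ^ 2 ≤ 4 ^ ε * (2 * Real.pi) *
        (‖ζ‖ * (1 + (‖ξ‖ ^ 2 - (inner ℝ ξ ζ / ‖ζ‖) ^ 2)) ^ (-(1 + ε))) := by
  have hc : 0 < ‖ζ‖ := norm_pos_iff.2 hζ
  have hpi := Real.pi_pos
  set R := ‖ξ‖ ^ 2 - (inner ℝ ξ ζ / ‖ζ‖) ^ 2 with hR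
  have hR0 : 0 ≤ R := by
    rw [hR, sub_nonneg, sq_le_sq, abs_of_nonneg (norm_nonneg ξ), abs_div, abs_of_pos hc,
      div_le_iff₀ hc]
    exact abs_real_inner_le_norm ξ ζ
  have hξ : R ≤ ‖ξ‖ ^ 2 := by
    rw [hR]
    linarith [sq_nonneg (inner ℝ ξ ζ / ‖ζ‖)]
  have hη : R ≤ ‖ζ - ξ‖ ^ 2 := by
    have : ‖ζ - ξ‖ ^ 2 = R + (‖ζ‖ - inner ℝ ξ ζ / ‖ζ‖) ^ 2 := by
      rw [norm_sub_sq_eq, hR]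
      field_simp
      ring
    rw [this]
    linarith [sq_nonneg (‖ζ‖ - inner ℝ ξ ζ / ‖ζ‖)]
  have hle : ∀ x : R3, R ≤ ‖x‖ ^ 2 → 1 + R ≤ 1 + ‖(2 * Real.pi) • x‖ ^ 2 := by
    intro x hx
    have : ‖x‖ ^ 2 ≤ ‖(2 * Real.pi) • x‖ ^ 2 := by
      gcongr
      exact norm_le_norm_two_pi_smul x
    linarith
  have hsqrt : ∀ x : R3, ‖(2 * Real.pi) • x‖ ≤ √(1 + ‖(2 * Real.pi) • x‖ ^ 2) := fun x =>
    Real.le_sqrt_of_sq_le (by linarith)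
  have hz : ‖(2 * Real.pi) • ζ‖ ≤ ‖(2 * Real.pi) • ξ‖ + ‖(2 * Real.pi) • (ζ - ξ)‖ := by
    refine le_trans (le_of_eq ?_) (norm_add_le _ _)
    rw [← smul_add, add_sub_cancel]
  have h := max_rpow_sq_le hε (z := ‖(2 * Real.pi) • ζ‖) (by rw [norm_two_pi_smul]; positivity)
    (V := 1 + R) (by linarith) (hle _ hξ) (hle _ hη)
    (hz.trans (add_le_add (hsqrt _) (hsqrt _)))
  have hξ1 := one_le_japSymbol (s := 1 / 2 + ε) (by positivity) ξ
  have hη1 := one_le_japSymbol (s := 1 / 2 + ε) (by positivity) (ζ - ξ)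
  rw [div_pow, mul_pow, div_le_iff₀ (by positivity), japSymbol_sq, japSymbol_sq]
  refine h.trans_eq ?_
  rw [norm_two_pi_smul ζ]
  ring

theorem exists_kernelBound_wave {ε : ℝ} (hε : 0 < ε) : ∃ C, KernelBound freqW (fun p => ‖max
    (homSymbol (1 / 2) (p.fst + p.snd)) (homSymbol (1 / 2 + ε) (p.fst + p.snd)) /
      japSymbol2 (1 / 2 + ε) p‖ₑ ^ 2) C := by
  obtain ⟨C, hC⟩ := exists_lintegral_wave_slice_le hε
  have h1 := measurable_homSymbol (1 / 2)
  have h2 := measurable_homSymbol (1 / 2 + ε)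
  have h3 := measurable_japSymbol2 (1 / 2 + ε)
  have hpi := Real.pi_pos
  refine ⟨(4 ^ ε * (2 * Real.pi)).toNNReal * C, KernelBound.of_slice measurable_freqW
    (by fun_prop) fun ζ hζ F hF => ?_⟩
  rw [ENNReal.coe_mul, mul_assoc]
  refine le_trans ?_ (mul_le_mul_right (hC ζ hζ F hF) _)
  rw [← lintegral_const_mul _ (by fun_prop)]
  refine lintegral_mono fun ξ => ?_
  rw [← mul_assoc]
  refine mul_le_mul' ?_ (le_of_eq ?_)
  · change ‖max (homSymbol (1 / 2) (ξ + (ζ - ξ))) (homSymbol (1 / 2 + ε) (ξ + (ζ - ξ))) /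
      (japSymbol (1 / 2 + ε) ξ * japSymbol (1 / 2 + ε) (ζ - ξ))‖ₑ ^ 2 ≤ _
    rw [add_sub_cancel, ← enorm_pow, Real.enorm_eq_ofReal (by positivity)]
    refine (ENNReal.ofReal_le_ofReal (max_homSymbol_div_sq_le hε hζ ξ)).trans_eq ?_
    rw [ENNReal.ofReal_mul (by positivity)]
    rfl
  · change F (-(2 * Real.pi * (‖ξ‖ ^ 2 - ‖ζ - ξ‖ ^ 2))) = _
    rw [norm_sub_sq_eq]
    congr 1
    ring

/-! ### Null sets of frequencies. -/

theorem ae_linearMap_ne_zero {E : Type*} [NormedAddCommGroup E] [InnerProductSpace ℝ E]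
    [FiniteDimensional ℝ E] [MeasurableSpace E] [BorelSpace E] {f : E → R3} (hf : IsLinearMap ℝ f)
    {x : E} (hx : f x ≠ 0) : ∀ᵐ p, f p ≠ 0 := by
  rw [ae_iff]
  simp only [not_not]
  refine Measure.addHaar_submodule volume (LinearMap.ker (hf.mk' f)) fun h => hx ?_
  have : x ∈ LinearMap.ker (hf.mk' f) := h ▸ Submodule.mem_top
  exact this

theorem exists_ne_zero : ∃ x : R3, x ≠ 0 := exists_ne 0

theorem ae_fst_ne_zero : ∀ᵐ p : R6, p.fst ≠ 0 := by
  obtain ⟨x, hx⟩ := exists_ne_zero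
  exact ae_linearMap_ne_zero (f := fun p : R6 => p.fst) ⟨fun _ _ => rfl, fun _ _ => rfl⟩
    (x := WithLp.toLp 2 (x, 0)) hx

theorem ae_snd_ne_zero : ∀ᵐ p : R6, p.snd ≠ 0 := by
  obtain ⟨x, hx⟩ := exists_ne_zero
  exact ae_linearMap_ne_zero (f := fun p : R6 => p.snd) ⟨fun _ _ => rfl, fun _ _ => rfl⟩
    (x := WithLp.toLp 2 (0, x)) hx

theorem ae_sub_ne_zero : ∀ᵐ p : R6, p.fst - p.snd ≠ 0 := by
  obtain ⟨x, hx⟩ := exists_ne_zero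
  refine ae_linearMap_ne_zero (f := fun p : R6 => p.fst - p.snd)
    ⟨fun p p' => ?_, fun c p => (smul_sub c p.fst p.snd).symm⟩ (x := WithLp.toLp 2 (x, 0)) ?_
  · exact add_sub_add_comm p.fst p'.fst p.snd p'.snd
  · exact (sub_zero x).trans_ne hx

theorem ae_add_ne_zero : ∀ᵐ p : R6, p.fst + p.snd ≠ 0 := by
  obtain ⟨x, hx⟩ := exists_ne_zero
  refine ae_linearMap_ne_zero (f := fun p : R6 => p.fst + p.snd)
    ⟨fun p p' => ?_, fun c p => (smul_add c p.fst p.snd).symm⟩ (x := WithLp.toLp 2 (x, 0)) ?_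
  · exact add_add_add_comm p.fst p'.fst p.snd p'.snd
  · exact (add_zero x).trans_ne hx

theorem ae_of_ae_snd {p : R6 → Prop} (h : ∀ᵐ x, p x) : ∀ᵐ P : R7, p P.snd := by
  have h1 : MeasurePreserving (WithLp.ofLp : R7 → ℝ × R6) :=
    WithLp.volume_preserving_ofLp ℝ R6
  have h2 : Measure.QuasiMeasurePreserving (Prod.snd : ℝ × R6 → R6) (volume.prod volume) volume :=
    Measure.quasiMeasurePreserving_snd
  exact (h2.comp h1.quasiMeasurePreserving).ae h

theorem ae_collapse_ne_zero : ∀ᵐ P : R7, (collapseMap P).snd ≠ 0 := ae_of_ae_snd ae_add_ne_zero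

/-! ### Decay relative to a symbol -/

/-- Of the eight powers of decay two serve the time frequency and four the space frequency. The
singularity `1/|ζ|` is integrated by `lintegral_inv_norm_comp_le` with zero vector, applied to a
function of `|ζ|²`. -/
theorem lintegral_decay_lt_top : ∫⁻ y : R4, ENNReal.ofReal
    ((1 / (1 + ‖y‖) ^ 4) ^ 2 * (1 + 1 / ‖y.snd‖)) < ⊤ := by
  let A : ℝ → ℝ≥0∞ := fun t => ENNReal.ofReal ((1 + ‖t‖) ^ (-2 : ℝ))
  let B : R3 → ℝ≥0∞ := fun ζ => ENNReal.ofReal ((1 + ‖ζ‖) ^ (-4 : ℝ))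
  let D : R3 → ℝ≥0∞ := fun ζ => ENNReal.ofReal (1 / ‖ζ‖) * A (‖ζ‖ ^ 2 - inner ℝ ζ 0)
  have hA : ∫⁻ t, A t < ⊤ := finite_integral_one_add_norm (by simp)
  have hB : ∫⁻ ζ, B ζ < ⊤ := finite_integral_one_add_norm (by simp; norm_num)
  have hD : ∫⁻ ζ, D ζ < ⊤ := (lintegral_inv_norm_comp_le 0 (by fun_prop)).trans_lt
    (ENNReal.mul_lt_top ENNReal.ofReal_lt_top hA)
  have h1 : ∀ y : R4, ENNReal.ofReal ((1 / (1 + ‖y‖) ^ 4) ^ 2 * (1 + 1 / ‖y.snd‖)) ≤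
      A y.fst * (B y.snd + D y.snd) := by
    intro y
    have ht : ‖y.fst‖ ≤ ‖y‖ := WithLp.norm_fst_le _ y
    have hz : ‖y.snd‖ ≤ ‖y‖ := WithLp.norm_snd_le _ y
    have e1 : A y.fst = ENNReal.ofReal (1 / (1 + ‖y.fst‖) ^ 2) := by
      simp only [A]
      rw [Real.rpow_neg (by positivity), one_div, ← Real.rpow_natCast]
      norm_num
    have e2 : B y.snd = ENNReal.ofReal (1 / (1 + ‖y.snd‖) ^ 4) := by
      simp only [B]
      rw [Real.rpow_neg (by positivity), one_div, ← Real.rpow_natCast]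
      norm_num
    have e3 : D y.snd = ENNReal.ofReal (1 / ‖y.snd‖ * (1 / (1 + ‖y.snd‖ ^ 2) ^ 2)) := by
      simp only [D, A]
      rw [inner_zero_right, sub_zero, Real.norm_of_nonneg (by positivity),
        Real.rpow_neg (by positivity), ENNReal.ofReal_mul (by positivity),
        one_div ((1 + ‖y.snd‖ ^ 2) ^ 2), ← Real.rpow_natCast (1 + ‖y.snd‖ ^ 2)]
      norm_num
    rw [e1, e2, e3, ← ENNReal.ofReal_add (by positivity) (by positivity),
      ← ENNReal.ofReal_mul (by positivity)]
    refine ENNReal.ofReal_le_ofReal ?_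
    have h2 : (1 / (1 + ‖y‖) ^ 4) ^ 2 ≤ 1 / (1 + ‖y.fst‖) ^ 2 * (1 / (1 + ‖y.snd‖) ^ 4) := by
      rw [div_pow, one_pow, div_mul_div_comm, one_mul]
      gcongr
      calc (1 + ‖y.fst‖) ^ 2 * (1 + ‖y.snd‖) ^ 4 ≤ (1 + ‖y‖) ^ 2 * (1 + ‖y‖) ^ 4 := by gcongr
        _ = (1 + ‖y‖) ^ 6 := by ring
        _ ≤ (1 + ‖y‖) ^ 8 := pow_le_pow_right₀ (by linarith [norm_nonneg y]) (by norm_num)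
        _ = _ := by ring
    have h3 : 1 / (1 + ‖y.snd‖) ^ 4 ≤ 1 / (1 + ‖y.snd‖ ^ 2) ^ 2 := by
      gcongr
      calc (1 + ‖y.snd‖ ^ 2) ^ 2 ≤ ((1 + ‖y.snd‖) ^ 2) ^ 2 := by
            gcongr
            nlinarith [norm_nonneg y.snd]
        _ = _ := by ring
    calc _ ≤ 1 / (1 + ‖y.fst‖) ^ 2 * (1 / (1 + ‖y.snd‖) ^ 4) * (1 + 1 / ‖y.snd‖) := by gcongr
      _ = 1 / (1 + ‖y.fst‖) ^ 2 * (1 / (1 + ‖y.snd‖) ^ 4 +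
          1 / ‖y.snd‖ * (1 / (1 + ‖y.snd‖) ^ 4)) := by ring
      _ ≤ _ := by gcongr
  refine (lintegral_mono h1).trans_lt ?_
  have hm : Measurable fun y : R4 => A y.fst * (B y.snd + D y.snd) := by fun_prop
  rw [lintegral_withLp_prod' hm]
  change ∫⁻ ζ : R3, ∫⁻ t : ℝ, A t * (B ζ + D ζ) < ⊤
  have e : ∀ ζ, ∫⁻ t : ℝ, A t * (B ζ + D ζ) = (∫⁻ t, A t) * (B ζ + D ζ) := fun ζ =>
    lintegral_mul_const _ (by fun_prop)
  rw [lintegral_congr e, lintegral_const_mul _ (by fun_prop), lintegral_add_left (by fun_prop)]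
  exact ENNReal.mul_lt_top hA (ENNReal.add_lt_top.2 ⟨hB, hD⟩)

/-- The right-hand side covers all symbols in use: `1` for those bounded below, `1/|ζ|` for those
that vanish like `|ζ|^{1/2}` at zero frequency. -/
theorem DecayOverSymbol.of_inv_sq_le {m : R4 → ℝ} (hm : Measurable m)
    (h : ∀ y : R4, y.snd ≠ 0 → 1 / m y ^ 2 ≤ 1 + 1 / ‖y.snd‖) : DecayOverSymbol m 4 := by
  refine ⟨Measurable.aestronglyMeasurable (by fun_prop), ?_⟩
  have h0 : ∀ᵐ y : R4, y.snd ≠ 0 := by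
    obtain ⟨x, hx⟩ := exists_ne_zero
    exact ae_linearMap_ne_zero (f := fun p : R4 => p.snd) ⟨fun _ _ => rfl, fun _ _ => rfl⟩
      (x := WithLp.toLp 2 (0, x)) hx
  refine lt_top_iff_ne_top.2 fun htop => ?_
  have htop2 := eLpNorm_two_sq (μ := volume) fun y : R4 => ((1 / (1 + ‖y‖) ^ 4 / m y : ℝ) : ℂ)
  rw [htop, ENNReal.top_pow two_ne_zero] at htop2
  refine (lt_top_iff_ne_top.1 ((lintegral_mono_ae ?_).trans_lt lintegral_decay_lt_top)) htop2.symm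
  filter_upwards [h0] with y hy
  rw [enorm_ofReal_complex, ← enorm_pow, Real.enorm_eq_ofReal (by positivity), div_pow,
    div_eq_mul_one_div _ (m y ^ 2)]
  gcongr
  exact h y hy

/-- The larger one of the symbols `|ζ|^{1/2}` and `|ζ|^{1/2 + ε}`. -/
def maxSymbol (ε : ℝ) (y : R4) : ℝ :=
  max (homSymbol (1 / 2) y.snd) (homSymbol (1 / 2 + ε) y.snd)

theorem measurable_maxSymbol (ε : ℝ) : Measurable (maxSymbol ε) := by
  have := measurable_homSymbol (1 / 2)
  have := measurable_homSymbol (1 / 2 + ε)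
  unfold maxSymbol
  fun_prop

theorem one_div_homSymbol_half_sq_le (ζ : R3) :
    1 / homSymbol (1 / 2) ζ ^ 2 ≤ 1 + 1 / ‖ζ‖ := by
  rcases eq_or_ne ζ 0 with h | h
  · rw [homSymbol_half_sq, h]
    simp
  · have h1 : 0 < ‖ζ‖ := norm_pos_iff.2 h
    have h2 : 1 / (2 * Real.pi * ‖ζ‖) ≤ 1 / ‖ζ‖ := by
      gcongr
      exact le_mul_of_one_le_left h1.le (by linarith [Real.pi_gt_three])
    rw [homSymbol_half_sq]
    linarith

theorem decayOverSymbol_one : DecayOverSymbol (fun _ => 1) 4 :=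
  DecayOverSymbol.of_inv_sq_le measurable_const fun y _ => by
    have : 0 ≤ 1 / ‖y.snd‖ := by positivity
    norm_num

theorem decayOverSymbol_homSymbol : DecayOverSymbol (fun y => homSymbol (1 / 2) y.snd) 4 :=
  DecayOverSymbol.of_inv_sq_le ((measurable_homSymbol _).comp (by fun_prop)) fun y _ =>
    one_div_homSymbol_half_sq_le _

theorem decayOverSymbol_maxSymbol (ε : ℝ) : DecayOverSymbol (maxSymbol ε) 4 :=
  DecayOverSymbol.of_inv_sq_le (measurable_maxSymbol ε) fun y hy => by
    refine le_trans ?_ (one_div_homSymbol_half_sq_le _)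
    have := homSymbol_pos (1 / 2) hy
    gcongr
    exact le_max_left _ _

theorem decayOverSymbol_japSymbol {s : ℝ} (hs : 0 ≤ s) :
    DecayOverSymbol (fun y => japSymbol s y.snd) 4 :=
  DecayOverSymbol.of_inv_sq_le ((measurable_japSymbol _).comp (by fun_prop)) fun y _ => by
    have h1 : 1 ≤ japSymbol s y.snd ^ 2 := one_le_pow₀ (one_le_japSymbol hs _)
    have h2 : 0 ≤ 1 / ‖y.snd‖ := by positivity
    have h3 : 1 / japSymbol s y.snd ^ 2 ≤ 1 := (div_le_one (by positivity)).2 h1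
    linarith

/-! ### The collapsing estimates on the Fourier side -/

theorem exists_collapseEstimate_sub : ∃ C, CollapseEstimate volume
    (fun p : R6 => WithLp.toLp 2 (-freqS p, p)) (fun _ => 1)
    (fun p => homSymbol (1 / 2) (p.fst - p.snd)) C := by
  obtain ⟨C, hC⟩ := exists_kernelBound_inv_norm_sub
  have h1 := measurable_homSymbol (1 / 2)
  refine ⟨_, hC.free measurable_freqS measurable_const (by fun_prop) (by simp)
    (ae_sub_ne_zero.mono fun p hp => (homSymbol_pos _ hp).ne') (ae_sub_ne_zero.mono fun p hp => ?_)⟩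
  have : 0 < ‖p.fst - p.snd‖ := norm_pos_iff.2 hp
  rw [← enorm_pow, Real.enorm_eq_ofReal (by positivity), div_pow, homSymbol_half_sq, one_pow]
  refine ENNReal.ofReal_le_ofReal ?_
  gcongr
  exact le_mul_of_one_le_left this.le (by linarith [Real.pi_gt_three])

theorem exists_collapseEstimate_mul : ∃ C, CollapseEstimate volume
    (fun p : R6 => WithLp.toLp 2 (-freqS p, p)) (fun y => homSymbol (1 / 2) y.snd)
    (fun p => homSymbol (1 / 2) p.fst * homSymbol (1 / 2) p.snd) C := by
  obtain ⟨C, hC⟩ := exists_kernelBound_inv_norm_fst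
  obtain ⟨C', hC'⟩ := exists_kernelBound_inv_norm_snd
  have h1 := measurable_homSymbol (1 / 2)
  refine ⟨_, (hC.add hC' measurable_freqS (by fun_prop)).free measurable_freqS (by fun_prop)
    (by fun_prop) (ae_add_ne_zero.mono fun p hp => (homSymbol_pos _ hp).ne') ?_ ?_⟩
  · filter_upwards [ae_fst_ne_zero, ae_snd_ne_zero] with p hp hp'
    exact (mul_pos (homSymbol_pos _ hp) (homSymbol_pos _ hp')).ne'
  · filter_upwards [ae_fst_ne_zero, ae_snd_ne_zero] with p hp hp'
    rw [← enorm_pow, Real.enorm_eq_ofReal (by positivity),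
      ← ENNReal.ofReal_add (by positivity) (by positivity)]
    exact ENNReal.ofReal_le_ofReal (homSymbol_div_sq_le hp hp')

theorem exists_collapseEstimate_japSymbol {s b : ℝ} (hs : 1 / 2 ≤ s) (hb : 1 / 2 < b) :
    ∃ C, CollapseEstimate volume id (fun y => japSymbol s y.snd)
      (fun P => (1 + |symbolS P|) ^ b * japSymbol2 s P.snd) C := by
  obtain ⟨C, hC⟩ := exists_kernelBound_inv_norm_fst
  obtain ⟨C', hC'⟩ := exists_kernelBound_inv_norm_snd
  obtain ⟨D, hD⟩ := KernelBound.spaceTime hb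
  have h1 := measurable_japSymbol s
  have hs0 : 0 ≤ s := by linarith
  refine ⟨_, hD ((hC.add hC' measurable_freqS (by fun_prop)).const_mul (4 ^ s : ℝ).toNNReal)
    measurable_freqS (by fun_prop) (by fun_prop) (measurable_japSymbol2 s)
    (Eventually.of_forall fun P => (zero_lt_one.trans_le (one_le_japSymbol hs0 _)).ne')
    (fun p => zero_lt_one.trans_le (one_le_japSymbol2 hs0 p)) (fun P => by rw [symbolS_eq]) ?_⟩
  filter_upwards [ae_of_ae_snd ae_fst_ne_zero, ae_of_ae_snd ae_snd_ne_zero] with P hp hp'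
  rw [← enorm_pow, Real.enorm_eq_ofReal (by positivity),
    ← ENNReal.ofReal_add (by positivity) (by positivity)]
  refine (ENNReal.ofReal_le_ofReal (japSymbol_div_sq_le hs hp hp')).trans_eq ?_
  rw [ENNReal.ofReal_mul (by positivity)]
  rfl

theorem maxSymbol_ne_zero (ε : ℝ) {y : R4} (hy : y.snd ≠ 0) : maxSymbol ε y ≠ 0 :=
  ((homSymbol_pos (1 / 2) hy).trans_le (le_max_left _ _)).ne'

theorem exists_collapseEstimate_wave_free {ε : ℝ} (hε : 0 < ε) : ∃ C, CollapseEstimate volume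
    (fun p : R6 => WithLp.toLp 2 (-freqW p, p)) (maxSymbol ε) (japSymbol2 (1 / 2 + ε)) C := by
  obtain ⟨C, hC⟩ := exists_kernelBound_wave hε
  exact ⟨_, hC.free measurable_freqW (measurable_maxSymbol ε) (measurable_japSymbol2 _)
    (ae_add_ne_zero.mono fun p hp => maxSymbol_ne_zero ε hp)
    (Eventually.of_forall fun p => (zero_lt_one.trans_le (one_le_japSymbol2 (by positivity) p)).ne')
    (Eventually.of_forall fun p => le_rfl)⟩

theorem exists_collapseEstimate_wave {ε b : ℝ} (hε : 0 < ε) (hb : 1 / 2 < b) :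
    ∃ C, CollapseEstimate volume id (maxSymbol ε)
      (fun P => (1 + |symbolW P|) ^ b * japSymbol2 (1 / 2 + ε) P.snd) C := by
  obtain ⟨C, hC⟩ := exists_kernelBound_wave hε
  obtain ⟨D, hD⟩ := KernelBound.spaceTime hb
  have h1 := measurable_homSymbol (1 / 2)
  have h2 := measurable_homSymbol (1 / 2 + ε)
  have h3 := measurable_japSymbol2 (1 / 2 + ε)
  exact ⟨_, hD hC measurable_freqW (by fun_prop) (measurable_maxSymbol ε) h3
    (ae_collapse_ne_zero.mono fun P hP => maxSymbol_ne_zero ε hP)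
    (fun p => zero_lt_one.trans_le (one_le_japSymbol2 (by positivity) p))
    (fun P => by rw [symbolW_eq]) (Eventually.of_forall fun p => le_rfl)⟩

/-! ### Collapsing estimates for free solutions and in `X^b` spaces. -/

theorem hasTemperateGrowth_norm_fst_sq : (fun p : R6 => ‖p.fst‖ ^ 2).HasTemperateGrowth :=
  (Function.hasTemperateGrowth_norm_sq (H := R3)).comp (WithLp.fstL 2 ℝ R3 R3).hasTemperateGrowth

theorem hasTemperateGrowth_norm_snd_sq : (fun p : R6 => ‖p.snd‖ ^ 2).HasTemperateGrowth :=
  (Function.hasTemperateGrowth_norm_sq (H := R3)).comp (WithLp.sndL 2 ℝ R3 R3).hasTemperateGrowth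

theorem hasTemperateGrowth_freqS : freqS.HasTemperateGrowth :=
  (Function.HasTemperateGrowth.const (2 * Real.pi)).mul
    (hasTemperateGrowth_norm_fst_sq.add hasTemperateGrowth_norm_snd_sq)

theorem hasTemperateGrowth_freqW : freqW.HasTemperateGrowth :=
  (Function.HasTemperateGrowth.const (2 * Real.pi)).mul
    (hasTemperateGrowth_norm_fst_sq.sub hasTemperateGrowth_norm_snd_sq)

section Solutions

variable {q : R6 → ℝ} {m : R4 → ℝ} {C : ℝ≥0}

/-- Without a source, `fourier_representation` says that the transform of the solution is the
measure `g dp` carried by `τ = -q(p)`. The Fourier function of `G z` is recorded as well, since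
passing to `l2Norm` needs it. -/
theorem exists_isCollapse_free (hq : q.HasTemperateGrowth) {Λ : 𝓢'(R7, ℂ)} {Λ₀ : 𝓢'(R6, ℂ)}
    (hΛ : ∀ Θ Φ : 𝓢(R7, ℂ), (∀ P, Φ P = (2 * Real.pi * (P.fst + q P.snd) : ℝ) * Θ P) →
      (𝓕 Λ) Φ = 0) (h0 : HasInitialValue Λ Λ₀) {w : R6 → ℝ}
    (h : CollapseEstimate volume (fun p => WithLp.toLp 2 (-q p, p)) m w C)
    (hm : DecayOverSymbol m 4) (hw : fourierNorm w Λ₀ ≠ ⊤) :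
    ∃ G : R3 → 𝓢'(R4, ℂ), IsCollapse Λ G ∧ ∀ z, fourierNorm m (G z) ≤ C * fourierNorm w Λ₀ ∧
      ∃ H, HasFourierFunction (G z) H := by
  obtain ⟨g, hg, hgf, hgn⟩ := exists_hasFourierFunction hw
  have hwg : MemLp (fun p => (w p : ℂ) * g p) 2 volume :=
    ⟨((Complex.measurable_ofReal.comp h.measurable_weight).mul hg.measurable).aestronglyMeasurable,
      by rw [hgn]; exact hw.lt_top⟩
  obtain ⟨G, hG, hGn⟩ := h.exists_isCollapse hm hwg hg.measurable (u := Λ) fun Φ => by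
    have := fourier_representation (f := 0) (N := 0) hq hgf h0 aestronglyMeasurable_zero (by simp)
      (fun Θ Φ hΦ => by simpa using hΛ Θ Φ hΦ) Φ
    simpa using this
  refine ⟨G, hG, fun z => ?_⟩
  obtain ⟨H, hH, hHn⟩ := hGn z
  rw [fourierNorm_eq hH, ← hgn]
  exact ⟨hHn, H, hH⟩

theorem exists_isCollapse_spaceTime {u : 𝓢'(R7, ℂ)} {w : R7 → ℝ}
    (h : CollapseEstimate volume id m w C) (hm : DecayOverSymbol m 4) (hw : fourierNorm w u ≠ ⊤) :
    ∃ G : R3 → 𝓢'(R4, ℂ), IsCollapse u G ∧ ∀ z, fourierNorm m (G z) ≤ C * fourierNorm w u := by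
  obtain ⟨g, hg, hgf, hgn⟩ := exists_hasFourierFunction hw
  have hwg : MemLp (fun p => (w p : ℂ) * g p) 2 volume :=
    ⟨((Complex.measurable_ofReal.comp h.measurable_weight).mul hg.measurable).aestronglyMeasurable,
      by rw [hgn]; exact hw.lt_top⟩
  obtain ⟨G, hG, hGn⟩ := h.exists_isCollapse hm hwg hg.measurable (u := u) fun Φ => (hgf.2 Φ).2
  refine ⟨G, hG, fun z => ?_⟩
  obtain ⟨H, hH, hHn⟩ := hGn z
  rwa [fourierNorm_eq hH, ← hgn]

end Solutions

theorem fourier_apply_eq_zero_of_opS {Λ : 𝓢'(R7, ℂ)} (h : opS Λ = 0) {Θ Φ : 𝓢(R7, ℂ)}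
    (hΦ : ∀ P, Φ P = (2 * Real.pi * (P.fst + freqS P.snd) : ℝ) * Θ P) : (𝓕 Λ) Φ = 0 := by
  rw [fourier_apply_of_opS h (Θ := Θ) fun P => by rw [symbolS_eq, hΦ P],
    TemperedDistribution.fourier_apply]
  rfl

theorem fourier_apply_eq_zero_of_opW {Λ : 𝓢'(R7, ℂ)} (h : opW Λ = 0) {Θ Φ : 𝓢(R7, ℂ)}
    (hΦ : ∀ P, Φ P = (2 * Real.pi * (P.fst + freqW P.snd) : ℝ) * Θ P) : (𝓕 Λ) Φ = 0 := by
  rw [fourier_apply_of_opW h (Θ := Θ) fun P => by rw [symbolW_eq, hΦ P],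
    TemperedDistribution.fourier_apply]
  rfl

theorem collapsing_free_S : ∃ C : ℝ≥0, ∀ (Λ : 𝓢'(R7, ℂ)) (Λ₀ : 𝓢'(R6, ℂ)),
    opS Λ = 0 → HasInitialValue Λ Λ₀ →
      (fourierNorm (fun p => homSymbol (1 / 2) (p.fst - p.snd)) Λ₀ ≠ ⊤ →
        ∃ G : R3 → 𝓢'(R4, ℂ), IsCollapse Λ G ∧
          l2Norm (G 0) ≤ C * fourierNorm (fun p => homSymbol (1 / 2) (p.fst - p.snd)) Λ₀) ∧
      (fourierNorm (fun p => homSymbol (1 / 2) p.fst * homSymbol (1 / 2) p.snd) Λ₀ ≠ ⊤ →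
        ∃ G : R3 → 𝓢'(R4, ℂ), IsCollapse Λ G ∧
          fourierNorm (fun q => homSymbol (1 / 2) q.snd) (G 0) ≤
            C * fourierNorm (fun p => homSymbol (1 / 2) p.fst * homSymbol (1 / 2) p.snd) Λ₀) := by
  obtain ⟨C, hC⟩ := exists_collapseEstimate_sub
  obtain ⟨C', hC'⟩ := exists_collapseEstimate_mul
  refine ⟨max C C', fun Λ Λ₀ hΛ h0 => ⟨fun hw => ?_, fun hw => ?_⟩⟩
  · obtain ⟨G, hG, hGn⟩ := exists_isCollapse_free hasTemperateGrowth_freqS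
      (fun Θ Φ => fourier_apply_eq_zero_of_opS hΛ) h0 hC decayOverSymbol_one hw
    obtain ⟨h1, H, hH⟩ := hGn 0
    rw [fourierNorm_eq hH] at h1
    refine ⟨G, hG, (l2Norm_le_of_hasFourierFunction hH).trans ?_⟩
    simp only [Complex.ofReal_one, one_mul] at h1
    refine h1.trans ?_
    gcongr
    exact le_max_left _ _
  · obtain ⟨G, hG, hGn⟩ := exists_isCollapse_free hasTemperateGrowth_freqS
      (fun Θ Φ => fourier_apply_eq_zero_of_opS hΛ) h0 hC' decayOverSymbol_homSymbol hw
    refine ⟨G, hG, (hGn 0).1.trans ?_⟩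
    gcongr
    exact le_max_right _ _

theorem fourierNorm_homSymbol_le_maxSymbol (ε : ℝ) (u : 𝓢'(R4, ℂ)) :
    fourierNorm (fun y => homSymbol (1 / 2) y.snd) u ≤ fourierNorm (maxSymbol ε) u :=
  fourierNorm_mono (fun y => by
    rw [abs_of_nonneg (homSymbol_nonneg _ _)]
    exact (le_max_left _ _).trans (le_abs_self _)) u

theorem fourierNorm_homSymbol_add_le_maxSymbol (ε : ℝ) (u : 𝓢'(R4, ℂ)) :
    fourierNorm (fun y => homSymbol (1 / 2 + ε) y.snd) u ≤ fourierNorm (maxSymbol ε) u :=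
  fourierNorm_mono (fun y => by
    rw [abs_of_nonneg (homSymbol_nonneg _ _)]
    exact (le_max_right _ _).trans (le_abs_self _)) u

theorem collapsing_free_W {ε : ℝ} (hε : 0 < ε) : ∃ C : ℝ≥0,
    ∀ (Γ : 𝓢'(R7, ℂ)) (Γ₀ : 𝓢'(R6, ℂ)), opW Γ = 0 → HasInitialValue Γ Γ₀ →
      fourierNorm (japSymbol2 (1 / 2 + ε)) Γ₀ ≠ ⊤ →
        ∃ G : R3 → 𝓢'(R4, ℂ), IsCollapse Γ G ∧
          fourierNorm (fun q => homSymbol (1 / 2 + ε) q.snd) (G 0) +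
              fourierNorm (fun q => homSymbol (1 / 2) q.snd) (G 0) ≤
            C * fourierNorm (japSymbol2 (1 / 2 + ε)) Γ₀ := by
  obtain ⟨C, hC⟩ := exists_collapseEstimate_wave_free hε
  -- Each of the two norms is at most the norm with the larger symbol, so one family `G` serves
  -- both.
  refine ⟨C + C, fun Γ Γ₀ hΓ h0 hw => ?_⟩
  obtain ⟨G, hG, hGn⟩ := exists_isCollapse_free hasTemperateGrowth_freqW
    (fun Θ Φ => fourier_apply_eq_zero_of_opW hΓ) h0 hC (decayOverSymbol_maxSymbol ε) hw
  refine ⟨G, hG, ?_⟩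
  rw [ENNReal.coe_add, add_mul]
  exact add_le_add ((fourierNorm_homSymbol_add_le_maxSymbol ε _).trans (hGn 0).1)
    ((fourierNorm_homSymbol_le_maxSymbol ε _).trans (hGn 0).1)

theorem collapsing_normXS {ε δ : ℝ} (hε : 0 < ε) (hδ : 0 < δ) : ∃ C : ℝ≥0, ∀ u : 𝓢'(R7, ℂ),
    normXS (1 / 2 + ε) (1 / 2 + δ) u ≠ ⊤ → ∃ G : R3 → 𝓢'(R4, ℂ), IsCollapse u G ∧
      (⨆ z, fourierNorm (fun q => japSymbol (1 / 2 + ε) q.snd) (G z)) ≤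
        C * normXS (1 / 2 + ε) (1 / 2 + δ) u := by
  obtain ⟨C, hC⟩ := exists_collapseEstimate_japSymbol (s := 1 / 2 + ε) (b := 1 / 2 + δ)
    (by linarith) (by linarith)
  refine ⟨C, fun u hu => ?_⟩
  obtain ⟨G, hG, hGn⟩ := exists_isCollapse_spaceTime hC
    (decayOverSymbol_japSymbol (by positivity)) hu
  exact ⟨G, hG, iSup_le hGn⟩

theorem collapsing_normXW {ε δ : ℝ} (hε : 0 < ε) (hδ : 0 < δ) : ∃ C : ℝ≥0, ∀ u : 𝓢'(R7, ℂ),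
    normXW (1 / 2 + ε) (1 / 2 + δ) u ≠ ⊤ → ∃ G : R3 → 𝓢'(R4, ℂ), IsCollapse u G ∧
      (⨆ z, fourierNorm (fun q => homSymbol (1 / 2 + ε) q.snd) (G z)) +
          (⨆ z, fourierNorm (fun q => homSymbol (1 / 2) q.snd) (G z)) ≤
        C * normXW (1 / 2 + ε) (1 / 2 + δ) u := by
  obtain ⟨C, hC⟩ := exists_collapseEstimate_wave hε (b := 1 / 2 + δ) (by linarith)
  refine ⟨C + C, fun u hu => ?_⟩
  obtain ⟨G, hG, hGn⟩ := exists_isCollapse_spaceTime hC (decayOverSymbol_maxSymbol ε) hu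
  refine ⟨G, hG, ?_⟩
  rw [ENNReal.coe_add, add_mul]
  exact add_le_add
    (iSup_le fun z => (fourierNorm_homSymbol_add_le_maxSymbol ε _).trans (hGn z))
    (iSup_le fun z => (fourierNorm_homSymbol_le_maxSymbol ε _).trans (hGn z))

/-! ### The Duhamel kernel of a cut-off function. -/

theorem lintegral_mul_sq_le {α : Type*} [MeasurableSpace α] {μ : Measure α} {f g : α → ℝ≥0∞}
    (hf : Measurable f) (hg : Measurable g) :
    (∫⁻ x, f x * g x ∂μ) ^ 2 ≤ (∫⁻ x, f x ^ 2 ∂μ) * ∫⁻ x, g x ^ 2 ∂μ := by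
  have h := ENNReal.lintegral_mul_le_Lp_mul_Lq μ (p := 2) (q := 2) ⟨by norm_num, by norm_num,
    by norm_num⟩ hf.aemeasurable hg.aemeasurable
  have hsq : ∀ x : ℝ≥0∞, (x ^ (1 / 2 : ℝ)) ^ 2 = x := fun x => by
    rw [← ENNReal.rpow_natCast, ← ENNReal.rpow_mul]
    norm_num
  have h2 := pow_le_pow_left' h 2
  rw [mul_pow, hsq, hsq] at h2
  simpa using h2

theorem ennreal_add_sq_le (a b : ℝ≥0∞) : (a + b) ^ 2 ≤ 2 * (a ^ 2 + b ^ 2) := by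
  have := ENNReal.rpow_add_le_mul_rpow_add_rpow a b (p := 2) (by norm_num)
  norm_num at this
  simpa using this

/-- The weight `1 + |τ|`, up to the normalization of frequencies. -/
def weight (s : ℝ) : ℝ := 1 + |2 * Real.pi * s|

theorem one_le_weight (s : ℝ) : 1 ≤ weight s := le_add_of_nonneg_right (abs_nonneg _)

theorem weight_pos (s : ℝ) : 0 < weight s := zero_lt_one.trans_le (one_le_weight s)

theorem weight_neg (s : ℝ) : weight (-s) = weight s := by
  rw [weight, mul_neg, abs_neg, weight]

theorem measurable_weight : Measurable weight := by
  unfold weight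
  fun_prop

theorem one_add_abs_le_weight (s : ℝ) : 1 + |s| ≤ weight s := by
  rw [weight, abs_mul, abs_of_pos Real.two_pi_pos]
  nlinarith [abs_nonneg s, Real.pi_gt_three]

theorem weight_le (s : ℝ) : weight s ≤ 7 * (1 + |s|) := by
  rw [weight, abs_mul, abs_of_pos Real.two_pi_pos]
  nlinarith [abs_nonneg s, Real.pi_lt_d2]

theorem weight_add_le (s t : ℝ) : weight (s + t) ≤ weight s * weight t := by
  simp only [weight, mul_add]
  have := abs_add_le (2 * Real.pi * s) (2 * Real.pi * t)
  nlinarith [abs_nonneg (2 * Real.pi * s), abs_nonneg (2 * Real.pi * t),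
    mul_nonneg (abs_nonneg (2 * Real.pi * s)) (abs_nonneg (2 * Real.pi * t))]

theorem lintegral_weight_rpow_lt_top {r : ℝ} (hr : 1 < r) :
    ∫⁻ s, ENNReal.ofReal (weight s ^ (-r)) < ⊤ := by
  refine lt_of_le_of_lt (lintegral_mono fun s => ?_)
    (finite_integral_one_add_norm (E := ℝ) (μ := volume) (r := r) (by simpa using hr))
  exact ENNReal.ofReal_le_ofReal (Real.rpow_le_rpow_of_nonpos (by positivity)
    (one_add_abs_le_weight s) (by linarith))

theorem exists_norm_le_weight_rpow (a : 𝓢(ℝ, ℂ)) (r : ℝ) :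
    ∃ D, 0 ≤ D ∧ ∀ s, ‖a s‖ ≤ D * weight s ^ (-r) := by
  obtain ⟨N, hN⟩ := exists_nat_ge r
  obtain ⟨D, hD0, hD⟩ := exists_norm_le_div_one_add_norm_pow a N
  refine ⟨D * 7 ^ N, by positivity, fun s => (hD s).trans ?_⟩
  have h1 : weight s ^ r ≤ (7 * (1 + ‖s‖)) ^ N := by
    calc weight s ^ r ≤ weight s ^ (N : ℝ) := Real.rpow_le_rpow_of_exponent_le (one_le_weight s) hN
      _ = weight s ^ N := Real.rpow_natCast _ _
      _ ≤ _ := pow_le_pow_left₀ (weight_pos s).le (weight_le s) N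
  rw [Real.rpow_neg (weight_pos s).le, ← div_eq_mul_inv,
    div_le_div_iff₀ (by positivity) (Real.rpow_pos_of_pos (weight_pos s) r)]
  calc D * weight s ^ r ≤ D * (7 * (1 + ‖s‖)) ^ N := by gcongr
    _ = _ := by rw [mul_pow, mul_assoc]

/-- The kernel that the cut-off function with the inverse Fourier transform `X` produces in
Duhamel's formula. -/
def cutoffKernel (X : 𝓢(ℝ, ℂ)) (s s' : ℝ) : ℂ := (X (s - s') - X (-s')) / (2 * Real.pi * s : ℝ)

theorem measurable_cutoffKernel (X : 𝓢(ℝ, ℂ)) :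
    Measurable fun y : ℝ × ℝ => cutoffKernel X y.1 y.2 := by
  have := X.continuous.measurable
  unfold cutoffKernel
  fun_prop

theorem exists_norm_cutoffKernel_le (X : 𝓢(ℝ, ℂ)) (r : ℝ) (hr : 0 ≤ r) : ∃ D, 0 ≤ D ∧ ∀ s s',
    ‖cutoffKernel X s s'‖ ≤ D * (weight s ^ (-1 : ℝ) * (weight (s - s') ^ (-r) +
      weight s' ^ (-r))) := by
  obtain ⟨D, hD0, hD⟩ := exists_norm_le_weight_rpow X r
  obtain ⟨D', hD0', hD'⟩ := exists_norm_le_weight_rpow (SchwartzMap.derivCLM ℂ ℂ X) r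
  refine ⟨7 * D + 14 * (D' * 14 ^ r), by positivity, fun s s' => ?_⟩
  have hw := weight_pos s
  have hp1 : 0 < weight (s - s') ^ (-r) := Real.rpow_pos_of_pos (weight_pos _) _
  have hp2 : 0 < weight s' ^ (-r) := Real.rpow_pos_of_pos (weight_pos _) _
  rw [cutoffKernel, norm_div, Complex.norm_real, Real.norm_eq_abs, Real.rpow_neg_one]
  rcases eq_or_ne s 0 with h0 | h0
  · rw [h0, mul_zero, abs_zero, div_zero]
    have := weight_pos 0
    rw [h0] at hp1
    positivity
  have hs0 : 0 < |s| := abs_pos.2 h0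
  have hpos : 0 < |2 * Real.pi * s| := abs_pos.2 (mul_ne_zero Real.two_pi_pos.ne' h0)
  have hge : 6 * |s| ≤ |2 * Real.pi * s| := by
    rw [abs_mul, abs_of_pos Real.two_pi_pos]
    nlinarith [Real.pi_gt_three]
  rcases le_total 1 |s| with h1 | h1
  · have h2 : ‖X (s - s') - X (-s')‖ ≤ D * (weight (s - s') ^ (-r) + weight s' ^ (-r)) := by
      refine (norm_sub_le _ _).trans ?_
      rw [mul_add]
      refine add_le_add (hD _) ?_
      have := hD (-s')
      rwa [weight_neg] at this
    have h3 : weight s ≤ 7 * |2 * Real.pi * s| := by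
      rw [weight]
      linarith
    rw [div_le_iff₀ hpos]
    calc ‖X (s - s') - X (-s')‖ ≤ D * (weight (s - s') ^ (-r) + weight s' ^ (-r)) := h2
      _ ≤ D * (weight (s - s') ^ (-r) + weight s' ^ (-r)) *
          ((weight s)⁻¹ * (7 * |2 * Real.pi * s|)) := by
        refine le_mul_of_one_le_right (by positivity) ?_
        rw [inv_mul_eq_div, one_le_div hw]
        exact h3
      _ = 7 * D * ((weight s)⁻¹ * (weight (s - s') ^ (-r) + weight s' ^ (-r))) *
          |2 * Real.pi * s| := by ring
      _ ≤ _ := by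
        gcongr
        exact le_add_of_nonneg_right (by positivity)
  -- The bound `2π ≤ 7` gives `weight s ≤ 7 (1 + |s|) ≤ 14`.
  · have hw14 : weight s ≤ 14 := (weight_le s).trans (by linarith)
    have h2 : ∀ y ∈ segment ℝ (-s') (s - s'), ‖deriv X y‖ ≤ D' * 14 ^ r * weight s' ^ (-r) := by
      intro y hy
      obtain ⟨θ, hθ, rfl⟩ := (segment_eq_image' ℝ (-s') (s - s')).le hy
      simp only [smul_eq_mul]
      set y := -s' + θ * (s - s' - -s') with hy'
      have h3 : weight s' ≤ weight y * 14 := by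
        have e : s' = -y + θ * s := by rw [hy']; ring
        have h5 : weight (θ * s) ≤ 14 := by
          refine le_trans ?_ hw14
          simp only [weight, mul_left_comm _ θ, abs_mul θ, abs_of_nonneg hθ.1]
          gcongr
          exact mul_le_of_le_one_left (abs_nonneg _) hθ.2
        calc weight s' = weight (-y + θ * s) := by rw [← e]
          _ ≤ weight (-y) * weight (θ * s) := weight_add_le _ _
          _ ≤ weight y * 14 := by
            rw [weight_neg]
            gcongr
            exact (weight_pos y).le
      have h6 := hD' y
      rw [SchwartzMap.derivCLM_apply] at h6
      refine h6.trans ?_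
      rw [mul_assoc]
      gcongr
      rw [Real.rpow_neg (weight_pos _).le, Real.rpow_neg (weight_pos _).le, ← div_eq_mul_inv,
        le_div_iff₀ (Real.rpow_pos_of_pos (weight_pos _) _), inv_mul_le_iff₀
        (Real.rpow_pos_of_pos (weight_pos _) _), ← Real.mul_rpow (weight_pos _).le (by norm_num)]
      exact Real.rpow_le_rpow (weight_pos _).le h3 hr
    have h4 := (convex_segment (𝕜 := ℝ) (-s') (s - s')).norm_image_sub_le_of_norm_deriv_le
      (fun y _ => X.differentiable y) h2 (left_mem_segment ℝ _ _) (right_mem_segment ℝ _ _)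
    have e : s - s' - -s' = s := by ring
    rw [e, Real.norm_eq_abs] at h4
    rw [div_le_iff₀ hpos]
    calc ‖X (s - s') - X (-s')‖ ≤ D' * 14 ^ r * weight s' ^ (-r) * |s| := h4
      _ ≤ D' * 14 ^ r * weight s' ^ (-r) * (14 * (weight s)⁻¹ * |2 * Real.pi * s|) := by
        gcongr
        have h7 : 1 ≤ 14 * (weight s)⁻¹ := by
          rw [← div_eq_mul_inv, one_le_div hw]
          exact hw14
        calc |s| ≤ 1 * |2 * Real.pi * s| := by linarith
          _ ≤ _ := by gcongr
      _ = 14 * (D' * 14 ^ r) * ((weight s)⁻¹ * weight s' ^ (-r)) * |2 * Real.pi * s| := by ring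
      _ ≤ _ := by
        gcongr
        · exact le_add_of_nonneg_left (by positivity)
        · exact le_add_of_nonneg_left hp1.le

/-- The rate `b + 2` leaves decay of order two after absorbing `weight s' ^ b`: directly in the
second term, through `weight s' ≤ weight s * weight (s - s')` in the first. The factor `weight s ^
(b - 1)` is split off because it belongs to the norm of the source. -/
theorem exists_weight_mul_norm_cutoffKernel_le (X : 𝓢(ℝ, ℂ)) {b : ℝ} (hb : 0 ≤ b) :
    ∃ D, 0 ≤ D ∧ ∀ s s', weight s' ^ b * ‖cutoffKernel X s s'‖ ≤
      D * (weight (s - s') ^ (-2 : ℝ) * weight s ^ (b - 1) +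
        weight s' ^ (-2 : ℝ) * (weight s ^ (-b) * weight s ^ (b - 1))) := by
  obtain ⟨D, hD0, hD⟩ := exists_norm_cutoffKernel_le X (b + 2) (by positivity)
  refine ⟨D, hD0, fun s s' => ?_⟩
  have hs := weight_pos s
  have hs' := weight_pos s'
  have hd := weight_pos (s - s')
  have h1 : weight s' ≤ weight s * weight (s - s') := by
    have := weight_add_le s (s' - s)
    rwa [add_sub_cancel, ← weight_neg (s' - s), neg_sub] at this
  have h2 : weight s' ^ b * (weight s ^ (-1 : ℝ) * weight (s - s') ^ (-(b + 2))) ≤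
      weight (s - s') ^ (-2 : ℝ) * weight s ^ (b - 1) := by
    calc _ ≤ (weight s * weight (s - s')) ^ b *
          (weight s ^ (-1 : ℝ) * weight (s - s') ^ (-(b + 2))) := by gcongr
      _ = (weight (s - s') ^ b * weight (s - s') ^ (-(b + 2))) *
          (weight s ^ b * weight s ^ (-1 : ℝ)) := by
        rw [Real.mul_rpow hs.le hd.le]
        ring
      _ = _ := by
        rw [← Real.rpow_add hd, ← Real.rpow_add hs, ← sub_eq_add_neg]
        congr 2
        ring
  have h3 : weight s' ^ b * (weight s ^ (-1 : ℝ) * weight s' ^ (-(b + 2))) =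
      weight s' ^ (-2 : ℝ) * (weight s ^ (-b) * weight s ^ (b - 1)) := by
    calc _ = (weight s' ^ b * weight s' ^ (-(b + 2))) * weight s ^ (-1 : ℝ) := by ring
      _ = _ := by
        rw [← Real.rpow_add hs', ← Real.rpow_add hs]
        congr 2 <;> ring
  calc _ ≤ weight s' ^ b * (D * (weight s ^ (-1 : ℝ) * (weight (s - s') ^ (-(b + 2)) +
        weight s' ^ (-(b + 2))))) := by
        gcongr
        exact hD s s'
    _ = D * (weight s' ^ b * (weight s ^ (-1 : ℝ) * weight (s - s') ^ (-(b + 2))) +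
        weight s' ^ b * (weight s ^ (-1 : ℝ) * weight s' ^ (-(b + 2)))) := by ring
    _ ≤ _ := by
        rw [h3]
        gcongr

/-- The first part of the kernel is a convolution with the integrable function `weight ^ (-2)`,
bounded on `L²`. The second has rank one, and Cauchy-Schwarz applies because `weight ^ (-b)` is
square integrable for `b > 1/2`. -/
theorem exists_lintegral_cutoffKernel_le (X : 𝓢(ℝ, ℂ)) {b : ℝ} (hb : 1 / 2 < b) :
    ∃ D : ℝ≥0, ∀ φ : ℝ → ℝ≥0∞, Measurable φ →
      ∫⁻ s', (ENNReal.ofReal (weight s' ^ b) * ∫⁻ s, ‖cutoffKernel X s s'‖ₑ * φ s) ^ 2 ≤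
        D * ∫⁻ s, (ENNReal.ofReal (weight s ^ (b - 1)) * φ s) ^ 2 := by
  obtain ⟨D, hD0, hD⟩ := exists_weight_mul_norm_cutoffKernel_le X (b := b) (by linarith)
  have hw := measurable_weight
  have hk := measurable_cutoffKernel X
  let e : ℝ → ℝ≥0∞ := fun s => ENNReal.ofReal (weight s ^ (-1 : ℝ))
  let a : ℝ → ℝ≥0∞ := fun s => ENNReal.ofReal (weight s ^ (-2 : ℝ))
  let c : ℝ → ℝ≥0∞ := fun s => ENNReal.ofReal (weight s ^ (-b))
  have ha : Measurable a := by fun_prop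
  have he : Measurable e := by fun_prop
  have hc : Measurable c := by fun_prop
  have hsq : ∀ r s : ℝ, ENNReal.ofReal (weight s ^ (-r)) ^ 2 =
      ENNReal.ofReal (weight s ^ (-(2 * r))) := by
    intro r s
    rw [← ENNReal.ofReal_pow (Real.rpow_nonneg (weight_pos s).le _), ← Real.rpow_natCast,
      ← Real.rpow_mul (weight_pos s).le]
    congr 2
    push_cast
    ring
  have hea : ∀ s, e s ^ 2 = a s := fun s => by
    simp only [e, a]
    rw [hsq]
    norm_num
  have hA : ∫⁻ s, a s ≠ ⊤ := (lintegral_weight_rpow_lt_top (r := 2) (by norm_num)).ne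
  have hA2 : ∫⁻ s, a s ^ 2 ≠ ⊤ := by
    simp only [a, hsq]
    exact (lintegral_weight_rpow_lt_top (by norm_num)).ne
  have hC : ∫⁻ s, c s ^ 2 ≠ ⊤ := by
    simp only [c, hsq]
    exact (lintegral_weight_rpow_lt_top (by linarith)).ne
  refine ⟨D.toNNReal ^ 2 * (2 * ((∫⁻ s, a s).toNNReal ^ 2 +
    (∫⁻ s, a s ^ 2).toNNReal * (∫⁻ s, c s ^ 2).toNNReal)), fun φ hφ => ?_⟩
  push_cast
  rw [ENNReal.coe_toNNReal hA, ENNReal.coe_toNNReal hA2, ENNReal.coe_toNNReal hC]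
  set ψ : ℝ → ℝ≥0∞ := fun s => ENNReal.ofReal (weight s ^ (b - 1)) * φ s with hψ'
  have hψ : Measurable ψ := by fun_prop
  have h1 : ∀ s', ENNReal.ofReal (weight s' ^ b) * ∫⁻ s, ‖cutoffKernel X s s'‖ₑ * φ s ≤
      ENNReal.ofReal D * ((∫⁻ s, a (s - s') * ψ s) + a s' * ∫⁻ s, c s * ψ s) := by
    intro s'
    rw [← lintegral_const_mul _ (by fun_prop), ← lintegral_const_mul _ (by fun_prop),
      ← lintegral_add_left (by fun_prop), ← lintegral_const_mul _ (by fun_prop)]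
    refine lintegral_mono fun s => ?_
    have e1 : ENNReal.ofReal D * (a (s - s') * ψ s + a s' * (c s * ψ s)) =
        ENNReal.ofReal (D * (weight (s - s') ^ (-2 : ℝ) * weight s ^ (b - 1) +
          weight s' ^ (-2 : ℝ) * (weight s ^ (-b) * weight s ^ (b - 1)))) * φ s := by
      have h : ∀ t r : ℝ, 0 ≤ weight t ^ r := fun t r => Real.rpow_nonneg (weight_pos t).le r
      rw [ENNReal.ofReal_mul hD0, ENNReal.ofReal_add (mul_nonneg (h _ _) (h _ _))
        (mul_nonneg (h _ _) (mul_nonneg (h _ _) (h _ _))), ENNReal.ofReal_mul (h _ _),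
        ENNReal.ofReal_mul (h _ _), ENNReal.ofReal_mul (h _ _)]
      ring
    rw [e1, ← mul_assoc, ← ofReal_norm,
      ← ENNReal.ofReal_mul (Real.rpow_nonneg (weight_pos s').le _)]
    exact mul_le_mul_left (ENNReal.ofReal_le_ofReal (hD s s')) _
  have h2 : ∀ s', (ENNReal.ofReal (weight s' ^ b) * ∫⁻ s, ‖cutoffKernel X s s'‖ₑ * φ s) ^ 2 ≤
      ENNReal.ofReal D ^ 2 * (2 * ((∫⁻ s, a s) * (∫⁻ s, a (s - s') * ψ s ^ 2) +
        a s' ^ 2 * ((∫⁻ s, c s ^ 2) * ∫⁻ s, ψ s ^ 2))) := by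
    intro s'
    refine (pow_le_pow_left' (h1 s') 2).trans ?_
    rw [mul_pow]
    gcongr
    refine (ennreal_add_sq_le _ _).trans ?_
    rw [mul_pow]
    gcongr
    -- Cauchy-Schwarz with `a = e²` split as `e · e`; integrating over `s'` afterwards yields
    -- Young's inequality for the convolution.
    · have h3 := lintegral_mul_sq_le (μ := volume) (f := fun s => e (s - s'))
        (g := fun s => e (s - s') * ψ s) (by fun_prop) (by fun_prop)
      simp only [← mul_assoc, ← sq, mul_pow, hea] at h3
      rwa [lintegral_sub_right_eq_self] at h3
    · exact lintegral_mul_sq_le hc hψ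
  refine (lintegral_mono h2).trans (le_of_eq ?_)
  have hm : Measurable fun s' => ∫⁻ s, a (s - s') * ψ s ^ 2 := by
    have : Measurable fun y : ℝ × ℝ => a (y.2 - y.1) * ψ y.2 ^ 2 := by fun_prop
    exact this.lintegral_prod_right'
  rw [lintegral_const_mul _ (by fun_prop), lintegral_const_mul _ (by fun_prop),
    lintegral_add_left (by fun_prop), lintegral_const_mul _ (by fun_prop),
    lintegral_mul_const _ (by fun_prop), lintegral_lintegral_swap
    (Measurable.aemeasurable (by simp only [Function.uncurry_def]; fun_prop))]
  have h4 : ∀ s, ∫⁻ s', a (s - s') * ψ s ^ 2 = (∫⁻ t, a t) * ψ s ^ 2 := fun s => by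
    rw [lintegral_mul_const _ (by fun_prop), lintegral_sub_left_eq_self]
  rw [lintegral_congr h4, lintegral_const_mul _ (by fun_prop)]
  change ENNReal.ofReal D ^ 2 * _ = ENNReal.ofReal D ^ 2 * _ * _
  ring

/-! ### The Fourier transform of the cut-off solution. -/

theorem fourierInv_mul_cutoff {X : 𝓢(ℝ, ℂ)} {Φ Ψ : 𝓢(R7, ℂ)}
    (h : ∀ P : R7, Ψ P = (𝓕 X) P.fst * (𝓕 Φ) P) (P : R7) :
    (𝓕⁻ Ψ) P = ∫ σ, X σ * Φ (P - WithLp.toLp 2 (σ, 0)) := by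
  have hc := Real.continuous_fourierChar
  have hX := X.continuous
  have hF := (𝓕 Φ).continuous
  have hcont : Continuous fun y : R7 × ℝ => X y.2 *
      (Real.fourierChar (inner ℝ y.1 (P - WithLp.toLp 2 (y.2, 0))) • (𝓕 Φ) y.1) := by
    fun_prop
  have hint : Integrable (fun y : R7 × ℝ => X y.2 *
      (Real.fourierChar (inner ℝ y.1 (P - WithLp.toLp 2 (y.2, 0))) • (𝓕 Φ) y.1))
      (volume.prod volume) := by
    refine (((𝓕 Φ).integrable (μ := volume)).mul_prod (X.integrable (μ := volume))).mono
      hcont.aestronglyMeasurable (Eventually.of_forall fun y => ?_)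
    rw [norm_mul, norm_mul, Circle.norm_smul, mul_comm]
  have e1 : ∀ v : R7, Real.fourierChar (inner ℝ v P) • Ψ v = ∫ σ, X σ *
      (Real.fourierChar (inner ℝ v (P - WithLp.toLp 2 (σ, 0))) • (𝓕 Φ) v) := by
    intro v
    rw [h, SchwartzMap.fourier_coe, Real.fourier_eq, Circle.smul_def, smul_eq_mul,
      ← integral_mul_const, ← integral_const_mul]
    refine integral_congr_ae (Eventually.of_forall fun σ => ?_)
    have e2 : inner ℝ v (P - WithLp.toLp 2 (σ, 0)) = inner ℝ v P + -(inner ℝ σ v.fst) := by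
      rw [inner_sub_right, WithLp.prod_inner_apply v (WithLp.toLp 2 (σ, 0))]
      change _ - (inner ℝ v.fst σ + inner ℝ v.snd 0) = _
      rw [inner_zero_right, add_zero, real_inner_comm σ v.fst, sub_eq_add_neg]
    simp only [Circle.smul_def, smul_eq_mul]
    rw [e2, AddChar.map_add_eq_mul, Circle.coe_mul]
    ring
  have e3 : ∀ σ, ∫ v : R7, X σ * (Real.fourierChar (inner ℝ v (P - WithLp.toLp 2 (σ, 0))) •
      (𝓕 Φ) v) = X σ * Φ (P - WithLp.toLp 2 (σ, 0)) := by
    intro σ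
    rw [integral_const_mul, ← Real.fourierInv_eq, ← SchwartzMap.fourierInv_coe,
      fourierInv_fourier_eq]
  rw [SchwartzMap.fourierInv_coe, Real.fourierInv_eq, integral_congr_ae (Eventually.of_forall e1),
    integral_integral_swap hint, integral_congr_ae (Eventually.of_forall e3)]

/-- Multiplication by `χ(t)` becomes convolution in `τ` with the inverse transform of `χ`, moved to
the test function. `X` is chosen before the distribution, so that later constants depend on `χ`
only. -/
theorem exists_fourier_cutoff {χ : ℝ → ℝ} (h : ContDiff ℝ ∞ χ) (hc : HasCompactSupport χ) :
    ∃ X : 𝓢(ℝ, ℂ), ∀ (u : 𝓢'(R7, ℂ)) (Φ : 𝓢(R7, ℂ)), ∃ Ψ : 𝓢(R7, ℂ),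
      (𝓕 (cutoff χ u)) Φ = (𝓕 u) Ψ ∧
        ∀ P, Ψ P = ∫ τ, X (P.fst - τ) * Φ (WithLp.toLp 2 (τ, P.snd)) := by
  have h0 : ContDiff ℝ ∞ (fun t : ℝ => (χ t : ℂ)) := Complex.ofRealCLM.contDiff.comp h
  let χ' : 𝓢(ℝ, ℂ) := HasCompactSupport.toSchwartzMap (f := fun t : ℝ => (χ t : ℂ))
    (hc.comp_left (g := Complex.ofReal) rfl) h0
  refine ⟨𝓕⁻ χ', fun u Φ => ⟨𝓕⁻ (SchwartzMap.smulLeftCLM ℂ (fun p : R7 => (χ p.fst : ℂ)) (𝓕 Φ)),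
    ?_, fun P => ?_⟩⟩
  · rw [TemperedDistribution.fourier_apply, TemperedDistribution.fourier_apply,
      fourier_fourierInv_eq]
    rfl
  · rw [fourierInv_mul_cutoff (X := 𝓕⁻ χ') (Φ := Φ)]
    · rw [← integral_sub_left_eq_self _ volume P.fst]
      refine integral_congr_ae (Eventually.of_forall fun τ => ?_)
      have e : P - WithLp.toLp 2 (P.fst - τ, 0) = WithLp.toLp 2 (τ, P.snd) :=
        withLp_prod_ext (sub_sub_cancel P.fst τ) (sub_zero P.snd)
      change _ * Φ (P - WithLp.toLp 2 (P.fst - τ, 0)) = _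
      rw [e]
    · intro v
      rw [fourier_fourierInv_eq, SchwartzMap.smulLeftCLM_apply_apply (hasTemperateGrowth_cutoff h hc)]
      rfl

/-- The exchange of the two frequencies dual to `t`. -/
theorem measurePreserving_exchange : MeasurePreserving
    (fun y : R7 × ℝ => ((WithLp.toLp 2 (y.2, y.1.snd) : R7), y.1.fst))
    (volume.prod volume) (volume.prod volume) := by
  have f1 : MeasurePreserving (Prod.map (WithLp.ofLp : R7 → ℝ × R6) (id : ℝ → ℝ))
      (volume.prod volume) (volume.prod volume) :=
    (WithLp.volume_preserving_ofLp ℝ R6).prod (MeasurePreserving.id _)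
  have f2 : MeasurePreserving (Prod.swap : (ℝ × R6) × ℝ → ℝ × (ℝ × R6)) (volume.prod volume)
      (volume.prod volume) := Measure.measurePreserving_swap
  have f3 : MeasurePreserving (MeasurableEquiv.prodAssoc : (ℝ × ℝ) × R6 ≃ᵐ ℝ × (ℝ × R6))
      (volume.prod volume) (volume.prod (volume.prod volume)) :=
    measurePreserving_prodAssoc volume volume volume
  have f4 : MeasurePreserving (Prod.map (Prod.swap : ℝ × ℝ → ℝ × ℝ) (id : R6 → R6))
      (volume.prod volume) (volume.prod volume) :=
    Measure.measurePreserving_swap.prod (MeasurePreserving.id _)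
  have f5 : MeasurePreserving (Prod.swap : ℝ × (ℝ × R6) → (ℝ × R6) × ℝ) (volume.prod volume)
      (volume.prod volume) := Measure.measurePreserving_swap
  have f6 : MeasurePreserving (Prod.map (WithLp.toLp 2 : ℝ × R6 → R7) (id : ℝ → ℝ))
      (volume.prod volume) (volume.prod volume) :=
    measurePreserving_toLp.prod (MeasurePreserving.id _)
  exact f6.comp (f5.comp (f3.comp (f4.comp (f3.symm.comp (f2.comp f1)))))

theorem exists_norm_le_div_fst_mul_snd (Φ : 𝓢(R7, ℂ)) (N : ℕ) : ∃ D, 0 ≤ D ∧ ∀ P : R7,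
    ‖Φ P‖ ≤ D * ((1 + ‖P.fst‖) ^ (-2 : ℝ) * (1 / (1 + ‖P.snd‖) ^ N)) := by
  obtain ⟨D, hD0, hD⟩ := exists_norm_le_div_one_add_norm_pow Φ (2 + N)
  refine ⟨D, hD0, fun P => (hD P).trans ?_⟩
  rw [div_eq_mul_one_div]
  gcongr
  rw [Real.rpow_neg (by positivity), Real.rpow_ofNat, ← one_div, div_mul_div_comm, one_mul,
    pow_add]
  gcongr
  · exact WithLp.norm_fst_le _ P
  · exact WithLp.norm_snd_le _ P

/-- The Fourier transform of the cut-off solution, by Duhamel's formula. -/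
def duhamel (X : 𝓢(ℝ, ℂ)) (q : R6 → ℝ) (g₀ : R6 → ℂ) (f : R7 → ℂ) (P : R7) : ℂ :=
  X (-(P.fst + q P.snd)) * g₀ P.snd +
    ∫ τ, cutoffKernel X (τ + q P.snd) (P.fst + q P.snd) * f (WithLp.toLp 2 (τ, P.snd))

section Duhamel

variable {X : 𝓢(ℝ, ℂ)} {q : R6 → ℝ} {g₀ : R6 → ℂ} {f : R7 → ℂ} {N : ℕ}

theorem measurable_cutoffKernel_comp (X : 𝓢(ℝ, ℂ)) (hq : Measurable q) :
    Measurable fun y : R7 × ℝ => cutoffKernel X (y.2 + q y.1.snd) (y.1.fst + q y.1.snd) :=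
  Measurable.comp (g := fun y : ℝ × ℝ => cutoffKernel X y.1 y.2)
    (f := fun y : R7 × ℝ => (y.2 + q y.1.snd, y.1.fst + q y.1.snd))
    (measurable_cutoffKernel X) (by fun_prop)

theorem measurable_duhamel (X : 𝓢(ℝ, ℂ)) (hq : Measurable q) (hg : Measurable g₀)
    (hf : Measurable f) : Measurable (duhamel X q g₀ f) := by
  have h1 := measurable_cutoffKernel_comp X hq
  have h2 : Measurable fun y : R7 × ℝ => cutoffKernel X (y.2 + q y.1.snd) (y.1.fst + q y.1.snd) *
      f (WithLp.toLp 2 (y.2, y.1.snd)) := by fun_prop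
  have h3 := (h2.stronglyMeasurable.integral_prod_right' (ν := volume)).measurable
  have h4 := X.continuous.measurable
  have h5 : Measurable fun P : R7 => X (-(P.fst + q P.snd)) * g₀ P.snd := by fun_prop
  exact h5.add h3

theorem integrable_one_add_norm_rpow_neg_two : Integrable fun t : ℝ => (1 + ‖t‖) ^ (-2 : ℝ) :=
  integrable_one_add_norm (by simp)

theorem integrable_initial (hq : Measurable q) (hg : Measurable g₀)
    (hgi : Integrable fun p => ‖g₀ p‖ * (1 / (1 + ‖p‖) ^ N)) (Φ : 𝓢(R7, ℂ)) :
    Integrable fun P : R7 => Φ P * (X (-(P.fst + q P.snd)) * g₀ P.snd) := by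
  obtain ⟨D, hD0, hD⟩ := exists_norm_le_div_fst_mul_snd Φ N
  obtain ⟨B, hB0, hB⟩ := exists_norm_le_div_one_add_norm_pow X 0
  rw [integrable_withLp_prod]
  refine ((integrable_one_add_norm_rpow_neg_two.mul_prod hgi).const_mul (D * B)).mono' ?_
    (Eventually.of_forall fun z => ?_)
  · have h1 := Φ.continuous.measurable
    have h2 := X.continuous.measurable
    exact Measurable.aestronglyMeasurable (by fun_prop)
  · have h1 := hD (WithLp.toLp 2 z)
    have h2 := hB (-(z.1 + q z.2))
    rw [pow_zero, div_one] at h2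
    rw [norm_mul, norm_mul]
    calc _ ≤ D * ((1 + ‖z.1‖) ^ (-2 : ℝ) * (1 / (1 + ‖z.2‖) ^ N)) * (B * ‖g₀ z.2‖) := by
          gcongr
          · exact h1
          · exact h2
          · exact le_rfl
      _ = _ := by ring

/-- Exchanging the two time frequencies turns the bound into a product of the integrability
hypothesis on `f` and an integrable function of the other frequency. The kernel bound is used with
rate `0`, whence the factor `2`. -/
theorem integrable_duhamel_kernel (hq : Measurable q) (hf : Measurable f)
    (hfi : Integrable fun P : R7 => ‖f P‖ / (1 + |P.fst + q P.snd|) * (1 / (1 + ‖P.snd‖) ^ N))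
    (Φ : 𝓢(R7, ℂ)) : Integrable (fun y : R7 × ℝ => Φ y.1 *
      (cutoffKernel X (y.2 + q y.1.snd) (y.1.fst + q y.1.snd) * f (WithLp.toLp 2 (y.2, y.1.snd))))
      (volume.prod volume) := by
  obtain ⟨D, hD0, hD⟩ := exists_norm_le_div_fst_mul_snd Φ N
  obtain ⟨B, hB0, hB⟩ := exists_norm_cutoffKernel_le X 0 le_rfl
  have hk := measurable_cutoffKernel_comp X hq
  have hΦ := Φ.continuous.measurable
  have h1 := (hfi.mul_prod integrable_one_add_norm_rpow_neg_two).const_mul (D * (B * 2))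
  refine ((measurePreserving_exchange.integrable_comp h1.1).2 h1).mono'
    (Measurable.aestronglyMeasurable (by fun_prop)) (Eventually.of_forall fun y => ?_)
  have h2 := hD y.1
  have h3 : ‖cutoffKernel X (y.2 + q y.1.snd) (y.1.fst + q y.1.snd)‖ ≤
      B * 2 * (1 / (1 + |y.2 + q y.1.snd|)) := by
    refine (hB _ _).trans ?_
    rw [neg_zero, Real.rpow_zero, Real.rpow_zero, Real.rpow_neg_one, mul_assoc, one_div]
    have := one_add_abs_le_weight (y.2 + q y.1.snd)
    have h4 : (weight (y.2 + q y.1.snd))⁻¹ ≤ (1 + |y.2 + q y.1.snd|)⁻¹ := by gcongr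
    nlinarith
  rw [norm_mul, norm_mul]
  calc _ ≤ D * ((1 + ‖y.1.fst‖) ^ (-2 : ℝ) * (1 / (1 + ‖y.1.snd‖) ^ N)) *
        (B * 2 * (1 / (1 + |y.2 + q y.1.snd|)) * ‖f (WithLp.toLp 2 (y.2, y.1.snd))‖) := by gcongr
    _ = _ := by
      change _ = D * (B * 2) * (‖f (WithLp.toLp 2 (y.2, y.1.snd))‖ / (1 + |y.2 + q y.1.snd|) *
        (1 / (1 + ‖y.1.snd‖) ^ N) * (1 + ‖y.1.fst‖) ^ (-2 : ℝ))
      ring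

theorem integrable_slice_mul (X : 𝓢(ℝ, ℂ)) (Φ : 𝓢(R7, ℂ)) (p : R6) (s : ℝ) :
    Integrable fun τ => X (s - τ) * Φ (WithLp.toLp 2 (τ, p)) := by
  obtain ⟨D, hD0, hD⟩ := exists_norm_le_div_fst_mul_snd Φ 0
  obtain ⟨B, hB0, hB⟩ := exists_norm_le_div_one_add_norm_pow X 0
  refine (integrable_one_add_norm_rpow_neg_two.const_mul (B * D)).mono'
    (Continuous.aestronglyMeasurable ?_) (Eventually.of_forall fun τ => ?_)
  · have := X.continuous
    have := Φ.continuous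
    fun_prop
  · have h1 := hD (WithLp.toLp 2 (τ, p))
    have h2 := hB (s - τ)
    rw [pow_zero, div_one] at h1 h2
    rw [norm_mul, mul_assoc]
    gcongr
    exact h1.trans_eq (by rw [mul_one]; rfl)

/-- Inserting the convolved test function into `fourier_representation` and applying Fubini moves
the convolution onto the data. The restriction to `τ = -q` produces the second value of `X` in the
kernel. -/
theorem hasFourierFunction_duhamel (hq : q.HasTemperateGrowth) {Λ u : 𝓢'(R7, ℂ)}
    {Λ₀ : 𝓢'(R6, ℂ)} (h0 : HasInitialValue Λ Λ₀) (hgf : HasFourierFunction Λ₀ g₀)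
    (hg : Measurable g₀) (hgi : Integrable fun p => ‖g₀ p‖ * (1 / (1 + ‖p‖) ^ N))
    (hf : Measurable f)
    (hfi : Integrable fun P : R7 => ‖f P‖ / (1 + |P.fst + q P.snd|) * (1 / (1 + ‖P.snd‖) ^ N))
    (hF : ∀ Θ Φ : 𝓢(R7, ℂ), (∀ P, Φ P = (2 * Real.pi * (P.fst + q P.snd) : ℝ) * Θ P) →
      (𝓕 Λ) Φ = ∫ P, Θ P * f P)
    (hu : ∀ Φ : 𝓢(R7, ℂ), ∃ Ψ : 𝓢(R7, ℂ), (𝓕 u) Φ = (𝓕 Λ) Ψ ∧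
      ∀ P, Ψ P = ∫ τ, X (P.fst - τ) * Φ (WithLp.toLp 2 (τ, P.snd))) :
    HasFourierFunction u (duhamel X q g₀ f) := by
  have hqm : Measurable q := hq.1.continuous.measurable
  refine ⟨(measurable_duhamel X hqm hg hf).aestronglyMeasurable, fun Φ => ?_⟩
  have i1 := integrable_initial (X := X) hqm hg hgi Φ
  have i2 := integrable_duhamel_kernel (X := X) hqm hf hfi Φ
  have i3 := i2.integral_prod_left
  simp only [integral_const_mul] at i3
  have e1 : (fun P => Φ P * duhamel X q g₀ f P) = fun P : R7 =>
      Φ P * (X (-(P.fst + q P.snd)) * g₀ P.snd) + Φ P *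
        ∫ τ, cutoffKernel X (τ + q P.snd) (P.fst + q P.snd) * f (WithLp.toLp 2 (τ, P.snd)) := by
    ext P
    rw [duhamel, mul_add]
  rw [e1]
  refine ⟨i1.add i3, ?_⟩
  obtain ⟨Ψ, hΨ, hΨ'⟩ := hu Φ
  rw [hΨ, fourier_representation hq hgf h0 hf.aestronglyMeasurable hfi hF Ψ, integral_add i1 i3]
  congr 1
  · refine Eq.trans ?_ (integral_withLp_prod _).symm
    refine Eq.trans ?_ (integral_prod_symm _ (integrable_withLp_prod.1 i1)).symm
    refine integral_congr_ae (Eventually.of_forall fun p => ?_)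
    simp only [hΨ']
    rw [← integral_mul_const]
    refine integral_congr_ae (Eventually.of_forall fun τ => ?_)
    change X (-q p - τ) * Φ (WithLp.toLp 2 (τ, p)) * g₀ p =
      Φ (WithLp.toLp 2 (τ, p)) * (X (-(τ + q p)) * g₀ p)
    rw [show -q p - τ = -(τ + q p) by ring]
    ring
  · have e2 : ∀ P : R7, Φ P * ∫ τ, cutoffKernel X (τ + q P.snd) (P.fst + q P.snd) *
        f (WithLp.toLp 2 (τ, P.snd)) = ∫ τ, Φ P * (cutoffKernel X (τ + q P.snd)
          (P.fst + q P.snd) * f (WithLp.toLp 2 (τ, P.snd))) := fun P =>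
      (integral_const_mul _ _).symm
    have i4 := (measurePreserving_exchange.integrable_comp i2.1).2 i2
    rw [integral_congr_ae (Eventually.of_forall e2), ← integral_prod _ i2,
      ← measurePreserving_exchange.map_eq, integral_map
      measurePreserving_exchange.measurable.aemeasurable
      (by rw [measurePreserving_exchange.map_eq]; exact i2.1)]
    refine Eq.trans ?_ (integral_prod _ i4).symm
    refine integral_congr_ae (Eventually.of_forall fun P => ?_)
    have hi : ∀ s, Integrable fun τ => X (s - τ) * Φ (WithLp.toLp 2 (τ, P.snd)) :=
      integrable_slice_mul X Φ P.snd
    change (Ψ P - Ψ (WithLp.toLp 2 (-q P.snd, P.snd))) / _ * f P = ∫ τ, _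
    have e4 : Ψ (WithLp.toLp 2 (-q P.snd, P.snd)) =
      ∫ τ, X (-q P.snd - τ) * Φ (WithLp.toLp 2 (τ, P.snd)) := hΨ' _
    rw [hΨ', e4, ← integral_sub (hi _) (hi _), ← integral_div, ← integral_mul_const]
    refine integral_congr_ae (Eventually.of_forall fun τ => ?_)
    change (X (P.fst - τ) * Φ (WithLp.toLp 2 (τ, P.snd)) -
      X (-q P.snd - τ) * Φ (WithLp.toLp 2 (τ, P.snd))) / _ * f P =
      Φ (WithLp.toLp 2 (τ, P.snd)) * (cutoffKernel X (P.fst + q P.snd) (τ + q P.snd) *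
        f (WithLp.toLp 2 (P.fst, P.snd)))
    rw [cutoffKernel, add_sub_add_right_eq_sub, show -q P.snd - τ = -(τ + q P.snd) by ring]
    have e3 : (WithLp.toLp 2 (P.fst, P.snd) : R7) = P := rfl
    rw [e3]
    ring

end Duhamel

/-! ### The energy estimate in `X^b`. -/

theorem lintegral_eq_shifted {q : R6 → ℝ} {F : R7 → ℝ≥0∞} (hF : Measurable F) :
    ∫⁻ P, F P = ∫⁻ p, ∫⁻ s, F (WithLp.toLp 2 (s - q p, p)) := by
  rw [lintegral_withLp_prod' hF]
  exact lintegral_congr fun p => (lintegral_sub_right_eq_self _ (q p)).symm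

theorem lintegral_weight_mul_schwartz_lt_top (X : 𝓢(ℝ, ℂ)) (b : ℝ) :
    ∫⁻ s, (ENNReal.ofReal (weight s ^ b) * ‖X (-s)‖ₑ) ^ 2 < ⊤ := by
  obtain ⟨D, hD0, hD⟩ := exists_norm_le_weight_rpow X (b + 1)
  have hw := measurable_weight
  have h : ∀ s, (ENNReal.ofReal (weight s ^ b) * ‖X (-s)‖ₑ) ^ 2 ≤
      ENNReal.ofReal (D ^ 2) * ENNReal.ofReal (weight s ^ (-2 : ℝ)) := by
    intro s
    have hs := weight_pos s
    have h1 := hD (-s)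
    rw [weight_neg] at h1
    rw [← ofReal_norm, ← ENNReal.ofReal_mul (by positivity), ← ENNReal.ofReal_pow (by positivity),
      ← ENNReal.ofReal_mul (by positivity)]
    refine ENNReal.ofReal_le_ofReal ?_
    calc (weight s ^ b * ‖X (-s)‖) ^ 2 ≤ (weight s ^ b * (D * weight s ^ (-(b + 1)))) ^ 2 := by
          gcongr
      _ = D ^ 2 * (weight s ^ b * weight s ^ (-(b + 1))) ^ 2 := by ring
      _ = _ := by
        rw [← Real.rpow_add hs, ← Real.rpow_natCast (weight s ^ _), ← Real.rpow_mul hs.le]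
        congr 2
        push_cast
        ring
  refine (lintegral_mono h).trans_lt ?_
  rw [lintegral_const_mul _ (by fun_prop)]
  exact ENNReal.mul_lt_top ENNReal.ofReal_lt_top (lintegral_weight_rpow_lt_top (by norm_num))

theorem enorm_ofReal_mul (r : ℝ) (hr : 0 ≤ r) (z : ℂ) :
    ‖(r : ℂ) * z‖ₑ = ENNReal.ofReal r * ‖z‖ₑ := by
  rw [enorm_mul, enorm_ofReal_complex, Real.enorm_eq_ofReal hr]

/-- For fixed `p` the variable `s = τ + q(p)` makes the weights independent of `p` apart from the
factor `v p`. The estimate reduces to one dimension, with a constant independent of `q` and `v`. -/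
theorem exists_eLpNorm_duhamel_le (X : 𝓢(ℝ, ℂ)) {b : ℝ} (hb : 1 / 2 < b) : ∃ D : ℝ≥0,
    ∀ {q v : R6 → ℝ} {g₀ : R6 → ℂ} {f : R7 → ℂ}, Measurable q → Measurable v → (∀ p, 0 ≤ v p) →
      Measurable g₀ → Measurable f →
      eLpNorm (fun P => ((weight (P.fst + q P.snd) ^ b * v P.snd : ℝ) : ℂ) * duhamel X q g₀ f P) 2
        volume ≤ D * (eLpNorm (fun p => (v p : ℂ) * g₀ p) 2 volume +
          eLpNorm (fun P => ((weight (P.fst + q P.snd) ^ (b - 1) * v P.snd : ℝ) : ℂ) * f P) 2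
            volume) := by
  obtain ⟨D, hD⟩ := exists_lintegral_cutoffKernel_le X hb
  have hA := lintegral_weight_mul_schwartz_lt_top X b
  set A := ∫⁻ s, (ENNReal.ofReal (weight s ^ b) * ‖X (-s)‖ₑ) ^ 2 with hA'
  -- The factor `2` comes from squaring the sum of the initial and source terms; `A` bounds the
  -- former and `D` the latter.
  refine ⟨NNReal.sqrt (2 * max A.toNNReal D), fun {q v g₀ f} hq hv hv0 hg hf => ?_⟩
  have hw := measurable_weight
  have hX := X.continuous.measurable
  have hk := measurable_cutoffKernel X
  have hH := measurable_duhamel X hq hg hf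
  have hw0 : ∀ s r : ℝ, 0 ≤ weight s ^ r := fun s r => Real.rpow_nonneg (weight_pos s).le r
  have hM : ∀ x y : ℝ≥0∞, 2 * (A * x ^ 2 + D * y ^ 2) ≤
      (NNReal.sqrt (2 * max A.toNNReal D) * (x + y)) ^ 2 := by
    intro x y
    rw [mul_pow, ← ENNReal.coe_pow, NNReal.sq_sqrt, ENNReal.coe_mul, ENNReal.coe_ofNat, mul_assoc]
    gcongr
    calc A * x ^ 2 + D * y ^ 2 ≤ (max A.toNNReal D : ℝ≥0) * x ^ 2 +
          (max A.toNNReal D : ℝ≥0) * y ^ 2 := by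
          gcongr
          · rw [← ENNReal.coe_toNNReal hA.ne, ENNReal.toNNReal_coe]
            exact ENNReal.coe_le_coe.2 (le_max_left _ _)
          · exact le_max_right _ _
      _ = (max A.toNNReal D : ℝ≥0) * (x ^ 2 + y ^ 2) := by ring
      _ ≤ _ := by
          gcongr
          calc x ^ 2 + y ^ 2 ≤ x ^ 2 + y ^ 2 + 2 * x * y := le_self_add
            _ = _ := by ring
  refine (ENNReal.pow_le_pow_left_iff two_ne_zero).1 (le_trans ?_ (hM _ _))
  rw [eLpNorm_two_sq, eLpNorm_two_sq, eLpNorm_two_sq, lintegral_eq_shifted (q := q) (by fun_prop),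
    lintegral_eq_shifted (q := q) (F := fun P : R7 => ‖((weight (P.fst + q P.snd) ^ (b - 1) *
      v P.snd : ℝ) : ℂ) * f P‖ₑ ^ 2) (by fun_prop)]
  have hm : Measurable fun p : R6 => ∫⁻ s, ‖((weight (s - q p + q p) ^ (b - 1) * v p : ℝ) : ℂ) *
      f (WithLp.toLp 2 (s - q p, p))‖ₑ ^ 2 := by
    have : Measurable fun y : R6 × ℝ =>
      ‖((weight (y.2 - q y.1 + q y.1) ^ (b - 1) * v y.1 : ℝ) : ℂ) * f (WithLp.toLp 2 (y.2 - q y.1, y.1))‖ₑ ^ 2 := by fun_prop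
    exact this.lintegral_prod_right'
  have hslice : ∀ p : R6, ∫⁻ s', ‖((weight (s' - q p + q p) ^ b * v p : ℝ) : ℂ) *
      duhamel X q g₀ f (WithLp.toLp 2 (s' - q p, p))‖ₑ ^ 2 ≤
      2 * (A * ‖(v p : ℂ) * g₀ p‖ₑ ^ 2 + D * ∫⁻ s,
        ‖((weight (s - q p + q p) ^ (b - 1) * v p : ℝ) : ℂ) * f (WithLp.toLp 2 (s - q p, p))‖ₑ ^ 2) := by
    intro p
    let φ : ℝ → ℝ≥0∞ := fun s => ‖f (WithLp.toLp 2 (s - q p, p))‖ₑ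
    have hφ : Measurable φ := by fun_prop
    have h1 : ∀ s', ‖((weight (s' - q p + q p) ^ b * v p : ℝ) : ℂ) *
        duhamel X q g₀ f (WithLp.toLp 2 (s' - q p, p))‖ₑ ^ 2 ≤ ENNReal.ofReal (v p) ^ 2 *
        (2 * ((ENNReal.ofReal (weight s' ^ b) * ‖X (-s')‖ₑ) ^ 2 * ‖g₀ p‖ₑ ^ 2 +
          (ENNReal.ofReal (weight s' ^ b) * ∫⁻ s, ‖cutoffKernel X s s'‖ₑ * φ s) ^ 2)) := by
      intro s'
      have h2 : ‖duhamel X q g₀ f (WithLp.toLp 2 (s' - q p, p))‖ₑ ≤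
          ‖X (-s')‖ₑ * ‖g₀ p‖ₑ + ∫⁻ s, ‖cutoffKernel X s s'‖ₑ * φ s := by
        change ‖X (-(s' - q p + q p)) * g₀ p + ∫ τ, cutoffKernel X (τ + q p) (s' - q p + q p) *
          f (WithLp.toLp 2 (τ, p))‖ₑ ≤ _
        rw [sub_add_cancel]
        refine (enorm_add_le _ _).trans ?_
        rw [enorm_mul]
        gcongr
        refine (enorm_integral_le_lintegral_enorm _).trans (le_of_eq ?_)
        rw [← lintegral_sub_right_eq_self _ (q p)]
        simp only [enorm_mul, sub_add_cancel, φ]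
      rw [sub_add_cancel, enorm_ofReal_mul _ (mul_nonneg (hw0 _ _) (hv0 p)),
        ENNReal.ofReal_mul (hw0 _ _), mul_comm (ENNReal.ofReal (weight s' ^ b)), mul_assoc, mul_pow]
      gcongr
      rw [← mul_pow]
      refine le_trans (pow_le_pow_left' ?_ 2) (ennreal_add_sq_le _ _)
      rw [mul_assoc, ← mul_add]
      gcongr
    refine (lintegral_mono h1).trans ?_
    have hmk : Measurable fun s' => ∫⁻ s, ‖cutoffKernel X s s'‖ₑ * φ s := by
      have : Measurable fun y : ℝ × ℝ => ‖cutoffKernel X y.2 y.1‖ₑ * φ y.2 :=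
        ((hk.comp measurable_swap).enorm).mul (hφ.comp measurable_snd)
      exact this.lintegral_prod_right'
    rw [lintegral_const_mul _ (by fun_prop), lintegral_const_mul _ (by fun_prop),
      lintegral_add_left (by fun_prop), lintegral_mul_const _ (by fun_prop), ← hA']
    have e1 : ∀ s, ‖((weight (s - q p + q p) ^ (b - 1) * v p : ℝ) : ℂ) *
        f (WithLp.toLp 2 (s - q p, p))‖ₑ ^ 2 = ENNReal.ofReal (v p) ^ 2 *
          (ENNReal.ofReal (weight s ^ (b - 1)) * φ s) ^ 2 := by
      intro s
      rw [sub_add_cancel, enorm_ofReal_mul _ (mul_nonneg (hw0 _ _) (hv0 p)),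
        ENNReal.ofReal_mul (hw0 _ _)]
      ring
    rw [lintegral_congr e1, lintegral_const_mul _ (by fun_prop),
      enorm_ofReal_mul _ (hv0 p), mul_pow (ENNReal.ofReal (v p)) ‖g₀ p‖ₑ]
    calc _ ≤ ENNReal.ofReal (v p) ^ 2 * (2 * (A * ‖g₀ p‖ₑ ^ 2 +
          D * ∫⁻ s, (ENNReal.ofReal (weight s ^ (b - 1)) * φ s) ^ 2)) := by
          gcongr
          exact hD φ hφ
      _ = _ := by ring
  refine (lintegral_mono hslice).trans (le_of_eq ?_)
  rw [lintegral_const_mul _ (by fun_prop), lintegral_add_left (by fun_prop),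
    lintegral_const_mul _ (by fun_prop), lintegral_const_mul _ hm]
  rfl

/-! ### Integrability of the data, and the bound of the cut-off solution. -/

theorem lintegral_decay_sq_lt_top :
    ∫⁻ p : R6, ENNReal.ofReal ((1 / (1 + ‖p‖) ^ 4) ^ 2) < ⊤ := by
  have h := finite_integral_one_add_norm (E := R6) (μ := volume) (r := 8) (by
    rw [(WithLp.linearEquiv 2 ℝ (R3 × R3)).finrank_eq, Module.finrank_prod]
    simp
    norm_num)
  refine lt_of_le_of_lt (lintegral_mono fun p => le_of_eq ?_) h
  rw [Real.rpow_neg (by positivity), Real.rpow_ofNat, div_pow, one_pow, ← pow_mul, one_div]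

theorem memLp_two_of_lintegral {α : Type*} [MeasurableSpace α] {μ : Measure α} {h : α → ℝ}
    (hm : Measurable h) (hi : ∫⁻ x, ‖h x‖ₑ ^ 2 ∂μ < ⊤) : MemLp h 2 μ := by
  refine ⟨hm.aestronglyMeasurable, lt_top_iff_ne_top.2 fun htop => ?_⟩
  rw [← eLpNorm_two_sq, htop, ENNReal.top_pow two_ne_zero] at hi
  exact hi.ne rfl

theorem integrable_initial_decay {v : R6 → ℝ} {g₀ : R6 → ℂ} (hv : ∀ p, 1 ≤ v p)
    (hg : Measurable g₀) (h : eLpNorm (fun p => (v p : ℂ) * g₀ p) 2 volume < ⊤) :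
    Integrable fun p => ‖g₀ p‖ * (1 / (1 + ‖p‖) ^ 4) := by
  have h1 : MemLp (fun p => ‖g₀ p‖) 2 volume := by
    refine ⟨hg.norm.aestronglyMeasurable, lt_of_le_of_lt (eLpNorm_mono fun p => ?_) h⟩
    rw [norm_norm, norm_mul, Complex.norm_real, Real.norm_of_nonneg (zero_le_one.trans (hv p))]
    exact le_mul_of_one_le_left (norm_nonneg _) (hv p)
  refine h1.integrable_mul (memLp_two_of_lintegral (by fun_prop) ?_)
  refine lt_of_le_of_lt (lintegral_mono fun p => le_of_eq ?_) lintegral_decay_sq_lt_top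
  rw [Real.enorm_eq_ofReal (by positivity), ← ENNReal.ofReal_pow (by positivity)]

/-- Cauchy-Schwarz for `weight ^ (b - 1) * |f|` and `weight ^ (-b) * (1 + ‖p‖)^{-4}`. The second is
square integrable because `2b > 1` in the shifted time frequency and `8 > 6` in `p`. -/
theorem integrable_source_decay {q v : R6 → ℝ} {f : R7 → ℂ} {b : ℝ} (hb : 1 / 2 < b)
    (hq : Measurable q) (hv : ∀ p, 1 ≤ v p) (hf : Measurable f)
    (h : eLpNorm (fun P => ((weight (P.fst + q P.snd) ^ (b - 1) * v P.snd : ℝ) : ℂ) * f P) 2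
      volume < ⊤) :
    Integrable fun P : R7 => ‖f P‖ / (1 + |P.fst + q P.snd|) * (1 / (1 + ‖P.snd‖) ^ 4) := by
  have hw := measurable_weight
  have hpos := fun P : R7 => weight_pos (P.fst + q P.snd)
  have h1 : MemLp (fun P : R7 => weight (P.fst + q P.snd) ^ (b - 1) * ‖f P‖) 2 volume := by
    refine ⟨Measurable.aestronglyMeasurable (by fun_prop), lt_of_le_of_lt
      (eLpNorm_mono fun P => ?_) h⟩
    have h2 : 0 ≤ weight (P.fst + q P.snd) ^ (b - 1) := Real.rpow_nonneg (hpos P).le _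
    have h3 := zero_le_one.trans (hv P.snd)
    rw [norm_mul, norm_norm, norm_mul, Complex.norm_real, norm_mul, Real.norm_of_nonneg h2,
      Real.norm_of_nonneg h3]
    gcongr
    exact le_mul_of_one_le_right h2 (hv P.snd)
  have h2 : MemLp (fun P : R7 => weight (P.fst + q P.snd) ^ (-b) * (1 / (1 + ‖P.snd‖) ^ 4)) 2
      volume := by
    refine memLp_two_of_lintegral (by fun_prop) ?_
    rw [lintegral_eq_shifted (q := q) (by fun_prop)]
    have e : ∀ (p : R6) (s : ℝ), ‖weight (s - q p + q p) ^ (-b) * (1 / (1 + ‖p‖) ^ 4)‖ₑ ^ 2 =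
        ENNReal.ofReal (weight s ^ (-(2 * b))) * ENNReal.ofReal ((1 / (1 + ‖p‖) ^ 4) ^ 2) := by
      intro p s
      have hs := weight_pos s
      have hs' : 0 ≤ weight s ^ (-b) := Real.rpow_nonneg hs.le _
      rw [sub_add_cancel, Real.enorm_eq_ofReal (by positivity), ← ENNReal.ofReal_pow (by positivity),
        ← ENNReal.ofReal_mul (Real.rpow_nonneg hs.le _), mul_pow, ← Real.rpow_natCast (weight s ^ _),
        ← Real.rpow_mul hs.le]
      congr 3
      push_cast
      ring
    change ∫⁻ p : R6, ∫⁻ s : ℝ, ‖weight (s - q p + q p) ^ (-b) * (1 / (1 + ‖p‖) ^ 4)‖ₑ ^ 2 < ⊤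
    simp_rw [e]
    have e2 : ∀ p : R6, ∫⁻ s, ENNReal.ofReal (weight s ^ (-(2 * b))) *
        ENNReal.ofReal ((1 / (1 + ‖p‖) ^ 4) ^ 2) = (∫⁻ s, ENNReal.ofReal (weight s ^ (-(2 * b)))) *
        ENNReal.ofReal ((1 / (1 + ‖p‖) ^ 4) ^ 2) := fun p => lintegral_mul_const _ (by fun_prop)
    rw [lintegral_congr e2, lintegral_const_mul _ (by fun_prop)]
    exact ENNReal.mul_lt_top (lintegral_weight_rpow_lt_top (by linarith)) lintegral_decay_sq_lt_top
  refine ((h1.integrable_mul h2).const_mul 7).mono' (Measurable.aestronglyMeasurable (by fun_prop))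
    (Eventually.of_forall fun P => ?_)
  have hP := hpos P
  have h3 : 1 / (1 + |P.fst + q P.snd|) ≤ 7 * (weight (P.fst + q P.snd))⁻¹ := by
    rw [← div_eq_mul_inv, div_le_div_iff₀ (by positivity) hP, one_mul]
    exact weight_le _
  have h4 : weight (P.fst + q P.snd) ^ (b - 1) * weight (P.fst + q P.snd) ^ (-b) =
      (weight (P.fst + q P.snd))⁻¹ := by
    rw [← Real.rpow_add hP, ← Real.rpow_neg_one]
    congr 1
    ring
  rw [Real.norm_of_nonneg (by positivity)]
  calc _ = ‖f P‖ * (1 / (1 + |P.fst + q P.snd|)) * (1 / (1 + ‖P.snd‖) ^ 4) := by ring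
    _ ≤ ‖f P‖ * (7 * (weight (P.fst + q P.snd))⁻¹) * (1 / (1 + ‖P.snd‖) ^ 4) := by gcongr
    _ = _ := by
      rw [← h4]
      simp only [Pi.mul_apply]
      ring

theorem exists_fourierNorm_cutoff_le {χ : ℝ → ℝ} (hχ : ContDiff ℝ ∞ χ) (hc : HasCompactSupport χ)
    {b : ℝ} (hb : 1 / 2 < b) : ∃ D : ℝ≥0, ∀ {q v : R6 → ℝ}, q.HasTemperateGrowth → Measurable v →
      (∀ p, 1 ≤ v p) → ∀ {Λ F : 𝓢'(R7, ℂ)} {Λ₀ : 𝓢'(R6, ℂ)}, HasInitialValue Λ Λ₀ →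
      (∀ Θ Φ : 𝓢(R7, ℂ), (∀ P, Φ P = (2 * Real.pi * (P.fst + q P.snd) : ℝ) * Θ P) →
        (𝓕 Λ) Φ = (𝓕 F) Θ) →
      fourierNorm (fun P => weight (P.fst + q P.snd) ^ b * v P.snd) (cutoff χ Λ) ≤
        D * (fourierNorm v Λ₀ +
          fourierNorm (fun P => weight (P.fst + q P.snd) ^ (b - 1) * v P.snd) F) := by
  obtain ⟨X, hX⟩ := exists_fourier_cutoff hχ hc
  obtain ⟨D, hD⟩ := exists_eLpNorm_duhamel_le X hb
  -- A positive constant is needed so that the right-hand side is infinite when one of the norms of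
  -- the data is.
  refine ⟨max D 1, fun {q v} hq hv hv1 {Λ F Λ₀} h0 hF => ?_⟩
  rcases eq_or_ne (fourierNorm v Λ₀ +
    fourierNorm (fun P => weight (P.fst + q P.snd) ^ (b - 1) * v P.snd) F) ⊤ with htop | htop
  · rw [htop, ENNReal.mul_top]
    · exact le_top
    · exact_mod_cast (zero_lt_one.trans_le (le_max_right D 1)).ne'
  obtain ⟨ht1, ht2⟩ := ENNReal.add_ne_top.1 htop
  obtain ⟨g₀, hg, hgf, hgn⟩ := exists_hasFourierFunction ht1
  obtain ⟨f, hf, hff, hfn⟩ := exists_hasFourierFunction ht2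
  have hqm : Measurable q := hq.1.continuous.measurable
  have hH := hasFourierFunction_duhamel (X := X) (u := cutoff χ Λ) hq h0 hgf hg.measurable
    (integrable_initial_decay hv1 hg.measurable (hgn ▸ ht1.lt_top)) hf.measurable
    (integrable_source_decay hb hqm hv1 hf.measurable (hfn ▸ ht2.lt_top))
    (fun Θ Φ hΦ => (hF Θ Φ hΦ).trans (hff.2 Θ).2) (hX Λ)
  rw [fourierNorm_eq hH, ← hgn, ← hfn]
  refine (hD hqm hv (fun p => zero_le_one.trans (hv1 p)) hg.measurable hf.measurable).trans ?_
  gcongr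
  exact le_max_left _ _

theorem exists_normXS_cutoff_le {ε δ : ℝ} (hε : 0 < ε) (hδ : 0 < δ) {χ : ℝ → ℝ}
    (hχ : ContDiff ℝ ∞ χ) (hc : HasCompactSupport χ) : ∃ C : ℝ≥0,
    ∀ (Λ F : 𝓢'(R7, ℂ)) (Λ₀ : 𝓢'(R6, ℂ)), opS Λ = F → HasInitialValue Λ Λ₀ →
      normXS (1 / 2 + ε) (1 / 2 + δ) (cutoff χ Λ) ≤
        C * (fourierNorm (japSymbol2 (1 / 2 + ε)) Λ₀ + normXS (1 / 2 + ε) (-1 / 2 + δ) F) := by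
  obtain ⟨D, hD⟩ := exists_fourierNorm_cutoff_le hχ hc (b := 1 / 2 + δ) (by linarith)
  refine ⟨D, fun Λ F Λ₀ hΛ h0 => ?_⟩
  have h := hD hasTemperateGrowth_freqS (measurable_japSymbol2 (1 / 2 + ε))
    (one_le_japSymbol2 (by positivity)) h0 (F := F) fun Θ Φ hΦ =>
      fourier_apply_of_opS hΛ fun P => by rw [symbolS_eq, hΦ P]
  have e : 1 / 2 + δ - 1 = -1 / 2 + δ := by ring
  simp only [normXS, symbolS_eq]
  rwa [e] at h

theorem exists_normXW_cutoff_le {ε δ : ℝ} (hε : 0 < ε) (hδ : 0 < δ) {χ : ℝ → ℝ}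
    (hχ : ContDiff ℝ ∞ χ) (hc : HasCompactSupport χ) : ∃ C : ℝ≥0,
    ∀ (Γ F : 𝓢'(R7, ℂ)) (Γ₀ : 𝓢'(R6, ℂ)), opW Γ = F → HasInitialValue Γ Γ₀ →
      normXW (1 / 2 + ε) (1 / 2 + δ) (cutoff χ Γ) ≤
        C * (fourierNorm (japSymbol2 (1 / 2 + ε)) Γ₀ + normXW (1 / 2 + ε) (-1 / 2 + δ) F) := by
  obtain ⟨D, hD⟩ := exists_fourierNorm_cutoff_le hχ hc (b := 1 / 2 + δ) (by linarith)
  refine ⟨D, fun Γ F Γ₀ hΓ h0 => ?_⟩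
  have h := hD hasTemperateGrowth_freqW (measurable_japSymbol2 (1 / 2 + ε))
    (one_le_japSymbol2 (by positivity)) h0 (F := F) fun Θ Φ hΦ =>
      fourier_apply_of_opW hΓ fun P => by rw [symbolW_eq, hΦ P]
  have e : 1 / 2 + δ - 1 = -1 / 2 + δ := by ring
  simp only [normXW, symbolW_eq]
  rwa [e] at h

end Collapsing

end

theorem mainTheorem8 :
    -- free solutions of `S Λ = 0`
    (∃ C : ℝ≥0, ∀ (Λ : 𝓢'(R7, ℂ)) (Λ₀ : 𝓢'(R6, ℂ)),
      opS Λ = 0 → HasInitialValue Λ Λ₀ →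
        (fourierNorm (fun p => homSymbol (1 / 2) (p.fst - p.snd)) Λ₀ ≠ ⊤ →
          ∃ G : R3 → 𝓢'(R4, ℂ), IsCollapse Λ G ∧
            l2Norm (G 0) ≤
              C * fourierNorm
                (fun p => homSymbol (1 / 2) (p.fst - p.snd)) Λ₀) ∧
        (fourierNorm
            (fun p => homSymbol (1 / 2) p.fst * homSymbol (1 / 2) p.snd) Λ₀ ≠ ⊤ →
          ∃ G : R3 → 𝓢'(R4, ℂ), IsCollapse Λ G ∧
            fourierNorm (fun q => homSymbol (1 / 2) q.snd) (G 0) ≤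
              C * fourierNorm
                (fun p => homSymbol (1 / 2) p.fst * homSymbol (1 / 2) p.snd) Λ₀)) ∧
    -- solutions of `S Λ = F`
    (∀ ε : ℝ, 0 < ε → ∀ δ : ℝ, 0 < δ → ∃ C₁ : ℝ≥0,
      ∀ χ : ℝ → ℝ, ContDiff ℝ ∞ χ → HasCompactSupport χ → ∃ C₂ : ℝ≥0,
      ∀ (Λ F : 𝓢'(R7, ℂ)) (Λ₀ : 𝓢'(R6, ℂ)),
        opS Λ = F → HasInitialValue Λ Λ₀ →
          (normXS (1 / 2 + ε) (1 / 2 + δ) (cutoff χ Λ) ≠ ⊤ →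
            ∃ G : R3 → 𝓢'(R4, ℂ),
              IsCollapse (cutoff χ Λ) G ∧
              (⨆ z, fourierNorm
                  (fun q => japSymbol (1 / 2 + ε) q.snd) (G z)) ≤
                C₁ * normXS (1 / 2 + ε) (1 / 2 + δ) (cutoff χ Λ)) ∧
          normXS (1 / 2 + ε) (1 / 2 + δ) (cutoff χ Λ) ≤
            C₂ * (fourierNorm (japSymbol2 (1 / 2 + ε)) Λ₀ +
              normXS (1 / 2 + ε) (-1 / 2 + δ) F)) ∧
    -- free solutions of `S_± Γ = 0`
    (∀ ε : ℝ, 0 < ε → ∃ C : ℝ≥0,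
      ∀ (Γ : 𝓢'(R7, ℂ)) (Γ₀ : 𝓢'(R6, ℂ)),
        opW Γ = 0 → HasInitialValue Γ Γ₀ →
          fourierNorm (japSymbol2 (1 / 2 + ε)) Γ₀ ≠ ⊤ →
            ∃ G : R3 → 𝓢'(R4, ℂ), IsCollapse Γ G ∧
              fourierNorm (fun q => homSymbol (1 / 2 + ε) q.snd) (G 0) +
                  fourierNorm (fun q => homSymbol (1 / 2) q.snd) (G 0) ≤
                C * fourierNorm (japSymbol2 (1 / 2 + ε)) Γ₀) ∧
    -- solutions of `S_± Γ = F`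
    (∀ ε : ℝ, 0 < ε → ∀ δ : ℝ, 0 < δ → ∃ C₁ : ℝ≥0,
      ∀ χ : ℝ → ℝ, ContDiff ℝ ∞ χ → HasCompactSupport χ → ∃ C₂ : ℝ≥0,
      ∀ (Γ F : 𝓢'(R7, ℂ)) (Γ₀ : 𝓢'(R6, ℂ)),
        opW Γ = F → HasInitialValue Γ Γ₀ →
          (normXW (1 / 2 + ε) (1 / 2 + δ) (cutoff χ Γ) ≠ ⊤ →
            ∃ G : R3 → 𝓢'(R4, ℂ),
              IsCollapse (cutoff χ Γ) G ∧
              (⨆ z, fourierNorm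
                  (fun q => homSymbol (1 / 2 + ε) q.snd) (G z)) +
                (⨆ z, fourierNorm
                  (fun q => homSymbol (1 / 2) q.snd) (G z)) ≤
                C₁ * normXW (1 / 2 + ε) (1 / 2 + δ) (cutoff χ Γ)) ∧
          normXW (1 / 2 + ε) (1 / 2 + δ) (cutoff χ Γ) ≤
            C₂ * (fourierNorm (japSymbol2 (1 / 2 + ε)) Γ₀ +
              normXW (1 / 2 + ε) (-1 / 2 + δ) F)) := by
  refine ⟨collapsing_free_S, fun ε hε δ hδ => ?_, fun ε hε => collapsing_free_W hε,
    fun ε hε δ hδ => ?_⟩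
  · obtain ⟨C₁, hC₁⟩ := collapsing_normXS hε hδ
    refine ⟨C₁, fun χ hχ hc => ?_⟩
    obtain ⟨C₂, hC₂⟩ := exists_normXS_cutoff_le hε hδ hχ hc
    exact ⟨C₂, fun Λ F Λ₀ hΛ h0 => ⟨hC₁ _, hC₂ Λ F Λ₀ hΛ h0⟩⟩
  · obtain ⟨C₁, hC₁⟩ := collapsing_normXW hε hδ
    refine ⟨C₁, fun χ hχ hc => ?_⟩
    obtain ⟨C₂, hC₂⟩ := exists_normXW_cutoff_le hε hδ hχ hc
    exact ⟨C₂, fun Γ F Γ₀ hΓ h0 => ⟨hC₁ _, hC₂ Γ F Γ₀ hΓ h0⟩⟩
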